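/- Let $\alpha>0$ and let $\gamma:\mathbb{R}\to\mathbb{R}^2$ be a continuous, piecewise $C^1$ curve parametrized by its arc length (so $|\gamma'|=1$ away from the break points, which form a locally finite set), with range $\Gamma$. Suppose that (a1) there is $c\in(0,1)$ such that $|\gamma(s)-\gamma(s')|\ge c\,|s-s'|$ for all $s,s'\in\mathbb{R}$; (a2) there are $d>0$, $\mu>0$ and $\omega\in(0,1)$ such that $$1-\frac{|\gamma(s)-\gamma(s')|}{|s-s'|}\le d\,\bigl[1+|s+s'|^{2\mu}\bigr]^{-1/2}$$ for all $s\ne s'$ with $\omega<s/s'<\omega^{-1}$. Let $m$ be the measure $m(M)=\ell_1(M\cap\Gamma)$ on $\mathbb{R}^2$, where $\ell_1$ is the one-dimensional Hausdorff measure, and let $I_m:W_{1,2}(\mathbb{R}^2)\to L^2(m)$ be the extension by density of the map that sends a Schwartz function to its class in $L^2(m)$. Then the form $$\mathcal{E}(\psi,\phi)=\int_{\mathbb{R}^2}\overline{\nabla\psi}\cdot\nabla\phi\,dx-\alpha\int_{\mathbb{R}^2}\overline{I_m\psi}\;I_m\phi\,dm,\qquad \psi,\phi\in W_{1,2}(\mathbb{R}^2),$$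 is associated with a unique self-adjoint operator $H_{\alpha,\gamma}=-\Delta-\alpha\,\delta(x-\Gamma)$ in $L^2(\mathbb{R}^2)$ (that is, $u\in D(H_{\alpha,\gamma})$ and $H_{\alpha,\gamma}u=f$ if and only if $u\in W_{1,2}(\mathbb{R}^2)$ and $\mathcal{E}(w,u)=\langle w,f\rangle$ for all $w\in W_{1,2}(\mathbb{R}^2)$), and its essential spectrum (the spectrum without the isolated eigenvalues of finite multiplicity) is $$\sigma_{\rm ess}(H_{\alpha,\gamma})=\bigl[-\tfrac14\alpha^2,\infty\bigr).$$ -/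

import Mathlib

open MeasureTheory Filter Topology
open scoped SchwartzMap LineDeriv ENNReal

noncomputable section

namespace LeakyWire

/-! ### Unbounded operators: resolvent set, spectrum, discrete and essential spectrum -/

section Spectrum

variable {X : Type*} [NormedAddCommGroup X] [InnerProductSpace ℂ X]

/-- `z` is in the resolvent set of `T` if `T - z : D(T) → X` is a bijection with a bounded
inverse `R`. -/
def resolventSet (T : X →ₗ.[ℂ] X) : Set ℂ :=
  {z | ∃ R : X →L[ℂ] X,
    (∀ u : T.domain, R (T u - z • (u : X)) = u) ∧
    ∀ f : X, ∃ u : T.domain, (u : X) = R f ∧ T u - z • (u : X) = f}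

def spectrum (T : X →ₗ.[ℂ] X) : Set ℂ := (resolventSet T)ᶜ

/-- The kernel of `T - z`. -/
def eigenspace (T : X →ₗ.[ℂ] X) (z : ℂ) : Submodule ℂ T.domain :=
  LinearMap.ker (T.toFun - z • T.domain.subtype)

/-- The isolated points of the spectrum that are eigenvalues of finite multiplicity. -/
def discreteSpectrum (T : X →ₗ.[ℂ] X) : Set ℂ :=
  {z | z ∈ spectrum T ∧ (∀ᶠ w in 𝓝[≠] z, w ∉ spectrum T) ∧
    eigenspace T z ≠ ⊥ ∧ FiniteDimensional ℂ (eigenspace T z)}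

/-- The essential spectrum (of a self-adjoint operator). -/
def essentialSpectrum (T : X →ₗ.[ℂ] X) : Set ℂ := spectrum T \ discreteSpectrum T

end Spectrum

/-! ### The Sobolev space, the trace map `I_m`, and the operator of the form -/

/-- The Euclidean plane. -/
abbrev Plane : Type := EuclideanSpace ℝ (Fin 2)

/-- The Hilbert space `L²(ℝ²)`. -/
abbrev L2Plane : Type := Lp ℂ 2 (volume : Measure Plane)

/-- The `i`-th standard basis vector of the plane. -/
def e (i : Fin 2) : Plane := EuclideanSpace.single i 1

/-- `u` belongs to `W_{1,2}(ℝ²)` and `g` is its weak gradient. -/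
def HasWeakGradient (u : L2Plane) (g : Fin 2 → L2Plane) : Prop :=
  ∀ (i : Fin 2) (φ : 𝓢(Plane, ℂ)),
    ∫ x, u x * (∂_{e i} φ) x = -∫ x, g i x * φ x

/-- `v ∈ L²(m)` is the trace `I_m u` of the function `u ∈ W_{1,2}(ℝ²)` with weak gradient `g`:
the map `I_m` is the extension by density, from `𝓢(ℝ²)` with the norm of `W_{1,2}(ℝ²)`, of the map
that sends a Schwartz function to its class in `L²(m)`. -/
def IsTrace (m : Measure Plane) (u : L2Plane) (g : Fin 2 → L2Plane) (v : Lp ℂ 2 m) : Prop :=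
  ∃ φ : ℕ → 𝓢(Plane, ℂ),
    Tendsto (fun n => (φ n).toLp 2 volume) atTop (𝓝 u) ∧
    (∀ i, Tendsto (fun n => (∂_{e i} (φ n)).toLp 2 volume) atTop (𝓝 (g i))) ∧
    Tendsto (fun n => eLpNorm (fun x => φ n x - v x) 2 m) atTop (𝓝 0)

/-- The value `∫ conj(∇w) · ∇u dx - α ∫ conj(I_m w) (I_m u) dm` of the quadratic form, where `h`,
`g` are the gradients and `z`, `v` the traces of `w` and `u`. -/
def formValue (α : ℝ) (m : Measure Plane) (h g : Fin 2 → L2Plane) (z v : Lp ℂ 2 m) : ℂ :=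
  (∑ i, inner ℂ (h i) (g i)) - (α : ℂ) * inner ℂ z v

/-- `H` is the operator associated with the form with parameters `α`, `m` and domain
`W_{1,2}(ℝ²)`: `u ∈ D(H)` and `H u = f` if and only if `u` is in the form domain and
`form(w, u) = ⟨w, f⟩` for every `w` in the form domain. -/
def IsFormOperator (α : ℝ) (m : Measure Plane) (H : L2Plane →ₗ.[ℂ] L2Plane) : Prop :=
  ∀ u f : L2Plane, (u, f) ∈ H.graph ↔
    ∃ (g : Fin 2 → L2Plane) (v : Lp ℂ 2 m), HasWeakGradient u g ∧ IsTrace m u g v ∧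
      ∀ (w : L2Plane) (h : Fin 2 → L2Plane) (z : Lp ℂ 2 m),
        HasWeakGradient w h → IsTrace m w h z → formValue α m h g z v = inner ℂ w f

/-- There is at most one operator associated with the form. -/
theorem IsFormOperator.unique {α : ℝ} {m : Measure Plane} {H H' : L2Plane →ₗ.[ℂ] L2Plane}
    (h : IsFormOperator α m H) (h' : IsFormOperator α m H') : H = H' := by
  apply LinearPMap.eq_of_eq_graph
  ext ⟨u, f⟩
  rw [h u f, h' u f]

/-! ### The curve -/

/-- `γ` is piecewise `C¹`: off a locally finite set of break points, and `C¹` up to the end points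
on every closed interval without break points in its interior. -/
def IsPiecewiseC1 (γ : ℝ → Plane) : Prop :=
  ∃ S : Set ℝ, (∀ a b : ℝ, (S ∩ Set.Icc a b).Finite) ∧
    ∀ a b : ℝ, a < b → Disjoint S (Set.Ioo a b) → ContDiffOn ℝ 1 γ (Set.Icc a b)

/-- The piecewise `C¹` curve `γ` is parametrized by its arc length. -/
def IsArcLengthParametrized (γ : ℝ → Plane) : Prop :=
  ∀ s : ℝ, DifferentiableAt ℝ γ s → ‖deriv γ s‖ = 1

def ConditionA1 (γ : ℝ → Plane) : Prop :=
  ∃ c : ℝ, 0 < c ∧ c < 1 ∧ ∀ s s' : ℝ, c * |s - s'| ≤ ‖γ s - γ s'‖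

/-- Asymptotic straightness; the inequality makes sense for `s ≠ s'` only. -/
def ConditionA2 (γ : ℝ → Plane) : Prop :=
  ∃ d μ ω : ℝ, 0 < d ∧ 0 < μ ∧ 0 < ω ∧ ω < 1 ∧
    ∀ s s' : ℝ, s ≠ s' → ω < s / s' → s / s' < ω⁻¹ →
      1 - ‖γ s - γ s'‖ / |s - s'| ≤ d * (1 + |s + s'| ^ (2 * μ)) ^ (-(1 / 2) : ℝ)

/-- The measure `M ↦ ℓ₁(M ∩ Γ)`, with `ℓ₁` the one-dimensional Hausdorff measure and `Γ` the range
of `γ`. -/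
def curveMeasure (γ : ℝ → Plane) : Measure Plane :=
  (Measure.hausdorffMeasure 1).restrict (Set.range γ)

/-- `H` is the operator `H_{α,γ} = -Δ - α δ(x - Γ)`. -/
def IsLeakyHamiltonian (α : ℝ) (γ : ℝ → Plane) (H : L2Plane →ₗ.[ℂ] L2Plane) : Prop :=
  IsFormOperator α (curveMeasure γ) H

end LeakyWire

end

set_option linter.unusedSectionVars false

/-! The form is realised by a bounded operator on a Hilbert space `K` embedded in `L²(ℝ²)` by `J`.
Here `K` is `W_{1,2}`, stored on the Fourier side as the functions `(1 + 4π²|k|²)^{1/2} û`. Two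
criteria on the form then determine the essential spectrum. Below the threshold, coercivity off a
finite-dimensional subspace leaves only discrete eigenvalues. Above it, approximate null vectors of
the shifted form in the norm of `K`, i.e. residuals small in the dual Sobolev norm, put every point
into the spectrum (`IsSemiboundedForm.essentialSpectrum_eq`). No smoothness across the curve is
needed for such vectors.

The curve enters through the kernel `G_κ(|γ(s) - γ(s')|)` of `(-Δ + κ²)⁻¹` on it, the
Birman–Schwinger kernel. `G_κ` is a superposition of Gaussians, so it is positive and decreasing,
and its Fourier transform along a straight line is `1 / (2√(κ² + p²))`. Thus `α` times the operator
of a line has norm `α / (2κ)`, which is `1` exactly at `-κ² = -α²/4`.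

Lower bound. By duality and a Schur test, a bound `b` on the row integrals of the kernel over a part
of the curve gives a trace inequality there with constant `b`. Asymptotic straightness makes these
integrals at most `1 / (2κ) + ε` far out (`exists_integral_curveKernel_le`), so for `κ > α/2` the
distant part costs less than the whole form of `-Δ + κ²`. On a bounded arc the trace is compact, and
it becomes negligible after finitely many conditions (`IsWire.exists_setIntegral_trace_le`).

Upper bound, energies in `[-α²/4, 0)`. The trial function is the single layer potential of a plane
wave `e^{iqs}` cut off to a long, distant interval, with `κ² + q² = α²/4`. On a line its trace would
be `1/α` times the density. The error from curvature and cutoff is `o(L)` for an interval of length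
`L`, against a squared norm `L` of the density.

Upper bound, energies `r ≥ 0`. A wave packet of width `L` with momenta near the sphere `4π²|k|² = r`
has squared norm of order `L⁻²`, while its squared trace is only `O(L⁻³)`, since a ball of radius
`L` contains a length `O(L)` of the curve. -/

noncomputable section

namespace LeakyWire

/-! ### Operators of forms with a form domain given by a Hilbert space `K` embedded in `X` -/

section FormOperator

open scoped InnerProduct ComplexConjugate
open ContinuousLinearMap (adjoint)

variable {K X : Type*} [NormedAddCommGroup K] [InnerProductSpace ℂ K] [CompleteSpace K]
  [NormedAddCommGroup X] [InnerProductSpace ℂ X] [CompleteSpace X]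

/-- The form `⟨h, B h'⟩` on the Hilbert space `K`, embedded in `X` by `J`, is densely defined,
symmetric and bounded below with respect to `X`. -/
structure IsSemiboundedForm (J : K →L[ℂ] X) (B : K →L[ℂ] K) : Prop where
  injective : Function.Injective J
  dense : DenseRange J
  symm : ∀ x y, inner ℂ (B x) y = inner ℂ x (B y)
  bddBelow : ∃ C δ : ℝ, 0 < δ ∧ ∀ h, δ * ‖h‖ ^ 2 ≤ (inner ℂ h (B h)).re + C * ‖J h‖ ^ 2

/-- The graph of the operator of the form `⟨h, B h'⟩`. -/
def formGraph (J : K →L[ℂ] X) (B : K →L[ℂ] K) : Submodule ℂ (X × X) where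
  carrier := {p | ∃ h, J h = p.1 ∧ B h = adjoint J p.2}
  add_mem' := by
    rintro a b ⟨h, h1, h2⟩ ⟨h', h1', h2'⟩
    exact ⟨h + h', by simp [h1, h1'], by simp [h2, h2']⟩
  zero_mem' := ⟨0, by simp, by simp⟩
  smul_mem' := by
    rintro c a ⟨h, h1, h2⟩
    exact ⟨c • h, by simp [h1], by simp [h2]⟩

/-- The operator of the form `⟨h, B h'⟩`. -/
def formOp (J : K →L[ℂ] X) (B : K →L[ℂ] K) : X →ₗ.[ℂ] X := (formGraph J B).toLinearPMap

/-- The operator in `K` of the form `⟨h, B h'⟩ - z ⟨J h, J h'⟩`. -/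
def shiftedForm (J : K →L[ℂ] X) (B : K →L[ℂ] K) (z : ℂ) : K →L[ℂ] K :=
  B - z • (adjoint J ∘L J)

theorem shiftedForm_apply (J : K →L[ℂ] X) (B : K →L[ℂ] K) (z : ℂ) (h : K) :
    shiftedForm J B z h = B h - z • adjoint J (J h) := by
  simp [shiftedForm]

theorem inner_shiftedForm (J : K →L[ℂ] X) (B : K →L[ℂ] K) (z : ℂ) (h h' : K) :
    inner ℂ h (shiftedForm J B z h') = inner ℂ h (B h') - z * inner ℂ (J h) (J h') := by
  rw [shiftedForm_apply, inner_sub_right, inner_smul_right,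
    ContinuousLinearMap.adjoint_inner_right]

variable {J : K →L[ℂ] X} {B : K →L[ℂ] K}

theorem IsSemiboundedForm.adjoint_injective (hF : IsSemiboundedForm J B) {f : X}
    (hf : adjoint J f = 0) : f = 0 := by
  refine Dense.eq_zero_of_inner_left ℂ hF.dense ?_
  rintro _ ⟨h, rfl⟩
  rw [← ContinuousLinearMap.adjoint_inner_left J h f, hf, inner_zero_left]

theorem IsSemiboundedForm.mem_graph (hF : IsSemiboundedForm J B) {u f : X} :
    (u, f) ∈ (formOp J B).graph ↔ ∃ h, J h = u ∧ B h = adjoint J f := by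
  -- `toLinearPMap` has the given graph only if that graph is single-valued. Injectivity of `J`
  -- kills `h` over `0`, and density of its range then kills the second component.
  rw [formOp, Submodule.toLinearPMap_graph_eq]
  · rfl
  · rintro ⟨x, y⟩ ⟨h, h1, h2⟩ (rfl : x = 0)
    have : h = 0 := hF.injective (by simpa using h1)
    subst this
    exact hF.adjoint_injective (by simpa using h2.symm)

theorem IsSemiboundedForm.exists_of_domain (hF : IsSemiboundedForm J B)
    (u : (formOp J B).domain) : ∃ h, J h = u ∧ B h = adjoint J (formOp J B u) :=
  hF.mem_graph.1 ((formOp J B).mem_graph u)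

theorem IsSemiboundedForm.exists_domain (hF : IsSemiboundedForm J B) {h : K} {f : X}
    (hf : B h = adjoint J f) : ∃ u : (formOp J B).domain, (u : X) = J h ∧ formOp J B u = f :=
  (LinearPMap.mem_graph_iff _).1 (hF.mem_graph.2 ⟨h, rfl, hf⟩)

theorem IsSemiboundedForm.im_inner_self (hF : IsSemiboundedForm J B) (h : K) :
    (inner ℂ h (B h)).im = 0 := by
  have h1 := hF.symm h h
  rw [← inner_conj_symm] at h1
  have := congrArg Complex.im h1
  simp only [Complex.conj_im] at this
  linarith

theorem IsSemiboundedForm.shiftedForm_symm (hF : IsSemiboundedForm J B) (r : ℝ) (x y : K) :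
    inner ℂ (shiftedForm J B r x) y = inner ℂ x (shiftedForm J B r y) := by
  rw [inner_shiftedForm, shiftedForm_apply, inner_sub_left, hF.symm, inner_smul_left,
    ContinuousLinearMap.adjoint_inner_left]
  simp

/-! ### Invertibility of the shifted form, resolvents and self-adjointness. -/

theorem isUnit_of_le_norm_inner (A : K →L[ℂ] K) {δ : ℝ} (hδ : 0 < δ)
    (h : ∀ x, δ * ‖x‖ ^ 2 ≤ ‖(inner ℂ x (A x) : ℂ)‖) : IsUnit A := by
  refine A.isUnit_of_forall_le_norm_inner_map (c := ⟨δ, hδ.le⟩) hδ fun x => ?_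
  rw [← inner_conj_symm, RCLike.norm_conj, mul_comm]
  exact h x

theorem inner_self_eq_norm_sq_complex (x : X) : (inner ℂ x x : ℂ) = ((‖x‖ ^ 2 : ℝ) : ℂ) := by
  rw [inner_self_eq_norm_sq_to_K]; simp

theorem IsSemiboundedForm.exists_isUnit_shiftedForm (hF : IsSemiboundedForm J B) :
    ∃ r : ℝ, IsUnit (shiftedForm J B r) := by
  obtain ⟨C, δ, hδ, h⟩ := hF.bddBelow
  -- At the real parameter `-C` semiboundedness is exactly coercivity on `K`.
  refine ⟨-C, isUnit_of_le_norm_inner _ hδ fun x => (h x).trans ?_⟩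
  refine le_trans (le_of_eq ?_) (Complex.re_le_norm _)
  rw [inner_shiftedForm, inner_self_eq_norm_sq_complex, Complex.sub_re, ← Complex.ofReal_mul,
    Complex.ofReal_re]
  ring

theorem exists_inverse {A : K →L[ℂ] K} (hA : IsUnit A) :
    ∃ P : K →L[ℂ] K, (∀ x, P (A x) = x) ∧ ∀ x, A (P x) = x := by
  obtain ⟨a, rfl⟩ := hA
  exact ⟨(a⁻¹ : (K →L[ℂ] K)ˣ),
    fun x => congrArg (fun T : K →L[ℂ] K => T x) a.inv_mul,
    fun x => congrArg (fun T : K →L[ℂ] K => T x) a.mul_inv⟩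

/-- With `A` the shifted form, the resolvent is `J A⁻¹ J*`. -/
theorem IsSemiboundedForm.mem_resolventSet (hF : IsSemiboundedForm J B) {z : ℂ}
    (hz : IsUnit (shiftedForm J B z)) : z ∈ resolventSet (formOp J B) := by
  obtain ⟨P, hP1, hP2⟩ := exists_inverse hz
  refine ⟨J ∘L P ∘L adjoint J, fun u => ?_, fun f => ?_⟩
  · obtain ⟨h, h1, h2⟩ := hF.exists_of_domain u
    have : adjoint J (formOp J B u - z • (u : X)) = shiftedForm J B z h := by
      rw [shiftedForm_apply, map_sub, map_smul, ← h2, h1]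
    simp [this, hP1, h1]
  · have h3 := hP2 (adjoint J f)
    set h := P (adjoint J f) with hh
    rw [shiftedForm_apply] at h3
    obtain ⟨u, hu1, hu2⟩ := hF.exists_domain (h := h) (f := f + z • J h) (by
      rw [map_add, map_smul, ← h3]; abel)
    exact ⟨u, by simp [hu1, hh], by rw [hu1, hu2]; abel⟩

/-- At a real point where the shifted form is invertible, the resolvent `R = J P J*` is bounded,
symmetric and injective, so its range, which lies in the domain, is dense. If `(y, g)` is in the
graph of the adjoint, pairing it with the graph elements `(R f, f + r R f)` gives `y = R (g - r y)`,
so `y` already lies in the domain. -/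
theorem IsSemiboundedForm.isSelfAdjoint (hF : IsSemiboundedForm J B) :
    IsSelfAdjoint (formOp J B) := by
  obtain ⟨r, hr⟩ := hF.exists_isUnit_shiftedForm
  obtain ⟨P, hP1, hP2⟩ := exists_inverse hr
  have hPs : ∀ x y, inner ℂ (P x) y = inner ℂ x (P y) := fun x y => by
    conv_lhs => rw [← hP2 y]
    conv_rhs => rw [← hP2 x]
    rw [hF.shiftedForm_symm]
  have key : ∀ f : X, (J (P (adjoint J f)), f + (r : ℂ) • J (P (adjoint J f))) ∈
      (formOp J B).graph := fun f => by
    refine hF.mem_graph.2 ⟨_, rfl, ?_⟩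
    have h3 := hP2 (adjoint J f)
    rw [shiftedForm_apply] at h3
    rw [map_add (adjoint J), map_smul (adjoint J)]
    exact sub_eq_iff_eq_add.1 h3
  have hdense : Dense ((formOp J B).domain : Set X) := by
    rw [Submodule.dense_iff_topologicalClosure_eq_top, Submodule.topologicalClosure_eq_top_iff,
      Submodule.eq_bot_iff]
    intro u hu
    have h1 : J (P (adjoint J u)) = 0 := by
      refine ext_inner_left ℂ fun f => ?_
      have h2 := hu _ (LinearPMap.mem_domain_of_mem_graph (key f))
      rw [← ContinuousLinearMap.adjoint_inner_right, hPs] at h2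
      rw [inner_zero_right, ← ContinuousLinearMap.adjoint_inner_left, h2]
    have h2 : P (adjoint J u) = 0 := hF.injective (by simpa using h1)
    exact hF.adjoint_injective (by rw [← hP2 (adjoint J u), h2, map_zero])
  rw [LinearPMap.isSelfAdjoint_def]
  apply LinearPMap.eq_of_eq_graph
  rw [LinearPMap.adjoint_graph_eq_graph_adjoint hdense]
  ext ⟨y, g⟩
  rw [Submodule.mem_adjoint_iff]
  constructor
  · intro h
    have h1 : ∀ f : X, inner ℂ f y = inner ℂ f (J (P (adjoint J (g - (r : ℂ) • y)))) := fun f => by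
      have := h _ _ (key f)
      simp only [inner_add_left, inner_smul_left, Complex.conj_ofReal] at this
      rw [← ContinuousLinearMap.adjoint_inner_left, ← hPs, ContinuousLinearMap.adjoint_inner_right,
        inner_sub_right, inner_smul_right]
      linear_combination this
    have hy := ext_inner_left ℂ h1
    have := key (g - (r : ℂ) • y)
    rw [← hy] at this
    simpa using this
  · intro h a b hab
    obtain ⟨h1, rfl, e1⟩ := hF.mem_graph.1 h
    obtain ⟨h2, rfl, e2⟩ := hF.mem_graph.1 hab
    change inner ℂ b (J h1) - inner ℂ (J h2) g = 0
    rw [← ContinuousLinearMap.adjoint_inner_left, ← ContinuousLinearMap.adjoint_inner_right J h2,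
      ← e1, ← e2, hF.symm, sub_self]

theorem IsSemiboundedForm.mem_resolventSet_of_im_ne_zero (hF : IsSemiboundedForm J B) {z : ℂ}
    (hz : z.im ≠ 0) : z ∈ resolventSet (formOp J B) := by
  obtain ⟨C, δ, hδ, hC⟩ := hF.bddBelow
  -- The imaginary part of the form is `-(Im z) ‖J x‖²`. Adding `M` times its modulus to the real
  -- part absorbs the `‖J x‖²` terms, so `δ ‖x‖²` is at most `1 + M` times the modulus of the form.
  set M : ℝ := (|C| + |z.re|) / |z.im| with hM
  have hM0 : 0 ≤ M := by positivity
  refine hF.mem_resolventSet (isUnit_of_le_norm_inner _ (δ := δ / (1 + M)) (by positivity) fun x => ?_)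
  have e1 : (inner ℂ x (shiftedForm J B z x)).re = (inner ℂ x (B x)).re - z.re * ‖J x‖ ^ 2 := by
    rw [inner_shiftedForm, inner_self_eq_norm_sq_complex, Complex.sub_re, Complex.re_mul_ofReal]
  have e2 : (inner ℂ x (shiftedForm J B z x)).im = - (z.im * ‖J x‖ ^ 2) := by
    rw [inner_shiftedForm, inner_self_eq_norm_sq_complex, Complex.sub_im, Complex.im_mul_ofReal,
      hF.im_inner_self]; ring
  have h1 := Complex.abs_re_le_norm (inner ℂ x (shiftedForm J B z x))
  have h2 := Complex.abs_im_le_norm (inner ℂ x (shiftedForm J B z x))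
  rw [e2, abs_neg, abs_mul, abs_of_nonneg (sq_nonneg ‖J x‖)] at h2
  rw [e1] at h1
  have h3 : M * (|z.im| * ‖J x‖ ^ 2) = (|C| + |z.re|) * ‖J x‖ ^ 2 := by
    rw [hM]; field_simp
  rw [div_mul_eq_mul_div, div_le_iff₀ (by positivity)]
  have h4 := mul_le_mul_of_nonneg_left h2 hM0
  have h5 := le_abs_self ((inner ℂ x (B x)).re - z.re * ‖J x‖ ^ 2)
  have h6 : (C + z.re) * ‖J x‖ ^ 2 ≤ (|C| + |z.re|) * ‖J x‖ ^ 2 := by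
    gcongr <;> exact le_abs_self _
  nlinarith [hC x]

/-- This carries a resolvent bound in `X` over to `K`, so that vectors with small residual in the
norm of `K` detect the spectrum. A duality argument bounds `‖J h‖` by the residual, and the
coercivity up to `‖J h‖²` then bounds `‖h‖`. -/
theorem IsSemiboundedForm.exists_bound_of_mem_resolventSet (hF : IsSemiboundedForm J B) {r : ℝ}
    (hr : (r : ℂ) ∈ resolventSet (formOp J B)) :
    ∃ c > 0, ∀ h, c * ‖h‖ ≤ ‖shiftedForm J B r h‖ := by
  obtain ⟨R, -, hR⟩ := hr
  obtain ⟨C, δ, hδ, hC⟩ := hF.bddBelow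
  have hC' : ∀ h, δ * ‖h‖ ^ 2 ≤ ‖(inner ℂ h (shiftedForm J B r h) : ℂ)‖ +
      (|C| + |r|) * ‖J h‖ ^ 2 := fun h => by
    have h1 := Complex.re_le_norm (inner ℂ h (shiftedForm J B r h))
    rw [inner_shiftedForm, inner_self_eq_norm_sq_complex, Complex.sub_re, ← Complex.ofReal_mul,
      Complex.ofReal_re] at h1
    rw [inner_shiftedForm, inner_self_eq_norm_sq_complex]
    have h6 : (C + r) * ‖J h‖ ^ 2 ≤ (|C| + |r|) * ‖J h‖ ^ 2 := by
      gcongr <;> exact le_abs_self _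
    push_cast at h1 ⊢
    nlinarith [hC h]
  set A := |C| + |r|
  have hA : 0 ≤ A := by positivity
  set D : ℝ := (‖R‖ + A * ‖R‖ ^ 2) / δ with hD
  have hD0 : 0 ≤ D := by positivity
  have step : ∀ h, ‖J h‖ ≤ Real.sqrt D * ‖shiftedForm J B r h‖ := fun h => by
    obtain ⟨u, hu1, hu2⟩ := hR (J h)
    obtain ⟨h', e1, e2⟩ := hF.exists_of_domain u
    have e3 : shiftedForm J B r h' = adjoint J (J h) := by
      rw [shiftedForm_apply, e2, e1, ← map_smul, ← map_sub, hu2]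
    have e4 : ‖J h'‖ ≤ ‖R‖ * ‖J h‖ := by rw [e1, hu1]; exact R.le_opNorm _
    have e5 : ‖h'‖ ^ 2 ≤ D * ‖J h‖ ^ 2 := by
      have := hC' h'
      rw [e3, ContinuousLinearMap.adjoint_inner_right] at this
      have h7 : ‖(inner ℂ (J h') (J h) : ℂ)‖ ≤ ‖R‖ * ‖J h‖ ^ 2 := by
        refine (norm_inner_le_norm _ _).trans ?_
        nlinarith [norm_nonneg (J h)]
      have h8 : A * ‖J h'‖ ^ 2 ≤ A * (‖R‖ ^ 2 * ‖J h‖ ^ 2) := by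
        gcongr; rw [← mul_pow]; gcongr
      rw [hD, div_mul_eq_mul_div, le_div_iff₀ hδ]
      nlinarith
    have e6 : ‖h'‖ ≤ Real.sqrt D * ‖J h‖ := by
      rw [← Real.sqrt_sq (norm_nonneg h'), ← Real.sqrt_sq (norm_nonneg (J h)),
        ← Real.sqrt_mul hD0]
      exact Real.sqrt_le_sqrt e5
    -- Duality: `h'` solves `A h' = J* J h`, so symmetry moves `A` onto `h`.
    have e7 : ‖J h‖ ^ 2 ≤ ‖shiftedForm J B r h‖ * ‖h'‖ := by
      have : ((‖J h‖ ^ 2 : ℝ) : ℂ) = inner ℂ (shiftedForm J B r h) h' := by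
        rw [hF.shiftedForm_symm, e3, ContinuousLinearMap.adjoint_inner_right,
          inner_self_eq_norm_sq_complex]
      have h9 := norm_inner_le_norm (𝕜 := ℂ) (shiftedForm J B r h) h'
      rw [← this, Complex.norm_real, Real.norm_of_nonneg (by positivity)] at h9
      exact h9
    rcases (norm_nonneg (J h)).eq_or_lt with h0 | h0
    · rw [← h0]; positivity
    · refine le_of_mul_le_mul_right ?_ h0
      calc ‖J h‖ * ‖J h‖ = ‖J h‖ ^ 2 := by ring
        _ ≤ ‖shiftedForm J B r h‖ * ‖h'‖ := e7
        _ ≤ ‖shiftedForm J B r h‖ * (Real.sqrt D * ‖J h‖) := by gcongr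
        _ = _ := by ring
  set E : ℝ := 1 + A * D * ‖shiftedForm J B r‖ with hE
  have hE0 : 0 < E := by positivity
  refine ⟨δ / E, by positivity, fun h => ?_⟩
  rw [div_mul_eq_mul_div, div_le_iff₀ hE0]
  rcases (norm_nonneg h).eq_or_lt with h0 | h0
  · rw [← h0]; simp; positivity
  refine le_of_mul_le_mul_right ?_ h0
  have h1 := hC' h
  have h2 := norm_inner_le_norm (𝕜 := ℂ) h (shiftedForm J B r h)
  have h3 : ‖J h‖ ^ 2 ≤ D * ‖shiftedForm J B r h‖ ^ 2 := by
    calc ‖J h‖ ^ 2 ≤ (Real.sqrt D * ‖shiftedForm J B r h‖) ^ 2 := by gcongr; exact step h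
      _ = _ := by rw [mul_pow, Real.sq_sqrt hD0]
  have h4 := (shiftedForm J B r).le_opNorm h
  calc δ * ‖h‖ * ‖h‖ = δ * ‖h‖ ^ 2 := by ring
    _ ≤ ‖h‖ * ‖shiftedForm J B r h‖ + A * (D * ‖shiftedForm J B r h‖ ^ 2) := by
        refine h1.trans ?_; gcongr
    _ = ‖h‖ * ‖shiftedForm J B r h‖ + A * D * ‖shiftedForm J B r h‖ * ‖shiftedForm J B r h‖ := by
        ring
    _ ≤ ‖h‖ * ‖shiftedForm J B r h‖ + A * D * ‖shiftedForm J B r h‖ *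
        (‖shiftedForm J B r‖ * ‖h‖) := by gcongr
    _ = _ := by rw [hE]; ring

/-- A symmetric operator that is coercive on the orthogonal complement of a finite-dimensional
subspace is invertible if it is injective. -/
theorem isUnit_of_injective_of_coercive_orthogonal {A : K →L[ℂ] K}
    (hA : Function.Injective A) {W : Submodule ℂ K} [FiniteDimensional ℂ W] {δ : ℝ} (hδ : 0 < δ)
    (h : ∀ x ∈ Wᗮ, δ * ‖x‖ ^ 2 ≤ (inner ℂ x (A x)).re) : IsUnit A := by
  -- Large enough for `c` times the projection onto `W` to absorb the `W`-block of `A` and, by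
  -- Young's inequality, its coupling to the complement. Half of `δ` survives.
  set c : ℝ := δ + 2 * ‖A‖ + 4 * ‖A‖ ^ 2 / δ with hc
  set N : K →L[ℂ] K := (c : ℂ) • W.starProjection with hN
  have hP : IsUnit (A + N) := by
    refine isUnit_of_le_norm_inner _ (δ := δ / 2) (by positivity) fun x => ?_
    refine le_trans ?_ (Complex.re_le_norm _)
    set w := W.starProjection x with hw
    set y := x - w with hy
    have hyW : y ∈ Wᗮ := Submodule.sub_starProjection_mem_orthogonal x
    have hwW : w ∈ W := Submodule.starProjection_apply_mem W x
    have hx : x = y + w := by simp [hy]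
    have horth : (inner ℂ y w : ℂ) = 0 := (Submodule.mem_orthogonal' W y).1 hyW w hwW
    have horth' : (inner ℂ w y : ℂ) = 0 := (Submodule.mem_orthogonal W y).1 hyW w hwW
    have hns : ‖x‖ ^ 2 = ‖y‖ ^ 2 + ‖w‖ ^ 2 := by
      have := norm_add_sq (𝕜 := ℂ) y w
      rw [← hx, horth] at this
      simpa using this
    have e0 : (A + N) x = A x + (c : ℂ) • w := by simp [hN, hw]
    have e1 : (inner ℂ x ((A + N) x)).re = (inner ℂ y (A y)).re + (inner ℂ y (A w)).re +
        (inner ℂ w (A x)).re + c * ‖w‖ ^ 2 := by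
      rw [e0, inner_add_right, inner_smul_right]
      have : (inner ℂ x w : ℂ) = ((‖w‖ ^ 2 : ℝ) : ℂ) := by
        rw [hx, inner_add_left, horth, zero_add, inner_self_eq_norm_sq_complex]
      rw [this]
      conv_lhs => rw [hx, inner_add_left, map_add, inner_add_right]
      rw [← map_add, ← hx, ← Complex.ofReal_mul]
      simp only [Complex.add_re, Complex.ofReal_re]
    have b1 : -(‖A‖ * ‖y‖ * ‖w‖) ≤ (inner ℂ y (A w)).re := by
      refine (neg_le_neg ?_).trans (neg_le_of_abs_le (Complex.abs_re_le_norm _))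
      refine (norm_inner_le_norm _ _).trans ?_
      calc ‖y‖ * ‖A w‖ ≤ ‖y‖ * (‖A‖ * ‖w‖) := by gcongr; exact A.le_opNorm w
        _ = _ := by ring
    have b2 : -(‖A‖ * ‖y‖ * ‖w‖ + ‖A‖ * ‖w‖ ^ 2) ≤ (inner ℂ w (A x)).re := by
      refine (neg_le_neg ?_).trans (neg_le_of_abs_le (Complex.abs_re_le_norm _))
      refine (norm_inner_le_norm _ _).trans ?_
      calc ‖w‖ * ‖A x‖ ≤ ‖w‖ * (‖A‖ * (‖y‖ + ‖w‖)) := by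
            gcongr
            refine (A.le_opNorm x).trans ?_
            gcongr
            rw [hx]
            exact norm_add_le _ _
        _ = _ := by ring
    have b3 := h y hyW
    have b4 : 2 * (‖A‖ * ‖y‖ * ‖w‖) ≤ δ / 2 * ‖y‖ ^ 2 + 4 * ‖A‖ ^ 2 / δ * ‖w‖ ^ 2 := by
      have h1 : 0 ≤ (δ * ‖y‖ - 2 * (‖A‖ * ‖w‖)) ^ 2 := sq_nonneg _
      have h2 : δ / 2 * ‖y‖ ^ 2 + 4 * ‖A‖ ^ 2 / δ * ‖w‖ ^ 2 - 2 * (‖A‖ * ‖y‖ * ‖w‖) =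
        ((δ * ‖y‖ - 2 * (‖A‖ * ‖w‖)) ^ 2 + 4 * (‖A‖ * ‖w‖) ^ 2) / (2 * δ) := by
        field_simp; ring
      have h3 : 0 ≤ ((δ * ‖y‖ - 2 * (‖A‖ * ‖w‖)) ^ 2 + 4 * (‖A‖ * ‖w‖) ^ 2) / (2 * δ) := by
        positivity
      linarith
    rw [e1, hns, hc]
    have h5 : 0 ≤ ‖A‖ * ‖w‖ ^ 2 := by positivity
    have h6 : 0 ≤ δ * ‖w‖ ^ 2 := by positivity
    nlinarith
  obtain ⟨P, hP1, hP2⟩ := exists_inverse hP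
  rw [ContinuousLinearMap.isUnit_iff_bijective]
  refine ⟨hA, fun y => ?_⟩
  -- The Fredholm alternative by hand: `P A = 1 - P N` and `P N` takes values in the
  -- finite-dimensional space `P(W)`. On that space injectivity implies surjectivity, which suffices
  -- to solve the equation on all of `K`.
  have hfin : FiniteDimensional ℂ (W.map (P : K →ₗ[ℂ] K)) := inferInstance
  have hNW : ∀ x, P (N x) ∈ W.map (P : K →ₗ[ℂ] K) := fun x =>
    Submodule.mem_map_of_mem (W.smul_mem _ (Submodule.starProjection_apply_mem W x))
  have hPA : ∀ x, P (A x) = x - P (N x) := fun x => by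
    rw [eq_sub_iff_add_eq, ← map_add]; exact hP1 x
  let f : W.map (P : K →ₗ[ℂ] K) →ₗ[ℂ] W.map (P : K →ₗ[ℂ] K) :=
    ((LinearMap.id - (P ∘L N : K →L[ℂ] K).toLinearMap) : K →ₗ[ℂ] K).restrict fun x hx =>
      Submodule.sub_mem _ hx (hNW x)
  have hfi : Function.Injective f := by
    rw [injective_iff_map_eq_zero]
    rintro ⟨x, hx⟩ h0
    have h1 : x - P (N x) = 0 := congrArg Subtype.val h0
    rw [← hPA] at h1
    have h2 : A x = 0 := by rw [← hP2 (A x), h1, map_zero]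
    exact Subtype.ext (hA (by simpa using h2))
  obtain ⟨⟨x, hx⟩, hxe⟩ := LinearMap.surjective_of_injective hfi ⟨P (N (P y)), hNW _⟩
  have h1 : x - P (N x) = P (N (P y)) := congrArg Subtype.val hxe
  refine ⟨P y + x, ?_⟩
  have h2 : P (A (P y + x)) = P y := by
    rw [hPA, map_add, map_add, ← h1]; abel
  rw [← hP2 (A (P y + x)), h2, hP2]

/-- Eigenvectors for distinct eigenvalues have orthogonal images under `J`, so the form shifted by
`r₀` is diagonal and nonpositive on their span. More than `dim W` of them would give a nontrivial
combination in `Wᗮ`, where that form is coercive. -/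
theorem IsSemiboundedForm.finite_eigenvalues (hF : IsSemiboundedForm J B)
    {W : Submodule ℂ K} [FiniteDimensional ℂ W] {δ r₀ : ℝ} (hδ : 0 < δ)
    (h : ∀ x ∈ Wᗮ, δ * ‖x‖ ^ 2 ≤ (inner ℂ x (shiftedForm J B r₀ x)).re) :
    {r : ℝ | r < r₀ ∧ ∃ x ≠ 0, shiftedForm J B r x = 0}.Finite := by
  by_contra hinf
  obtain ⟨s, hs, hcard⟩ := Set.Infinite.exists_subset_card_eq hinf (Module.finrank ℂ W + 1)
  choose! v hv0 hv using fun r (hr : r ∈ s) => (hs hr).2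
  have hBv : ∀ r ∈ s, ∀ y, inner ℂ y (B (v r)) = (r : ℂ) * inner ℂ (J y) (J (v r)) := by
    intro r hr y
    have := inner_shiftedForm J B r y (v r)
    rw [hv r hr, inner_zero_right] at this
    linear_combination -this
  have horth : ∀ r ∈ s, ∀ r' ∈ s, r ≠ r' → (inner ℂ (J (v r)) (J (v r')) : ℂ) = 0 := by
    intro r hr r' hr' hne
    have h1 := hBv r' hr' (v r)
    have h2 : inner ℂ (v r) (B (v r')) = (r : ℂ) * inner ℂ (J (v r)) (J (v r')) := by
      rw [← hF.symm, ← inner_conj_symm, hBv r hr, map_mul, inner_conj_symm, Complex.conj_ofReal]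
    have h3 : ((r : ℂ) - r') * inner ℂ (J (v r)) (J (v r')) = 0 := by
      linear_combination h1 - h2
    rcases mul_eq_zero.1 h3 with h4 | h4
    · exact absurd (by exact_mod_cast sub_eq_zero.1 h4) hne
    · exact h4
  let comb : (s → ℂ) →ₗ[ℂ] K := Fintype.linearCombination ℂ (fun r : s => v r)
  -- One eigenvalue more than `dim W` gives the coefficient vector a nonzero value in the kernel of
  -- the projection.
  have hker : ((W.orthogonalProjectionOnto : K →ₗ[ℂ] W) ∘ₗ comb).ker ≠ ⊥ :=
    LinearMap.ker_ne_bot_of_finrank_lt (by simp [hcard])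
  obtain ⟨c, hc, hc0⟩ := Submodule.exists_mem_ne_zero_of_ne_bot hker
  have hx : comb c ∈ Wᗮ := by
    rw [← Submodule.orthogonalProjectionOnto_eq_zero_iff]
    exact hc
  have hcomb : comb c = ∑ r : s, c r • v r := Fintype.linearCombination_apply ..
  have hJc : J (comb c) = ∑ r : s, c r • J (v r) := by simp [hcomb]
  have hexp : ∀ r : s, (inner ℂ (J (comb c)) (J (v r)) : ℂ) =
      conj (c r) * ((‖J (v r)‖ ^ 2 : ℝ) : ℂ) := by
    intro r
    rw [hJc, sum_inner, Finset.sum_eq_single r]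
    · rw [inner_smul_left, inner_self_eq_norm_sq_complex]
    · intro r' _ hne
      rw [inner_smul_left, horth r' r'.2 r r.2 (fun h => hne (Subtype.ext h)), mul_zero]
    · simp
  have hnorm : ‖J (comb c)‖ ^ 2 = ∑ r : s, ‖c r‖ ^ 2 * ‖J (v r)‖ ^ 2 := by
    have h1 : (inner ℂ (J (comb c)) (J (comb c)) : ℂ) =
        ((∑ r : s, ‖c r‖ ^ 2 * ‖J (v r)‖ ^ 2 : ℝ) : ℂ) := by
      conv_lhs => rw [show J (comb c) = ∑ r : s, c r • J (v r) from hJc, inner_sum]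
      push_cast
      refine Finset.sum_congr rfl fun r _ => ?_
      rw [inner_smul_right, ← hJc, hexp r, ← mul_assoc, Complex.mul_conj, Complex.normSq_eq_norm_sq]
      push_cast; ring
    rw [inner_self_eq_norm_sq_complex] at h1
    exact_mod_cast h1
  have hform : (inner ℂ (comb c) (B (comb c)) : ℂ) =
      ((∑ r : s, (r : ℝ) * (‖c r‖ ^ 2 * ‖J (v r)‖ ^ 2) : ℝ) : ℂ) := by
    have : B (comb c) = ∑ r : s, c r • B (v r) := by simp [hcomb]
    rw [this, inner_sum]
    push_cast
    refine Finset.sum_congr rfl fun r _ => ?_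
    rw [inner_smul_right, hBv r r.2, hexp r]
    have h2 : c r * conj (c r) = ((‖c r‖ ^ 2 : ℝ) : ℂ) := by
      rw [Complex.mul_conj, Complex.normSq_eq_norm_sq]
    push_cast at h2 ⊢
    linear_combination (r : ℂ) * (‖J (v r)‖ : ℂ) ^ 2 * h2
  have hle := h _ hx
  rw [inner_shiftedForm, hform, inner_self_eq_norm_sq_complex, hnorm, ← Complex.ofReal_mul,
    ← Complex.ofReal_sub, Complex.ofReal_re, Finset.mul_sum, ← Finset.sum_sub_distrib] at hle
  have hle0 : ∑ r : s, ((r : ℝ) * (‖c r‖ ^ 2 * ‖J (v r)‖ ^ 2) - r₀ * (‖c r‖ ^ 2 * ‖J (v r)‖ ^ 2))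
      ≤ 0 := by
    refine Finset.sum_nonpos fun r _ => ?_
    have h3 : (r : ℝ) < r₀ := (hs r.2).1
    have h4 : 0 ≤ ‖c r‖ ^ 2 * ‖J (v r)‖ ^ 2 := by positivity
    nlinarith
  have hz : comb c = 0 := by
    have h5 : ‖comb c‖ ^ 2 ≤ 0 := by
      by_contra h6
      push Not at h6
      have := mul_pos hδ h6
      linarith
    simpa using le_antisymm h5 (sq_nonneg _)
  apply hc0
  ext r
  -- The combination vanishes; pairing its image with each `J (v r)` shows that every coefficient is
  -- zero.
  have h7 := hexp r
  rw [hz, map_zero, inner_zero_left] at h7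
  have h8 : J (v r) ≠ 0 := fun h => hv0 r r.2 (hF.injective (by simpa using h))
  simpa [h8] using h7.symm

/-- Below `r₀` a real point is either regular or has a null vector of the shifted form. Isolation
follows from the finiteness of the eigenvalues and the regularity of nonreal points. The
multiplicity is finite because the projection to `W` is injective on null vectors. -/
theorem IsSemiboundedForm.mem_discreteSpectrum (hF : IsSemiboundedForm J B)
    {W : Submodule ℂ K} [FiniteDimensional ℂ W] {δ r₀ : ℝ} (hδ : 0 < δ)
    (h : ∀ x ∈ Wᗮ, δ * ‖x‖ ^ 2 ≤ (inner ℂ x (shiftedForm J B r₀ x)).re) {r : ℝ} (hr : r < r₀)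
    (hs : (r : ℂ) ∈ spectrum (formOp J B)) : (r : ℂ) ∈ discreteSpectrum (formOp J B) := by
  have hmono : ∀ t : ℝ, t ≤ r₀ → ∀ x ∈ Wᗮ,
      δ * ‖x‖ ^ 2 ≤ (inner ℂ x (shiftedForm J B t x)).re := by
    intro t ht x hx
    refine (h x hx).trans ?_
    rw [inner_shiftedForm, inner_shiftedForm, inner_self_eq_norm_sq_complex, Complex.sub_re,
      Complex.sub_re, ← Complex.ofReal_mul, ← Complex.ofReal_mul, Complex.ofReal_re,
      Complex.ofReal_re]
    have : 0 ≤ ‖J x‖ ^ 2 := by positivity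
    nlinarith
  have halt : ∀ t : ℝ, t < r₀ → (t : ℂ) ∈ spectrum (formOp J B) →
      ∃ x ≠ 0, shiftedForm J B t x = 0 := by
    intro t ht hts
    by_contra! hcon
    refine hts (hF.mem_resolventSet (isUnit_of_injective_of_coercive_orthogonal ?_ hδ
      (hmono t ht.le)))
    rw [injective_iff_map_eq_zero]
    intro x hx
    by_contra hx0
    exact hcon x hx0 hx
  have hlift : ∀ u : eigenspace (formOp J B) (r : ℂ),
      ∃ x, J x = ((u : (formOp J B).domain) : X) ∧ shiftedForm J B r x = 0 := by
    rintro ⟨u, hu⟩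
    obtain ⟨x, h1, h2⟩ := hF.exists_of_domain u
    refine ⟨x, h1, ?_⟩
    have h3 : formOp J B u - (r : ℂ) • (u : X) = 0 := hu
    rw [shiftedForm_apply, h1, h2, ← map_smul, ← map_sub, h3, map_zero]
  refine ⟨hs, ?_, ?_, ?_⟩
  · have hfin := hF.finite_eigenvalues hδ h
    set S := {t : ℝ | t < r₀ ∧ ∃ x ≠ 0, shiftedForm J B t x = 0} with hS
    have hcl : IsClosed (Complex.ofReal '' (S \ {r})) :=
      ((hfin.subset Set.sdiff_subset).image _).isClosed
    have h1 : ∀ᶠ w : ℂ in 𝓝[≠] (r : ℂ), w ∉ Complex.ofReal '' (S \ {r}) := by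
      refine nhdsWithin_le_nhds (hcl.isOpen_compl.mem_nhds ?_)
      rintro ⟨t, ht, hte⟩
      exact ht.2 (by exact_mod_cast hte)
    have h2 : ∀ᶠ w : ℂ in 𝓝[≠] (r : ℂ), w.re < r₀ :=
      nhdsWithin_le_nhds ((isOpen_lt Complex.continuous_re continuous_const).mem_nhds
        (by simpa using hr))
    filter_upwards [h1, h2, self_mem_nhdsWithin] with w hw1 hw2 hw3 hw
    by_cases him : w.im = 0
    · have hwr : ((w.re : ℝ) : ℂ) = w := Complex.ext (by simp) (by simp [him])
      refine hw1 ⟨w.re, ⟨⟨hw2, halt _ hw2 (by rwa [hwr])⟩, ?_⟩, hwr⟩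
      intro he
      refine hw3 ?_
      rw [Set.mem_singleton_iff] at he ⊢
      rw [← hwr, he]
    · exact hw (hF.mem_resolventSet_of_im_ne_zero him)
  · obtain ⟨x, hx0, hx⟩ := halt r hr hs
    rw [shiftedForm_apply, sub_eq_zero, ← map_smul] at hx
    obtain ⟨u, hu1, hu2⟩ := hF.exists_domain hx
    intro hbot
    have hu : u ∈ eigenspace (formOp J B) (r : ℂ) := by
      change formOp J B u - (r : ℂ) • (u : X) = 0
      rw [hu1, hu2, sub_self]
    rw [hbot, Submodule.mem_bot] at hu
    rw [hu] at hu1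
    exact hx0 (hF.injective (by simpa using hu1.symm))
  · choose L hL1 hL2 using hlift
    let L' : eigenspace (formOp J B) (r : ℂ) →ₗ[ℂ] K :=
      { toFun := L
        map_add' := fun u v => hF.injective (by simp [hL1])
        map_smul' := fun c u => hF.injective (by simp [hL1]) }
    refine Module.Finite.of_injective ((W.orthogonalProjectionOnto : K →ₗ[ℂ] W) ∘ₗ L') ?_
    rw [injective_iff_map_eq_zero]
    intro u hu
    have h1 : L u ∈ Wᗮ := by
      rw [← Submodule.orthogonalProjectionOnto_eq_zero_iff]
      exact hu
    have h2 := hmono r hr.le _ h1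
    rw [hL2, inner_zero_right, Complex.zero_re] at h2
    have h3 : L u = 0 := by
      have h5 : ‖L u‖ ^ 2 ≤ 0 := by
        by_contra h6
        push Not at h6
        have := mul_pos hδ h6
        linarith
      simpa using le_antisymm h5 (sq_nonneg _)
    have h4 := hL1 u
    rw [h3, map_zero] at h4
    exact Subtype.ext (Subtype.ext h4.symm)

/-- The essential spectrum of the operator of a form is `[b, ∞)` if below `b` the form is coercive
up to finite-dimensional subspaces, and if there are approximate eigenvectors, in the form sense,
for all points of `[b, ∞)`. -/
theorem IsSemiboundedForm.essentialSpectrum_eq (hF : IsSemiboundedForm J B) {b : ℝ}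
    (hlow : ∀ r₀ < b, ∃ W : Submodule ℂ K, FiniteDimensional ℂ W ∧ ∃ δ > 0, ∀ x ∈ Wᗮ,
      δ * ‖x‖ ^ 2 ≤ (inner ℂ x (shiftedForm J B r₀ x)).re)
    (hup : ∀ r : ℝ, b ≤ r → ∀ ε > 0, ∃ x ≠ 0, ‖shiftedForm J B r x‖ ≤ ε * ‖x‖) :
    essentialSpectrum (formOp J B) = Complex.ofReal '' Set.Ici b := by
  have hspec : ∀ r : ℝ, b ≤ r → (r : ℂ) ∈ spectrum (formOp J B) := by
    intro r hr hres
    obtain ⟨c, hc, h⟩ := hF.exists_bound_of_mem_resolventSet hres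
    obtain ⟨x, hx0, hx⟩ := hup r hr (c / 2) (by positivity)
    have h1 := (h x).trans hx
    have h2 : 0 < ‖x‖ := norm_pos_iff.2 hx0
    nlinarith
  ext z
  constructor
  · rintro ⟨hz, hnd⟩
    have him : z.im = 0 := by
      by_contra him
      exact hz (hF.mem_resolventSet_of_im_ne_zero him)
    have hzr : ((z.re : ℝ) : ℂ) = z := Complex.ext (by simp) (by simp [him])
    refine ⟨z.re, ?_, hzr⟩
    by_contra hlt
    rw [Set.mem_Ici, not_le] at hlt
    obtain ⟨r₀, h1, h2⟩ := exists_between hlt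
    obtain ⟨W, hW, δ, hδ, h⟩ := hlow r₀ h2
    apply hnd
    rw [← hzr] at hz ⊢
    exact hF.mem_discreteSpectrum hδ h h1 hz
  · rintro ⟨r, hr, rfl⟩
    refine ⟨hspec r hr, fun hd => ?_⟩
    have h1 := hd.2.1
    -- No point of the half-line is isolated in the spectrum, because the points `r + 1/(n+1)`
    -- belong to it too.
    have h2 : Tendsto (fun n : ℕ => ((r + 1 / ((n : ℝ) + 1) : ℝ) : ℂ)) atTop (𝓝[≠] (r : ℂ)) := by
      refine tendsto_nhdsWithin_iff.2 ⟨?_, Eventually.of_forall fun n => ?_⟩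
      · have := (tendsto_const_nhds (x := r)).add tendsto_one_div_add_atTop_nhds_zero_nat
        rw [add_zero] at this
        exact (Complex.continuous_ofReal.tendsto r).comp this
      · have : (0 : ℝ) < 1 / ((n : ℝ) + 1) := by positivity
        simp only [Set.mem_compl_iff, Set.mem_singleton_iff, Complex.ofReal_inj]
        linarith
    obtain ⟨n, hn⟩ := (h2.eventually h1).exists
    refine hn (hspec _ ?_)
    have : (0 : ℝ) < 1 / ((n : ℝ) + 1) := by positivity
    have := Set.mem_Ici.1 hr
    linarith

end FormOperator

/-! ### The resolvent kernel of the Laplacian in the plane -/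

section Kernel

open Real Set

/-- The heat kernel of the plane at time `t` and distance `r`, times `exp (-κ² t)`. -/
def heatWeight (κ t r : ℝ) : ℝ := exp (-κ ^ 2 * t) * ((4 * π * t)⁻¹ * exp (-r ^ 2 / (4 * t)))

/-- The kernel of `(-Δ + κ²)⁻¹` in the plane at distance `r`. -/
def resolventKernel (κ r : ℝ) : ℝ := ∫ t in Ioi 0, heatWeight κ t r

theorem heatWeight_nonneg {κ t r : ℝ} (ht : 0 < t) : 0 ≤ heatWeight κ t r := by
  unfold heatWeight; positivity

theorem measurable_heatWeight (κ : ℝ) : Measurable fun p : ℝ × ℝ => heatWeight κ p.1 p.2 := by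
  unfold heatWeight; fun_prop

theorem measurable_resolventKernel (κ : ℝ) : Measurable (resolventKernel κ) := by
  have h : StronglyMeasurable fun p : ℝ × ℝ => heatWeight κ p.2 p.1 :=
    ((measurable_heatWeight κ).comp measurable_swap).stronglyMeasurable
  exact (h.integral_prod_right' (ν := volume.restrict (Ioi (0 : ℝ)))).measurable

theorem resolventKernel_nonneg (κ r : ℝ) : 0 ≤ resolventKernel κ r :=
  setIntegral_nonneg measurableSet_Ioi fun _ ht => heatWeight_nonneg ht

/-- For `r ≠ 0` the inequality `e^{-x} ≤ 1/x` with `x = r²/(4t)` cancels the singularity `1/t`. -/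
theorem integrableOn_heatWeight {κ r : ℝ} (hκ : 0 < κ) (hr : r ≠ 0) :
    IntegrableOn (fun t => heatWeight κ t r) (Ioi 0) := by
  have h1 : IntegrableOn (fun t : ℝ => exp (-κ ^ 2 * t) * (π * r ^ 2)⁻¹) (Ioi 0) := by
    have := (exp_neg_integrableOn_Ioi 0 (b := κ ^ 2) (by positivity)).mul_const ((π * r ^ 2)⁻¹)
    simpa [IntegrableOn] using this
  refine Integrable.mono' h1 ((measurable_heatWeight κ).comp
    (measurable_id.prodMk measurable_const)).aestronglyMeasurable ?_
  refine (ae_restrict_iff' measurableSet_Ioi).2 (Eventually.of_forall fun t ht => ?_)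
  rw [Real.norm_of_nonneg (heatWeight_nonneg ht), heatWeight]
  have ht' : (0 : ℝ) < t := ht
  gcongr
  have hx : 0 < r ^ 2 / (4 * t) := by positivity
  have h2 : exp (-r ^ 2 / (4 * t)) ≤ (r ^ 2 / (4 * t))⁻¹ := by
    rw [neg_div, Real.exp_neg]
    gcongr
    linarith [add_one_le_exp (r ^ 2 / (4 * t))]
  calc (4 * π * t)⁻¹ * exp (-r ^ 2 / (4 * t)) ≤ (4 * π * t)⁻¹ * (r ^ 2 / (4 * t))⁻¹ := by gcongr
    _ = _ := by field_simp

/-- The integrand is decreasing in the distance for each `t`. Positivity of `r` matters: at `r = 0`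
the integral diverges logarithmically and takes the default value `0`. Later comparisons therefore
exclude the diagonal, a null set. -/
theorem resolventKernel_anti {κ r r' : ℝ} (hκ : 0 < κ) (hr : 0 < r) (hrr : r ≤ r') :
    resolventKernel κ r' ≤ resolventKernel κ r := by
  refine setIntegral_mono_on (integrableOn_heatWeight hκ (by linarith))
    (integrableOn_heatWeight hκ hr.ne') measurableSet_Ioi fun t ht => ?_
  have ht' : (0 : ℝ) < t := ht
  unfold heatWeight
  gcongr

theorem resolventKernel_abs (κ r : ℝ) : resolventKernel κ |r| = resolventKernel κ r := by
  simp [resolventKernel, heatWeight]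

theorem integral_heatWeight (κ : ℝ) {t : ℝ} (ht : 0 < t) :
    ∫ r, heatWeight κ t r = exp (-κ ^ 2 * t) * (√(4 * π * t))⁻¹ := by
  unfold heatWeight
  rw [integral_const_mul, integral_const_mul]
  have h1 : (fun r : ℝ => exp (-r ^ 2 / (4 * t))) = fun r => exp (-(4 * t)⁻¹ * r ^ 2) := by
    ext r; congr 1; field_simp
  rw [h1, integral_gaussian]
  have h2 : π / (4 * t)⁻¹ = 4 * π * t := by field_simp
  rw [h2]
  have h3 : (0 : ℝ) < 4 * π * t := by positivity
  congr 1
  rw [inv_mul_eq_div, Real.sqrt_div_self', one_div]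

theorem integral_exp_div_sqrt {a : ℝ} (ha : 0 < a) :
    ∫ t in Ioi (0 : ℝ), exp (-a ^ 2 * t) * (√(4 * π * t))⁻¹ = 1 / (2 * a) := by
  have h := Real.integral_rpow_mul_exp_neg_mul_Ioi (a := 1 / 2) (r := a ^ 2) (by norm_num)
    (by positivity)
  have h1 : ∀ t ∈ Ioi (0 : ℝ), exp (-a ^ 2 * t) * (√(4 * π * t))⁻¹ =
      (√(4 * π))⁻¹ * (t ^ (1 / 2 - 1 : ℝ) * exp (-(a ^ 2 * t))) := by
    intro t ht
    have ht' : (0 : ℝ) < t := ht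
    rw [Real.sqrt_mul (by positivity), mul_inv, Real.sqrt_eq_rpow t, ← Real.rpow_neg ht'.le]
    norm_num
    ring
  rw [setIntegral_congr_fun measurableSet_Ioi h1, integral_const_mul, h, Real.Gamma_one_half_eq,
    ← Real.sqrt_eq_rpow, Real.sqrt_div zero_le_one, Real.sqrt_sq ha.le,
    Real.sqrt_mul (by norm_num), show (4 : ℝ) = 2 ^ 2 by norm_num, Real.sqrt_sq (by norm_num)]
  have : √π ≠ 0 := by positivity
  simp
  field_simp

/-- A function that is not integrable would have integral `0`, but the integral is positive. -/
theorem integrableOn_exp_div_sqrt {a : ℝ} (ha : 0 < a) :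
    IntegrableOn (fun t => exp (-a ^ 2 * t) * (√(4 * π * t))⁻¹) (Ioi 0) := by
  by_contra h
  have := integral_exp_div_sqrt ha
  rw [integral_undef h] at this
  have h2 : 0 < 1 / (2 * a) := by positivity
  linarith

theorem integrable_heatWeight_right (κ : ℝ) {t : ℝ} (ht : 0 < t) :
    Integrable fun r => heatWeight κ t r := by
  by_contra h
  have h1 := integral_heatWeight κ ht
  rw [integral_undef h] at h1
  have : 0 < exp (-κ ^ 2 * t) * (√(4 * π * t))⁻¹ := by positivity
  linarith

theorem integrable_heatWeight {κ : ℝ} (hκ : 0 < κ) :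
    Integrable (fun p : ℝ × ℝ => heatWeight κ p.1 p.2)
      ((volume.restrict (Ioi 0)).prod volume) := by
  rw [integrable_prod_iff (measurable_heatWeight κ).aestronglyMeasurable]
  refine ⟨(ae_restrict_iff' measurableSet_Ioi).2 (Eventually.of_forall fun t ht =>
    integrable_heatWeight_right κ ht), ?_⟩
  refine (integrableOn_exp_div_sqrt hκ).congr_fun (fun t ht => ?_) measurableSet_Ioi
  refine (integral_heatWeight κ ht).symm.trans ?_
  exact integral_congr_ae (Eventually.of_forall fun r =>
    (Real.norm_of_nonneg (heatWeight_nonneg ht)).symm)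

theorem integrable_resolventKernel {κ : ℝ} (hκ : 0 < κ) : Integrable (resolventKernel κ) :=
  (integrable_heatWeight hκ).integral_prod_right

/-- The symbol of the Birman–Schwinger operator of a straight line, and the source of the threshold
`-α²/4`. Fubini reduces it to the Fourier transform of a one-dimensional Gaussian, after which `t`
is integrated with rate `κ² + p²`. -/
theorem integral_resolventKernel_mul_exp {κ : ℝ} (hκ : 0 < κ) (p : ℝ) :
    ∫ r, (resolventKernel κ r : ℂ) * Complex.exp (Complex.I * p * r) =
      ((1 / (2 * √(κ ^ 2 + p ^ 2)) : ℝ) : ℂ) := by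
  have hInt : Integrable (fun q : ℝ × ℝ => (heatWeight κ q.1 q.2 : ℂ) *
      Complex.exp (Complex.I * p * q.2)) ((volume.restrict (Ioi 0)).prod volume) := by
    refine (integrable_heatWeight hκ).ofReal.mul_bdd (c := 1) (by fun_prop) ?_
    refine Eventually.of_forall fun q => ?_
    rw [show Complex.I * p * q.2 = ((p * q.2 : ℝ) : ℂ) * Complex.I by push_cast; ring,
      Complex.norm_exp_ofReal_mul_I]
  have h1 : ∀ r : ℝ, (resolventKernel κ r : ℂ) * Complex.exp (Complex.I * p * r) =
      ∫ t in Ioi (0 : ℝ), (heatWeight κ t r : ℂ) * Complex.exp (Complex.I * p * r) := by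
    intro r
    rw [integral_mul_const, resolventKernel, integral_complex_ofReal]
  simp_rw [h1]
  rw [← integral_integral_swap (μ := volume.restrict (Ioi (0 : ℝ))) (ν := volume) hInt]
  have h2 : ∀ t ∈ Ioi (0 : ℝ), ∫ r : ℝ, (heatWeight κ t r : ℂ) * Complex.exp (Complex.I * p * r) =
      ((exp (-√(κ ^ 2 + p ^ 2) ^ 2 * t) * (√(4 * π * t))⁻¹ : ℝ) : ℂ) := by
    intro t ht
    have ht' : (0 : ℝ) < t := ht
    have h3 := fourierIntegral_gaussian (b := (((4 * t)⁻¹ : ℝ) : ℂ))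
      (by rw [Complex.ofReal_re]; positivity) (p : ℂ)
    have h4 : ∀ r : ℝ, (heatWeight κ t r : ℂ) * Complex.exp (Complex.I * p * r) =
        ((exp (-κ ^ 2 * t) * (4 * π * t)⁻¹ : ℝ) : ℂ) * (Complex.exp (Complex.I * p * r) *
          Complex.exp (-(((4 * t)⁻¹ : ℝ) : ℂ) * r ^ 2)) := by
      intro r
      rw [heatWeight, show -(((4 * t)⁻¹ : ℝ) : ℂ) * r ^ 2 = ((-r ^ 2 / (4 * t) : ℝ) : ℂ) by
        push_cast; field_simp, ← Complex.ofReal_exp]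
      push_cast; ring
    simp_rw [h4]
    rw [integral_const_mul, h3]
    have h5 : ((π : ℂ) / (((4 * t)⁻¹ : ℝ) : ℂ)) ^ (1 / 2 : ℂ) = ((√(4 * π * t) : ℝ) : ℂ) := by
      rw [Real.sqrt_eq_rpow, Complex.ofReal_cpow (by positivity)]
      congr 1
      · push_cast; field_simp
      · norm_num
    rw [h5, show -(p : ℂ) ^ 2 / (4 * (((4 * t)⁻¹ : ℝ) : ℂ)) = ((-p ^ 2 * t : ℝ) : ℂ) by
        push_cast; field_simp, ← Complex.ofReal_exp, ← Complex.ofReal_mul, ← Complex.ofReal_mul]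
    congr 1
    rw [Real.sq_sqrt (by positivity), show -(κ ^ 2 + p ^ 2) * t = -κ ^ 2 * t + -p ^ 2 * t by ring,
      Real.exp_add]
    have h6 : (4 * π * t)⁻¹ * √(4 * π * t) = (√(4 * π * t))⁻¹ := by
      rw [inv_mul_eq_div, Real.sqrt_div_self', one_div]
    rw [← h6]
    ring
  rw [setIntegral_congr_fun measurableSet_Ioi h2, integral_complex_ofReal,
    integral_exp_div_sqrt (by positivity)]

theorem integral_resolventKernel {κ : ℝ} (hκ : 0 < κ) : ∫ r, resolventKernel κ r = 1 / (2 * κ) := by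
  have h := integral_resolventKernel_mul_exp hκ 0
  simp only [Complex.ofReal_zero, mul_zero, zero_mul, Complex.exp_zero, mul_one] at h
  rw [integral_complex_ofReal] at h
  have h' := Complex.ofReal_injective h
  rw [h', show κ ^ 2 + 0 ^ 2 = κ ^ 2 by ring, Real.sqrt_sq hκ.le]

end Kernel

/-! ### The curve -/

section Curve

open Set

variable {γ : ℝ → Plane}

/-! ### Regularity of the curve and arc length as Hausdorff measure. -/

theorem IsPiecewiseC1.exists_countable (h : IsPiecewiseC1 γ) :
    ∃ S : Set ℝ, S.Countable ∧ ∀ s ∉ S, ContDiffAt ℝ 1 γ s := by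
  obtain ⟨S, hS, hC⟩ := h
  refine ⟨S, ?_, fun s hs => ?_⟩
  · have : S = ⋃ n : ℕ, S ∩ Icc (-(n : ℝ)) n := by
      ext x
      simp only [mem_iUnion, mem_inter_iff, mem_Icc]
      refine ⟨fun hx => ?_, fun ⟨_, hx, _⟩ => hx⟩
      obtain ⟨n, hn⟩ := exists_nat_ge |x|
      exact ⟨n, hx, abs_le.1 hn⟩
    rw [this]
    exact countable_iUnion fun n => (hS _ _).countable
  · have hfin := hS (s - 1) (s + 1)
    have hnhds : (S ∩ Icc (s - 1) (s + 1))ᶜ ∩ Ioo (s - 1) (s + 1) ∈ 𝓝 s :=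
      inter_mem (hfin.isClosed.isOpen_compl.mem_nhds fun hx => hs hx.1)
        (Ioo_mem_nhds (by linarith) (by linarith))
    obtain ⟨ε, hε, hball⟩ := Metric.mem_nhds_iff.1 hnhds
    rw [Real.ball_eq_Ioo] at hball
    have hdis : Disjoint S (Ioo (s - ε) (s + ε)) := by
      rw [Set.disjoint_left]
      intro x hx hx'
      have := hball hx'
      exact this.1 ⟨hx, Ioo_subset_Icc_self this.2⟩
    exact (hC _ _ (by linarith) hdis).contDiffAt (Icc_mem_nhds (by linarith) (by linarith))

theorem norm_sub_le_abs_of_arcLength (hcont : Continuous γ) (hC1 : IsPiecewiseC1 γ)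
    (harc : IsArcLengthParametrized γ) (a b : ℝ) : ‖γ a - γ b‖ ≤ |a - b| := by
  obtain ⟨S, hS, hC⟩ := hC1.exists_countable
  -- At break points `deriv` may have the default value `0`, which also satisfies the bound.
  have hbound : ∀ s, ‖deriv γ s‖ ≤ 1 := fun s => by
    by_cases h : DifferentiableAt ℝ γ s
    · exact (harc s h).le
    · rw [deriv_zero_of_not_differentiableAt h]; simp
  have hInt : IntervalIntegrable (deriv γ) volume b a := by
    refine (intervalIntegrable_const (c := (1 : ℝ))).mono_fun'
      (stronglyMeasurable_deriv γ).aestronglyMeasurable ?_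
    exact Eventually.of_forall hbound
  have h := MeasureTheory.integral_eq_of_hasDerivAt_off_countable γ (deriv γ) hS
    hcont.continuousOn (fun x hx => ((hC x hx.2).differentiableAt (by simp)).hasDerivAt) hInt
  rw [← h]
  simpa using intervalIntegral.norm_integral_le_of_norm_le_const (C := 1) (a := b) (b := a)
    fun x _ => hbound x

theorem ConditionA1.injective (h : ConditionA1 γ) : Function.Injective γ := by
  obtain ⟨c, hc, -, h⟩ := h
  intro s s' hs
  have := h s s'
  rw [hs, sub_self, norm_zero] at this
  have h2 : |s - s'| ≤ 0 := by
    by_contra h3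
    push Not at h3
    have := mul_pos hc h3
    linarith
  exact sub_eq_zero.1 (abs_nonpos_iff.1 h2)

/-- The curve is 1-Lipschitz, which gives one inequality. For the other, a unit strict derivative
makes `γ` expand distances by at least `1/q` near each regular point, for any `q > 1`. A countable
disjoint decomposition sums these local bounds, and then `q → 1`. The countable exceptional set has
measure zero. -/
theorem hausdorffMeasure_image_curve (hcont : Continuous γ) (hC1 : IsPiecewiseC1 γ)
    (harc : IsArcLengthParametrized γ) (ha1 : ConditionA1 γ) {A : Set ℝ} (hA : MeasurableSet A) :
    Measure.hausdorffMeasure 1 (γ '' A) = volume A := by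
  have hemb : MeasurableEmbedding γ := hcont.measurableEmbedding ha1.injective
  obtain ⟨S, hS, hC⟩ := hC1.exists_countable
  apply le_antisymm
  · have hL : LipschitzWith 1 γ := LipschitzWith.of_dist_le_mul fun x y => by
      simpa [dist_eq_norm] using norm_sub_le_abs_of_arcLength hcont hC1 harc x y
    have := (hL.lipschitzOnWith (s := A)).hausdorffMeasure_image_le (d := 1) zero_le_one
    simpa [hausdorffMeasure_real] using this
  · set ν : Measure ℝ := (Measure.hausdorffMeasure 1).comap γ with hν
    have hνA : ∀ s, ν s = Measure.hausdorffMeasure 1 (γ '' s) := fun s =>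
      hemb.comap_apply _ s
    rw [← hνA]
    have key : ∀ q : NNReal, 1 < q → volume A ≤ q * ν A := by
      intro q hq
      have hloc : ∀ s ∉ S, ∃ U ∈ 𝓝 s, ∀ t ⊆ U, volume t ≤ q * ν t := by
        intro s hs
        have hq0 : (0 : ℝ) < q := by exact_mod_cast zero_lt_one.trans hq
        have hq1 : (1 : ℝ) < q := by exact_mod_cast hq
        have hstrict := (hC s hs).hasStrictDerivAt (by simp)
        have h1 : ‖deriv γ s‖ = 1 := harc s ((hC s hs).differentiableAt (by simp))
        have hε : (0 : ℝ) < 1 - (q : ℝ)⁻¹ := by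
          rw [sub_pos]; exact inv_lt_one_of_one_lt₀ hq1
        -- An approximation error `1 - 1/q` leaves the lower Lipschitz constant `1/q`.
        obtain ⟨U, hU, happ⟩ := hstrict.hasStrictFDerivAt.approximates_deriv_on_nhds
          (c := ⟨1 - (q : ℝ)⁻¹, hε.le⟩) (Or.inr hε)
        refine ⟨U, hU, fun t ht => ?_⟩
        have hanti : AntilipschitzWith q (fun x : t => γ x) := by
          refine AntilipschitzWith.of_le_mul_dist fun x y => ?_
          have h2 := happ x (ht x.2) y (ht y.2)
          have h3 : ((ContinuousLinearMap.toSpanSingleton ℝ (deriv γ s)) ((x : ℝ) - y)) =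
            ((x : ℝ) - y) • deriv γ s := by simp
          rw [h3] at h2
          have h4 : ‖((x : ℝ) - y) • deriv γ s‖ = |(x : ℝ) - y| := by
            rw [norm_smul, h1, mul_one, Real.norm_eq_abs]
          have h5 := norm_sub_norm_le (((x : ℝ) - y) • deriv γ s) (γ x - γ y)
          rw [norm_sub_rev (((x : ℝ) - y) • deriv γ s), h4] at h5
          change _ ≤ (1 - (q : ℝ)⁻¹) * |(x : ℝ) - y| at h2
          rw [Subtype.dist_eq, Real.dist_eq, dist_eq_norm]
          have h6 : (q : ℝ)⁻¹ * |(x : ℝ) - y| ≤ ‖γ x - γ y‖ := by linarith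
          rwa [inv_mul_le_iff₀ hq0] at h6
        have h7 := hanti.le_hausdorffMeasure_image (d := 1) zero_le_one Set.univ
        have h8 : Measure.hausdorffMeasure 1 (Set.univ : Set t) = volume t := by
          rw [← hausdorffMeasure_real,
            ← (isometry_subtype_coe (s := t)).hausdorffMeasure_image (Or.inl zero_le_one)]
          simp
        rw [h8] at h7
        have h9 : (fun x : t => γ x) '' Set.univ = γ '' t := by
          rw [Set.image_univ]; ext; simp
        rw [h9, ← hνA] at h7
        simpa using h7
      choose! U hU hUle using hloc
      obtain ⟨T, hTS, hT, hcov⟩ := TopologicalSpace.countable_cover_nhdsWithin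
        (s := Sᶜ) (f := fun s => interior (U s))
        (fun s hs => mem_nhdsWithin_of_mem_nhds (interior_mem_nhds.2 (hU s hs)))
      rcases T.eq_empty_or_nonempty with hTe | hTne
      · have hSu : S = univ := by
          rw [hTe] at hcov
          simpa using hcov
        rw [hSu] at hS
        have : volume A = 0 := (hS.mono (subset_univ A)).measure_zero volume
        rw [this]; exact zero_le
      obtain ⟨f, rfl⟩ := hT.exists_eq_range hTne
      set D : ℕ → Set ℝ := disjointed fun n => interior (U (f n)) with hD
      have hDm : ∀ n, MeasurableSet (D n) := fun n =>
        MeasurableSet.disjointed (fun _ => isOpen_interior.measurableSet) n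
      have hDU : ∀ n, A ∩ D n ⊆ U (f n) := fun n =>
        inter_subset_right.trans ((disjointed_le _ n).trans interior_subset)
      have hDd : Pairwise (Function.onFun Disjoint fun n => A ∩ D n) := fun i j hij =>
        (disjoint_disjointed _ hij).mono inter_subset_right inter_subset_right
      have hcover : A ⊆ (⋃ n, A ∩ D n) ∪ S := by
        intro x hx
        by_cases hxS : x ∈ S
        · exact Or.inr hxS
        · left
          rw [← inter_iUnion, iUnion_disjointed]
          refine ⟨hx, ?_⟩
          simpa using hcov hxS
      calc volume A ≤ volume ((⋃ n, A ∩ D n) ∪ S) := measure_mono hcover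
        _ ≤ volume (⋃ n, A ∩ D n) + volume S := measure_union_le _ _
        _ = ∑' n, volume (A ∩ D n) := by
            rw [hS.measure_zero, add_zero, measure_iUnion hDd fun n => hA.inter (hDm n)]
        _ ≤ ∑' n, q * ν (A ∩ D n) :=
            ENNReal.tsum_le_tsum fun n => hUle _ (hTS (mem_range_self n)) _ (hDU n)
        _ = q * ν (⋃ n, A ∩ D n) := by
            rw [ENNReal.tsum_mul_left, measure_iUnion hDd fun n => hA.inter (hDm n)]
        _ ≤ q * ν A := by gcongr; exact iUnion_subset fun n => inter_subset_left
    by_cases htop : ν A = ⊤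
    · rw [htop]; exact le_top
    have hlim : Tendsto (fun q : NNReal => (q : ℝ≥0∞) * ν A) (𝓝[>] 1) (𝓝 (1 * ν A)) := by
      refine tendsto_nhdsWithin_of_tendsto_nhds ?_
      refine ENNReal.Tendsto.mul_const ?_ (Or.inr htop)
      exact (ENNReal.continuous_coe.tendsto 1)
    rw [one_mul] at hlim
    exact ge_of_tendsto hlim (eventually_nhdsWithin_of_forall fun q hq => key q hq)

theorem measurePreserving_curve (hcont : Continuous γ) (hC1 : IsPiecewiseC1 γ)
    (harc : IsArcLengthParametrized γ) (ha1 : ConditionA1 γ) :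
    MeasurePreserving γ volume (curveMeasure γ) := by
  have hemb : MeasurableEmbedding γ := hcont.measurableEmbedding ha1.injective
  refine ⟨hcont.measurable, ?_⟩
  ext M hM
  rw [Measure.map_apply hcont.measurable hM, curveMeasure, Measure.restrict_apply hM,
    ← image_preimage_eq_inter_range,
    hausdorffMeasure_image_curve hcont hC1 harc ha1 (hcont.measurable hM)]

/-- By (a1), `|γ(s)|` grows at least linearly, so the exponent `2` makes the weight integrable along
the curve. Schwartz functions then have classes in `L²(m)`. -/
theorem hasTemperateGrowth_curveMeasure (hcont : Continuous γ) (hC1 : IsPiecewiseC1 γ)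
    (harc : IsArcLengthParametrized γ) (ha1 : ConditionA1 γ) :
    (curveMeasure γ).HasTemperateGrowth := by
  have hmp := measurePreserving_curve hcont hC1 harc ha1
  have hemb : MeasurableEmbedding γ := hcont.measurableEmbedding ha1.injective
  obtain ⟨c, hc, hc1, h⟩ := ha1
  refine ⟨2, ?_⟩
  rw [← hmp.integrable_comp_emb hemb]
  have h1 : Integrable fun s : ℝ => (c / (1 + ‖γ 0‖)) ^ (-(2 : ℝ)) * (1 + ‖s‖) ^ (-(2 : ℝ)) :=
    (integrable_one_add_norm (by simp)).const_mul _
  refine h1.mono' ?_ (Eventually.of_forall fun s => ?_)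
  · refine Measurable.aestronglyMeasurable ?_
    have := hcont.measurable
    simp only [Function.comp_def]
    fun_prop
  · simp only [Function.comp_apply, Nat.cast_ofNat]
    rw [Real.norm_of_nonneg (by positivity), ← Real.mul_rpow (by positivity) (by positivity)]
    refine Real.rpow_le_rpow_of_nonpos (by positivity) ?_ (by norm_num)
    rw [div_mul_eq_mul_div, div_le_iff₀ (by positivity), Real.norm_eq_abs]
    have h2 := h s 0
    rw [sub_zero] at h2
    have h3 := norm_sub_le (γ s) (γ 0)
    nlinarith [norm_nonneg (γ s), norm_nonneg (γ 0), abs_nonneg s,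
      mul_nonneg (norm_nonneg (γ s)) (norm_nonneg (γ 0))]

/-! ### Integrals of the resolvent kernel along the curve -/

/-- The kernel of `(-Δ + κ²)⁻¹` at two points of the curve. -/
def curveKernel (γ : ℝ → Plane) (κ s s' : ℝ) : ℝ := resolventKernel κ ‖γ s - γ s'‖

theorem curveKernel_nonneg (κ s s' : ℝ) : 0 ≤ curveKernel γ κ s s' := resolventKernel_nonneg _ _

theorem curveKernel_comm (κ s s' : ℝ) : curveKernel γ κ s s' = curveKernel γ κ s' s := by
  rw [curveKernel, curveKernel, norm_sub_rev]

theorem measurable_curveKernel (hcont : Continuous γ) (κ : ℝ) :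
    Measurable fun p : ℝ × ℝ => curveKernel γ κ p.1 p.2 := by
  have := hcont.measurable
  exact (measurable_resolventKernel κ).comp (by fun_prop)

theorem curveKernel_le {κ a s s' : ℝ} (hκ : 0 < κ) (ha : 0 < a)
    (h : a * |s - s'| ≤ ‖γ s - γ s'‖) (hs : s ≠ s') :
    curveKernel γ κ s s' ≤ resolventKernel κ (a * (s - s')) := by
  have h1 : 0 < |s - s'| := abs_pos.2 (sub_ne_zero.2 hs)
  rw [← resolventKernel_abs κ (a * (s - s')), abs_mul, abs_of_pos ha]
  exact resolventKernel_anti hκ (by positivity) h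

/-- A chord is no longer than its arc, so bending only increases the kernel. This makes the defect
from straightness nonnegative. -/
theorem resolventKernel_le_curveKernel {κ s s' : ℝ} (hκ : 0 < κ) (hinj : Function.Injective γ)
    (hlip : ‖γ s - γ s'‖ ≤ |s - s'|) (hs : s ≠ s') :
    resolventKernel κ (s - s') ≤ curveKernel γ κ s s' := by
  rw [← resolventKernel_abs κ (s - s')]
  exact resolventKernel_anti hκ (norm_pos_iff.2 (sub_ne_zero.2 (hinj.ne hs))) hlip

theorem integrable_resolventKernel_mul_sub {κ a : ℝ} (hκ : 0 < κ) (ha : 0 < a) (s' : ℝ) :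
    Integrable fun s => resolventKernel κ (a * (s - s')) :=
  ((integrable_resolventKernel hκ).comp_mul_left' ha.ne').comp_sub_right s'

theorem integral_resolventKernel_mul_sub {κ a : ℝ} (hκ : 0 < κ) (ha : 0 < a) (s' : ℝ) :
    ∫ s, resolventKernel κ (a * (s - s')) = 1 / (2 * κ * a) := by
  rw [integral_sub_right_eq_self (fun s => resolventKernel κ (a * s)),
    Measure.integral_comp_mul_left, integral_resolventKernel hκ, abs_of_pos (by positivity),
    smul_eq_mul]
  field_simp

theorem integrable_curveKernel {κ c : ℝ} (hκ : 0 < κ) (hc : 0 < c) (hcont : Continuous γ)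
    (h : ∀ s s' : ℝ, c * |s - s'| ≤ ‖γ s - γ s'‖) (s' : ℝ) :
    Integrable fun s => curveKernel γ κ s s' := by
  refine (integrable_resolventKernel_mul_sub hκ hc s').mono'
    ((measurable_curveKernel hcont κ).comp
      (measurable_id.prodMk measurable_const)).aestronglyMeasurable ?_
  filter_upwards [compl_mem_ae_iff.2 (measure_singleton (μ := volume) s')] with s hs
  rw [Real.norm_of_nonneg (curveKernel_nonneg _ _ _)]
  exact curveKernel_le hκ hc (h s s') hs

theorem integral_curveKernel_le {κ c : ℝ} (hκ : 0 < κ) (hc : 0 < c) (hcont : Continuous γ)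
    (h : ∀ s s' : ℝ, c * |s - s'| ≤ ‖γ s - γ s'‖) (s' : ℝ) :
    ∫ s, curveKernel γ κ s s' ≤ 1 / (2 * κ * c) := by
  rw [← integral_resolventKernel_mul_sub hκ hc s']
  refine integral_mono_ae (integrable_curveKernel hκ hc hcont h s')
    (integrable_resolventKernel_mul_sub hκ hc s') ?_
  filter_upwards [compl_mem_ae_iff.2 (measure_singleton (μ := volume) s')] with s hs
  exact curveKernel_le hκ hc (h s s') hs

theorem exists_setIntegral_tail_le {f : ℝ → ℝ} (hf : Integrable f) {ε : ℝ} (hε : 0 < ε) :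
    ∃ l > 0, ∫ r in {r | l < |r|}, f r ≤ ε := by
  have hm : ∀ n : ℕ, MeasurableSet {r : ℝ | (n : ℝ) < |r|} := fun n =>
    measurableSet_lt measurable_const measurable_id.abs
  have h := tendsto_setIntegral_of_antitone (μ := volume) (f := f)
    (s := fun n : ℕ => {r : ℝ | (n : ℝ) < |r|}) hm
    (fun m n hmn r (hr : (n : ℝ) < |r|) =>
      show (m : ℝ) < |r| from lt_of_le_of_lt (by exact_mod_cast hmn) hr) ⟨0, hf.integrableOn⟩
  have hempty : (⋂ n : ℕ, {r : ℝ | (n : ℝ) < |r|}) = ∅ := by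
    ext r
    simp only [mem_iInter, mem_ofPred_eq, mem_empty_iff_false, iff_false, not_forall, not_lt]
    exact exists_nat_ge |r|
  rw [hempty, Measure.restrict_empty, integral_zero_measure] at h
  obtain ⟨n, hn, hn0⟩ := ((h.eventually_le_const hε).and (eventually_gt_atTop 0)).exists
  exact ⟨n, by exact_mod_cast hn0, hn⟩

/-- Far out, the curve is almost straight at every fixed scale. -/
theorem ConditionA2.exists_almost_straight (ha2 : ConditionA2 γ) {η : ℝ} (hη : 0 < η) (l : ℝ) :
    ∃ R : ℝ, ∀ s s' : ℝ, R ≤ |s'| → |s - s'| ≤ l → (1 - η) * |s - s'| ≤ ‖γ s - γ s'‖ := by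
  obtain ⟨d, μ, ω, hd, hμ, hω, hω1, h⟩ := ha2
  have h1 : Tendsto (fun R : ℝ => l / R) atTop (𝓝 0) := tendsto_const_nhds.div_atTop tendsto_id
  have h2 : Tendsto (fun R : ℝ => d * (1 + R ^ (2 * μ)) ^ (-(1 / 2) : ℝ)) atTop (𝓝 0) := by
    have h3 : Tendsto (fun R : ℝ => 1 + R ^ (2 * μ)) atTop atTop :=
      tendsto_atTop_add_const_left _ _ (tendsto_rpow_atTop (by positivity))
    have h4 := ((tendsto_rpow_neg_atTop (y := 1 / 2) (by norm_num)).comp h3).const_mul d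
    simpa using h4
  have hω2 : 1 < ω⁻¹ := (one_lt_inv₀ hω).2 hω1
  have e1 := h1.eventually_lt_const (show 0 < 1 - ω by linarith)
  have e2 := h1.eventually_lt_const (show 0 < ω⁻¹ - 1 by linarith)
  have e3 := h2.eventually_le_const hη
  -- For `|s'| ≥ R` the ratio `s/s'` is within `l/R` of `1`, hence in the window of (a2), and `R ≥
  -- l` gives `|s + s'| ≥ 2R - l ≥ R`.
  obtain ⟨R, h5, h6, h7, h8⟩ := (e1.and (e2.and (e3.and (eventually_ge_atTop (max 1 l))))).exists
  have hR1 : 1 ≤ R := (le_max_left _ _).trans h8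
  have hRl : l ≤ R := (le_max_right _ _).trans h8
  refine ⟨R, fun s s' hs' hss => ?_⟩
  rcases eq_or_ne s s' with rfl | hne
  · simp
  have hs0 : 0 < |s'| := by linarith
  have hs'0 : s' ≠ 0 := abs_pos.1 hs0
  have hpos : 0 < |s - s'| := abs_pos.2 (sub_ne_zero.2 hne)
  have hq : |s / s' - 1| ≤ l / R := by
    rw [div_sub_one hs'0, abs_div]
    have : 0 ≤ l := hpos.le.trans hss
    gcongr
  rw [abs_le] at hq
  have h9 := h s s' hne (by linarith) (by linarith)
  have h10 : R ≤ |s + s'| := by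
    have : |2 * s'| ≤ |s + s'| + |s - s'| := by
      have := abs_sub (s + s') (s - s')
      rwa [show s + s' - (s - s') = 2 * s' by ring] at this
    rw [abs_mul, abs_two] at this
    linarith
  have h11 : d * (1 + |s + s'| ^ (2 * μ)) ^ (-(1 / 2) : ℝ) ≤
      d * (1 + R ^ (2 * μ)) ^ (-(1 / 2) : ℝ) := by
    gcongr ?_ * ?_
    refine Real.rpow_le_rpow_of_nonpos (by positivity) ?_ (by norm_num)
    gcongr
  have h12 : 1 - η ≤ ‖γ s - γ s'‖ / |s - s'| := by linarith
  rwa [le_div_iff₀ hpos] at h12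

/-- Within distance `l` of a far point the curve is nearly straight, and the kernel is bounded by
that of a line contracted by `1 - η`. Beyond `l` the bound from (a1) has a small tail. -/
theorem exists_integral_curveKernel_le {κ : ℝ} (hκ : 0 < κ) (hcont : Continuous γ)
    (ha1 : ConditionA1 γ) (ha2 : ConditionA2 γ) {ε : ℝ} (hε : 0 < ε) :
    ∃ R : ℝ, ∀ s', R ≤ |s'| → ∫ s, curveKernel γ κ s s' ≤ 1 / (2 * κ) + ε := by
  obtain ⟨c, hc, hc1, h⟩ := ha1
  have h1 : Tendsto (fun η : ℝ => 1 / (2 * κ * (1 - η))) (𝓝[>] 0) (𝓝 (1 / (2 * κ))) := by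
    refine tendsto_nhdsWithin_of_tendsto_nhds ?_
    have : ContinuousAt (fun η : ℝ => 1 / (2 * κ * (1 - η))) 0 := by
      refine ContinuousAt.div (by fun_prop) (by fun_prop) ?_
      simp [hκ.ne']
    simpa [ContinuousAt] using this
  obtain ⟨η, ⟨hη1, hη2⟩, hη0⟩ := ((h1.eventually_le_const
    (show 1 / (2 * κ) < 1 / (2 * κ) + ε / 2 by linarith)).and
    (nhdsWithin_le_nhds (eventually_lt_nhds (zero_lt_one (α := ℝ))))).and
    self_mem_nhdsWithin |>.exists
  obtain ⟨l, hl, htail⟩ := exists_setIntegral_tail_le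
    ((integrable_resolventKernel hκ).comp_mul_left' hc.ne') (half_pos hε)
  obtain ⟨R, hR⟩ := ha2.exists_almost_straight hη0 l
  refine ⟨R, fun s' hs' => ?_⟩
  have hm : MeasurableSet {r : ℝ | l < |r|} := measurableSet_lt measurable_const measurable_id.abs
  set f : ℝ → ℝ := {r : ℝ | l < |r|}.indicator fun r => resolventKernel κ (c * r) with hf
  have hfi : Integrable f := ((integrable_resolventKernel hκ).comp_mul_left' hc.ne').indicator hm
  have hη3 : 0 < 1 - η := by linarith
  calc ∫ s, curveKernel γ κ s s'
      ≤ ∫ s, (resolventKernel κ ((1 - η) * (s - s')) + f (s - s')) := by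
        refine integral_mono_ae (integrable_curveKernel hκ hc hcont h s')
          ((integrable_resolventKernel_mul_sub hκ hη3 s').add (hfi.comp_sub_right s')) ?_
        filter_upwards [compl_mem_ae_iff.2 (measure_singleton (μ := volume) s')] with s hs
        by_cases hsl : l < |s - s'|
        · have : f (s - s') = resolventKernel κ (c * (s - s')) :=
            indicator_of_mem (s := {r : ℝ | l < |r|}) hsl _
          rw [this]
          have h2 := curveKernel_le hκ hc (h s s') hs
          linarith [resolventKernel_nonneg κ ((1 - η) * (s - s'))]
        · have : f (s - s') = 0 :=
            indicator_of_notMem (s := {r : ℝ | l < |r|}) hsl _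
          rw [this, add_zero]
          exact curveKernel_le hκ hη3 (hR s s' hs' (not_lt.1 hsl)) hs
    _ = 1 / (2 * κ * (1 - η)) + ∫ r in {r : ℝ | l < |r|}, resolventKernel κ (c * r) := by
        rw [integral_add (integrable_resolventKernel_mul_sub hκ hη3 s') (hfi.comp_sub_right s'),
          integral_resolventKernel_mul_sub hκ hη3, integral_sub_right_eq_self f,
          integral_indicator hm]
    _ ≤ 1 / (2 * κ) + ε := by linarith

end Curve

/-! ### Fourier transforms of densities on the curve -/

section CurveFourier

open Set Real
open scoped ComplexConjugate

variable {γ : ℝ → Plane}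

/-- The Fourier transform of the measure on the plane with the density `v`, as a function of the
arc length, with respect to the length of the curve `γ`. -/
def curveFourier (γ : ℝ → Plane) (v : ℝ → ℂ) (k : Plane) : ℂ :=
  ∫ s, v s * Complex.exp (((-2 * π * inner ℝ (γ s) k : ℝ) : ℂ) * Complex.I)

/-- The symbol of `-Δ + κ²`. -/
def laplaceSymbol (κ : ℝ) (k : Plane) : ℝ := 4 * π ^ 2 * ‖k‖ ^ 2 + κ ^ 2

theorem laplaceSymbol_pos {κ : ℝ} (hκ : 0 < κ) (k : Plane) : 0 < laplaceSymbol κ k := by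
  unfold laplaceSymbol; positivity

theorem continuous_laplaceSymbol (κ : ℝ) : Continuous (laplaceSymbol κ) := by
  unfold laplaceSymbol; fun_prop

theorem norm_curveFourier_le (v : ℝ → ℂ) (k : Plane) : ‖curveFourier γ v k‖ ≤ ∫ s, ‖v s‖ := by
  refine (norm_integral_le_integral_norm _).trans (le_of_eq ?_)
  simp only [norm_mul, Complex.norm_exp_ofReal_mul_I, mul_one]

theorem integrable_mul_exp_curve (hcont : Continuous γ) {v : ℝ → ℂ} (hv : Integrable v)
    (k : Plane) :
    Integrable fun s => v s * Complex.exp (((-2 * π * inner ℝ (γ s) k : ℝ) : ℂ) * Complex.I) := by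
  refine hv.mul_bdd (c := 1) ?_ (Eventually.of_forall fun s => ?_)
  · exact Continuous.aestronglyMeasurable (by fun_prop)
  · rw [Complex.norm_exp_ofReal_mul_I]

theorem continuous_curveFourier (hcont : Continuous γ) {v : ℝ → ℂ} (hv : Integrable v) :
    Continuous (curveFourier γ v) := by
  refine continuous_of_dominated (bound := fun s => ‖v s‖)
    (fun k => (integrable_mul_exp_curve hcont hv k).aestronglyMeasurable) (fun k => ?_) hv.norm ?_
  · refine Eventually.of_forall fun s => ?_
    rw [norm_mul, Complex.norm_exp_ofReal_mul_I, mul_one]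
  · exact Eventually.of_forall fun s => by fun_prop

/-! ### The heat kernel on the curve and on the Fourier side. -/

theorem integrable_gaussian_plane {t : ℝ} (ht : 0 < t) :
    Integrable fun k : Plane => exp (-4 * π ^ 2 * t * ‖k‖ ^ 2) := by
  have h := (GaussianFourier.integrable_cexp_neg_mul_sq_norm_add (V := Plane)
    (b := ((4 * π ^ 2 * t : ℝ) : ℂ)) (by rw [Complex.ofReal_re]; positivity) 0 0).re
  refine h.congr (Eventually.of_forall fun k => ?_)
  simp only [zero_mul, add_zero]
  rw [show -((4 * π ^ 2 * t : ℝ) : ℂ) * (‖k‖ : ℂ) ^ 2 = ((-4 * π ^ 2 * t * ‖k‖ ^ 2 : ℝ) : ℂ) by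
    push_cast; ring, ← Complex.ofReal_exp]
  exact Complex.ofReal_re _

theorem integral_exp_mul_gaussian_plane (x : Plane) {t : ℝ} (ht : 0 < t) :
    ∫ k : Plane, Complex.exp (((2 * π * inner ℝ x k : ℝ) : ℂ) * Complex.I) *
      ((exp (-4 * π ^ 2 * t * ‖k‖ ^ 2) : ℝ) : ℂ) =
      (((4 * π * t)⁻¹ * exp (-‖x‖ ^ 2 / (4 * t)) : ℝ) : ℂ) := by
  have h := GaussianFourier.integral_cexp_neg_mul_sq_norm_add (V := Plane)
    (b := ((4 * π ^ 2 * t : ℝ) : ℂ)) (by rw [Complex.ofReal_re]; positivity)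
    (2 * π * Complex.I) x
  have h1 : ∀ k : Plane, Complex.exp (((2 * π * inner ℝ x k : ℝ) : ℂ) * Complex.I) *
      ((exp (-4 * π ^ 2 * t * ‖k‖ ^ 2) : ℝ) : ℂ) =
      Complex.exp (-((4 * π ^ 2 * t : ℝ) : ℂ) * (‖k‖ : ℂ) ^ 2 +
        2 * π * Complex.I * ((inner ℝ x k : ℝ) : ℂ)) := by
    intro k
    rw [Complex.ofReal_exp, ← Complex.exp_add]
    congr 1
    push_cast; ring
  simp_rw [h1]
  rw [h]
  have h2 : ((Module.finrank ℝ Plane : ℂ) / 2) = 1 := by simp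
  have hp : (π : ℂ) ≠ 0 := by exact_mod_cast pi_ne_zero
  have ht' : (t : ℂ) ≠ 0 := by exact_mod_cast ht.ne'
  rw [h2, Complex.cpow_one, Complex.ofReal_mul (4 * π * t)⁻¹, Complex.ofReal_exp]
  congr 1
  · push_cast; field_simp
  · congr 1
    push_cast
    rw [mul_pow, Complex.I_sq]
    field_simp
    ring

theorem integral_curveFourier_mul_gaussian (hcont : Continuous γ) {v w : ℝ → ℂ}
    (hv : Integrable v) (hw : Integrable w) {t : ℝ} (ht : 0 < t) :
    ∫ k, conj (curveFourier γ w k) * curveFourier γ v k *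
      ((exp (-4 * π ^ 2 * t * ‖k‖ ^ 2) : ℝ) : ℂ) =
    ∫ p : ℝ × ℝ, conj (w p.1) * v p.2 *
      (((4 * π * t)⁻¹ * exp (-‖γ p.1 - γ p.2‖ ^ 2 / (4 * t)) : ℝ) : ℂ) := by
  have hw' : Integrable fun s => conj (w s) := by
    simpa [Function.comp_def] using
      (Complex.conjCLE.toContinuousLinearMap.integrable_comp hw)
  have h1 : ∀ k, conj (curveFourier γ w k) * curveFourier γ v k *
      ((exp (-4 * π ^ 2 * t * ‖k‖ ^ 2) : ℝ) : ℂ) =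
      ∫ p : ℝ × ℝ, conj (w p.1) * v p.2 *
        (Complex.exp (((2 * π * inner ℝ (γ p.1 - γ p.2) k : ℝ) : ℂ) * Complex.I) *
          ((exp (-4 * π ^ 2 * t * ‖k‖ ^ 2) : ℝ) : ℂ)) := by
    intro k
    rw [curveFourier, curveFourier, ← integral_conj, ← integral_prod_mul, ← integral_mul_const]
    refine integral_congr_ae (Eventually.of_forall fun p => ?_)
    simp only [map_mul, ← Complex.exp_conj, Complex.conj_ofReal, Complex.conj_I]
    rw [show ((2 * π * inner ℝ (γ p.1 - γ p.2) k : ℝ) : ℂ) * Complex.I =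
      ((-2 * π * inner ℝ (γ p.1) k : ℝ) : ℂ) * -Complex.I +
      ((-2 * π * inner ℝ (γ p.2) k : ℝ) : ℂ) * Complex.I by
        rw [inner_sub_left]; push_cast; ring, Complex.exp_add]
    ring
  simp_rw [h1]
  rw [integral_integral_swap]
  · refine integral_congr_ae (Eventually.of_forall fun p => ?_)
    simp only
    rw [integral_const_mul, integral_exp_mul_gaussian_plane _ ht]
  · have h2 := (integrable_gaussian_plane ht).ofReal (𝕜 := ℂ) |>.mul_prod (hw'.mul_prod hv)
    have h3 := h2.mul_bdd (c := 1) (g := fun q : Plane × (ℝ × ℝ) =>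
      Complex.exp (((2 * π * inner ℝ (γ q.2.1 - γ q.2.2) q.1 : ℝ) : ℂ) * Complex.I))
      (Continuous.aestronglyMeasurable (by fun_prop))
      (Eventually.of_forall fun q => by rw [Complex.norm_exp_ofReal_mul_I])
    refine h3.congr (Eventually.of_forall fun q => ?_)
    simp only [Function.uncurry, Complex.coe_algebraMap]
    simp
    ring

variable {κ c : ℝ}

/-- Row integrals of the kernel are uniformly bounded by (a1), so an integrable weight in one
variable suffices. With `f = ‖v‖²` this controls the double integrals of products of `L²` densities.
-/
theorem integrable_mul_curveKernel (hκ : 0 < κ) (hc : 0 < c) (hcont : Continuous γ)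
    (h : ∀ s s' : ℝ, c * |s - s'| ≤ ‖γ s - γ s'‖) {f : ℝ → ℝ} (hf : Integrable f) :
    Integrable fun p : ℝ × ℝ => f p.1 * curveKernel γ κ p.1 p.2 := by
  have hm : AEStronglyMeasurable (fun p : ℝ × ℝ => f p.1 * curveKernel γ κ p.1 p.2)
      (volume.prod volume) :=
    hf.aestronglyMeasurable.comp_fst.mul (measurable_curveKernel hcont κ).aestronglyMeasurable
  rw [Measure.volume_eq_prod, integrable_prod_iff hm]
  have hk : ∀ s, Integrable fun s' => curveKernel γ κ s s' := fun s => by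
    simpa only [curveKernel_comm κ s] using integrable_curveKernel hκ hc hcont h s
  refine ⟨Eventually.of_forall fun s => (hk s).const_mul (f s), ?_⟩
  refine (hf.norm.mul_const (1 / (2 * κ * c))).mono' hm.norm.integral_prod_right' ?_
  refine Eventually.of_forall fun s => ?_
  simp only [norm_mul, Real.norm_of_nonneg (curveKernel_nonneg _ _ _)]
  rw [integral_const_mul, Real.norm_of_nonneg (mul_nonneg (norm_nonneg _)
    (integral_nonneg fun _ => curveKernel_nonneg _ _ _))]
  gcongr
  simpa only [curveKernel_comm κ s] using integral_curveKernel_le hκ hc hcont h s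

theorem integrable_mul_curveKernel_right (hκ : 0 < κ) (hc : 0 < c) (hcont : Continuous γ)
    (h : ∀ s s' : ℝ, c * |s - s'| ≤ ‖γ s - γ s'‖) {f : ℝ → ℝ} (hf : Integrable f) :
    Integrable fun p : ℝ × ℝ => f p.2 * curveKernel γ κ p.1 p.2 := by
  have := (integrable_mul_curveKernel hκ hc hcont h hf).swap
  refine this.congr (Eventually.of_forall fun p => ?_)
  simp [curveKernel_comm κ p.2 p.1]

theorem integrable_mul_mul_curveKernel (hκ : 0 < κ) (hc : 0 < c) (hcont : Continuous γ)
    (h : ∀ s s' : ℝ, c * |s - s'| ≤ ‖γ s - γ s'‖) {v w : ℝ → ℂ} (hv : MemLp v 2)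
    (hw : MemLp w 2) :
    Integrable fun p : ℝ × ℝ => conj (w p.1) * v p.2 * (curveKernel γ κ p.1 p.2 : ℂ) := by
  have hv2 : Integrable fun s => ‖v s‖ ^ 2 := (memLp_two_iff_integrable_sq_norm hv.1).1 hv
  have hw2 : Integrable fun s => ‖w s‖ ^ 2 := (memLp_two_iff_integrable_sq_norm hw.1).1 hw
  refine ((integrable_mul_curveKernel hκ hc hcont h hw2).add
    (integrable_mul_curveKernel_right hκ hc hcont h hv2)).mono' ?_ ?_
  · refine AEStronglyMeasurable.mul (AEStronglyMeasurable.mul ?_ ?_) ?_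
    · exact (Complex.continuous_conj.comp_aestronglyMeasurable hw.1).comp_fst
    · exact hv.1.comp_snd
    · exact (Complex.measurable_ofReal.comp (measurable_curveKernel hcont κ)).aestronglyMeasurable
  · refine Eventually.of_forall fun p => ?_
    simp only [norm_mul, RCLike.norm_conj, Complex.norm_real,
      Real.norm_of_nonneg (curveKernel_nonneg _ _ _), Pi.add_apply]
    rw [← add_mul]
    refine mul_le_mul_of_nonneg_right ?_ (curveKernel_nonneg _ _ _)
    nlinarith [sq_nonneg (‖w p.1‖ - ‖v p.2‖), sq_nonneg (‖w p.1‖), sq_nonneg ‖v p.2‖]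

theorem ae_ne_prod : ∀ᵐ p : ℝ × ℝ, p.1 ≠ p.2 := by
  have hm : MeasurableSet {p : ℝ × ℝ | p.1 ≠ p.2} :=
    (measurableSet_eq_fun measurable_fst measurable_snd).compl
  rw [Measure.volume_eq_prod, Measure.ae_prod_iff_ae_ae hm]
  refine Eventually.of_forall fun s => ?_
  filter_upwards [compl_mem_ae_iff.2 (measure_singleton (μ := volume) s)] with s' hs' he
  exact hs' (by simpa using he.symm)

theorem integrable_mul_mul_heatWeight (hκ : 0 < κ) (hc : 0 < c) (hcont : Continuous γ)
    (h : ∀ s s' : ℝ, c * |s - s'| ≤ ‖γ s - γ s'‖) {v w : ℝ → ℂ} (hv : MemLp v 2)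
    (hw : MemLp w 2) :
    Integrable (fun q : ℝ × (ℝ × ℝ) => conj (w q.2.1) * v q.2.2 *
      (heatWeight κ q.1 ‖γ q.2.1 - γ q.2.2‖ : ℂ)) ((volume.restrict (Ioi 0)).prod volume) := by
  have hγ := hcont.measurable
  have hm : AEStronglyMeasurable (fun q : ℝ × (ℝ × ℝ) => conj (w q.2.1) * v q.2.2 *
      (heatWeight κ q.1 ‖γ q.2.1 - γ q.2.2‖ : ℂ)) ((volume.restrict (Ioi 0)).prod volume) := by
    refine AEStronglyMeasurable.mul (AEStronglyMeasurable.mul ?_ ?_) ?_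
    · exact ((Complex.continuous_conj.comp_aestronglyMeasurable hw.1).comp_fst
        (ν := (volume : Measure ℝ))).comp_snd
    · exact (hv.1.comp_snd (μ := (volume : Measure ℝ))).comp_snd
    · exact (Complex.measurable_ofReal.comp
        ((measurable_heatWeight κ).comp (g := fun p : ℝ × ℝ => heatWeight κ p.1 p.2)
          (f := fun q : ℝ × (ℝ × ℝ) => (q.1, ‖γ q.2.1 - γ q.2.2‖))
          (by fun_prop))).aestronglyMeasurable
  have hne : ∀ p : ℝ × ℝ, p.1 ≠ p.2 → ‖γ p.1 - γ p.2‖ ≠ 0 := fun p hp => by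
    have h1 := h p.1 p.2
    have h2 : 0 < |p.1 - p.2| := abs_pos.2 (sub_ne_zero.2 hp)
    have := mul_pos hc h2
    exact (this.trans_le h1).ne'
  rw [integrable_prod_iff' hm]
  refine ⟨?_, ?_⟩
  · filter_upwards [ae_ne_prod] with p hp
    exact ((integrableOn_heatWeight hκ (hne p hp)).ofReal).const_mul _
  · refine (integrable_mul_mul_curveKernel hκ hc hcont h hv hw).norm.congr
      (Eventually.of_forall fun p => ?_)
    simp only [norm_mul, Complex.norm_real]
    rw [integral_const_mul, Real.norm_of_nonneg (curveKernel_nonneg _ _ _), curveKernel,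
      resolventKernel]
    congr 1
    exact setIntegral_congr_fun measurableSet_Ioi fun t ht =>
      (Real.norm_of_nonneg (heatWeight_nonneg ht)).symm

theorem exp_mul_exp_gaussian (κ t : ℝ) (k : Plane) :
    exp (-κ ^ 2 * t) * exp (-4 * π ^ 2 * t * ‖k‖ ^ 2) = exp (-laplaceSymbol κ k * t) := by
  rw [← Real.exp_add, laplaceSymbol]; congr 1; ring

theorem integral_exp_laplaceSymbol (hκ : 0 < κ) (k : Plane) :
    ∫ t in Ioi (0 : ℝ), exp (-laplaceSymbol κ k * t) = (laplaceSymbol κ k)⁻¹ := by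
  have := integral_exp_mul_Ioi (a := -laplaceSymbol κ k) (by linarith [laplaceSymbol_pos hκ k]) 0
  simpa using this

theorem setIntegral_heat_curveFourier (hcont : Continuous γ) {v w : ℝ → ℂ} (hv1 : Integrable v)
    (hw1 : Integrable w) {t : ℝ} (ht : 0 < t) :
    ∫ k, conj (curveFourier γ w k) * curveFourier γ v k *
      ((exp (-laplaceSymbol κ k * t) : ℝ) : ℂ) =
    ∫ p : ℝ × ℝ, conj (w p.1) * v p.2 * (heatWeight κ t ‖γ p.1 - γ p.2‖ : ℂ) := by
  have h1 := congrArg (fun z => ((exp (-κ ^ 2 * t) : ℝ) : ℂ) * z)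
    (integral_curveFourier_mul_gaussian hcont hv1 hw1 ht)
  rw [← integral_const_mul, ← integral_const_mul] at h1
  refine Eq.trans (integral_congr_ae (Eventually.of_forall fun k => ?_))
    (h1.trans (integral_congr_ae (Eventually.of_forall fun p => ?_)))
  · simp only [← exp_mul_exp_gaussian]
    push_cast; ring
  · simp only [heatWeight]
    push_cast; ring

/-- For `w = v` the integrand on the frequency side is nonnegative. Its integral at fixed `t` is the
heat form on the curve, whose integrability in `t` is known from the kernel side. This justifies
Fubini when the heat semigroup is integrated to the resolvent. -/
theorem integrable_curveFourier_sq_mul_exp (hκ : 0 < κ) (hc : 0 < c) (hcont : Continuous γ)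
    (h : ∀ s s' : ℝ, c * |s - s'| ≤ ‖γ s - γ s'‖) {v : ℝ → ℂ} (hv1 : Integrable v)
    (hv : MemLp v 2) :
    Integrable (fun q : ℝ × Plane => ‖curveFourier γ v q.2‖ ^ 2 *
      exp (-laplaceSymbol κ q.2 * q.1)) ((volume.restrict (Ioi 0)).prod volume) := by
  have hF := continuous_curveFourier hcont hv1
  have hS := continuous_laplaceSymbol κ
  have hm : AEStronglyMeasurable (fun q : ℝ × Plane => ‖curveFourier γ v q.2‖ ^ 2 *
      exp (-laplaceSymbol κ q.2 * q.1)) ((volume.restrict (Ioi 0)).prod volume) :=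
    Continuous.aestronglyMeasurable (by fun_prop)
  rw [integrable_prod_iff hm]
  constructor
  · refine (ae_restrict_iff' measurableSet_Ioi).2 (Eventually.of_forall fun t ht => ?_)
    have h1 : Integrable fun k : Plane => exp (-laplaceSymbol κ k * t) := by
      simp_rw [← exp_mul_exp_gaussian]
      exact (integrable_gaussian_plane ht).const_mul _
    refine h1.bdd_mul (c := (∫ s, ‖v s‖) ^ 2) (Continuous.aestronglyMeasurable (by fun_prop)) ?_
    refine Eventually.of_forall fun k => ?_
    rw [norm_pow, norm_norm]
    gcongr
    exact norm_curveFourier_le v k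
  · have h2 := (integrable_mul_mul_heatWeight hκ hc hcont h hv hv).integral_prod_left.re
    refine IntegrableOn.congr_fun h2 (fun t ht => ?_) measurableSet_Ioi
    simp only
    rw [← setIntegral_heat_curveFourier hcont hv1 hv1 ht]
    have h3 : ∀ k, conj (curveFourier γ v k) * curveFourier γ v k *
      ((exp (-laplaceSymbol κ k * t) : ℝ) : ℂ) = ((‖curveFourier γ v k‖ ^ 2 *
      exp (-laplaceSymbol κ k * t) : ℝ) : ℂ) := fun k => by
        rw [mul_comm (conj _), Complex.mul_conj, Complex.normSq_eq_norm_sq]; push_cast; ring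
    simp_rw [h3]
    rw [integral_complex_ofReal]
    simp only [RCLike.re_to_complex, Complex.ofReal_re]
    refine integral_congr_ae (Eventually.of_forall fun k => ?_)
    exact (Real.norm_of_nonneg (by positivity)).symm

theorem integrable_curveFourier_sq_div (hκ : 0 < κ) (hc : 0 < c) (hcont : Continuous γ)
    (h : ∀ s s' : ℝ, c * |s - s'| ≤ ‖γ s - γ s'‖) {v : ℝ → ℂ} (hv1 : Integrable v)
    (hv : MemLp v 2) :
    Integrable fun k => ‖curveFourier γ v k‖ ^ 2 * (laplaceSymbol κ k)⁻¹ := by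
  have := (integrable_curveFourier_sq_mul_exp hκ hc hcont h hv1 hv).integral_prod_right
  refine this.congr (Eventually.of_forall fun k => ?_)
  simp only
  rw [integral_const_mul, integral_exp_laplaceSymbol hκ]

/-- The form of `(-Δ + κ²)⁻¹` on densities on the curve. -/
theorem integral_curveFourier_div (hκ : 0 < κ) (hc : 0 < c) (hcont : Continuous γ)
    (h : ∀ s s' : ℝ, c * |s - s'| ≤ ‖γ s - γ s'‖) {v w : ℝ → ℂ} (hv1 : Integrable v)
    (hv : MemLp v 2) (hw1 : Integrable w) (hw : MemLp w 2) :
    ∫ k, conj (curveFourier γ w k) * curveFourier γ v k * (((laplaceSymbol κ k)⁻¹ : ℝ) : ℂ) =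
    ∫ p : ℝ × ℝ, conj (w p.1) * v p.2 * (curveKernel γ κ p.1 p.2 : ℂ) := by
  have hFv := continuous_curveFourier hcont hv1
  have hFw := continuous_curveFourier hcont hw1
  have hS := continuous_laplaceSymbol κ
  have hInt : Integrable (fun q : ℝ × Plane => conj (curveFourier γ w q.2) *
      curveFourier γ v q.2 * ((exp (-laplaceSymbol κ q.2 * q.1) : ℝ) : ℂ))
      ((volume.restrict (Ioi 0)).prod volume) := by
    refine ((integrable_curveFourier_sq_mul_exp hκ hc hcont h hw1 hw).add
      (integrable_curveFourier_sq_mul_exp hκ hc hcont h hv1 hv)).mono'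
      (Continuous.aestronglyMeasurable (by fun_prop)) (Eventually.of_forall fun q => ?_)
    simp only [norm_mul, RCLike.norm_conj, Complex.norm_real, Real.norm_of_nonneg (exp_pos _).le,
      Pi.add_apply]
    rw [← add_mul]
    refine mul_le_mul_of_nonneg_right ?_ (exp_pos _).le
    nlinarith [sq_nonneg (‖curveFourier γ w q.2‖ - ‖curveFourier γ v q.2‖),
      sq_nonneg ‖curveFourier γ w q.2‖, sq_nonneg ‖curveFourier γ v q.2‖]
  -- The inverse symbol is written as `∫ e^{-St} dt`; at fixed `t` the identity is the Gaussian one,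
  -- and Fubini is used on both sides.
  have h1 : ∀ k, conj (curveFourier γ w k) * curveFourier γ v k *
      (((laplaceSymbol κ k)⁻¹ : ℝ) : ℂ) = ∫ t in Ioi (0 : ℝ), conj (curveFourier γ w k) *
      curveFourier γ v k * ((exp (-laplaceSymbol κ k * t) : ℝ) : ℂ) := fun k => by
    rw [integral_const_mul, integral_complex_ofReal, integral_exp_laplaceSymbol hκ]
  simp_rw [h1]
  rw [← integral_integral_swap (μ := volume.restrict (Ioi (0 : ℝ))) hInt,
    setIntegral_congr_fun measurableSet_Ioi
      (fun t ht => setIntegral_heat_curveFourier hcont hv1 hw1 ht),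
    integral_integral_swap (integrable_mul_mul_heatWeight hκ hc hcont h hv hw)]
  refine integral_congr_ae (Eventually.of_forall fun p => ?_)
  simp only
  rw [integral_const_mul, integral_complex_ofReal, curveKernel, resolventKernel]

/-- The Schur test for the form of `(-Δ + κ²)⁻¹` on densities supported in a part of the curve. -/
theorem integral_curveFourier_sq_div_le (hκ : 0 < κ) (hc : 0 < c) (hcont : Continuous γ)
    (h : ∀ s s' : ℝ, c * |s - s'| ≤ ‖γ s - γ s'‖) {v : ℝ → ℂ} (hv1 : Integrable v)
    (hv : MemLp v 2) {b : ℝ} (hb : ∀ s, v s ≠ 0 → ∫ s', curveKernel γ κ s' s ≤ b) :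
    ∫ k, ‖curveFourier γ v k‖ ^ 2 * (laplaceSymbol κ k)⁻¹ ≤ b * ∫ s, ‖v s‖ ^ 2 := by
  have hv2 : Integrable fun s => ‖v s‖ ^ 2 := (memLp_two_iff_integrable_sq_norm hv.1).1 hv
  have i1 := integrable_mul_curveKernel hκ hc hcont h hv2
  have i2 := integrable_mul_curveKernel_right hκ hc hcont h hv2
  have e1 := integral_curveFourier_div hκ hc hcont h hv1 hv hv1 hv
  have e2 : ((∫ k, ‖curveFourier γ v k‖ ^ 2 * (laplaceSymbol κ k)⁻¹ : ℝ) : ℂ) =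
      ∫ p : ℝ × ℝ, conj (v p.1) * v p.2 * (curveKernel γ κ p.1 p.2 : ℂ) := by
    rw [← e1, ← integral_complex_ofReal]
    refine integral_congr_ae (Eventually.of_forall fun k => ?_)
    simp only
    rw [mul_comm (conj _), Complex.mul_conj, Complex.normSq_eq_norm_sq]
    push_cast; ring
  have e3 : ∫ p : ℝ × ℝ, ‖v p.1‖ ^ 2 * curveKernel γ κ p.1 p.2 =
      ∫ s, ‖v s‖ ^ 2 * ∫ s', curveKernel γ κ s' s := by
    rw [Measure.volume_eq_prod, integral_prod _ i1]
    refine integral_congr_ae (Eventually.of_forall fun s => ?_)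
    simp only
    rw [integral_const_mul]
    simp_rw [curveKernel_comm κ s]
  have e4 : ∫ p : ℝ × ℝ, ‖v p.2‖ ^ 2 * curveKernel γ κ p.1 p.2 =
      ∫ s, ‖v s‖ ^ 2 * ∫ s', curveKernel γ κ s' s := by
    rw [Measure.volume_eq_prod, integral_prod_symm _ i2]
    refine integral_congr_ae (Eventually.of_forall fun s => ?_)
    simp only
    rw [integral_const_mul]
  have e5 : ∫ s, ‖v s‖ ^ 2 * ∫ s', curveKernel γ κ s' s ≤ b * ∫ s, ‖v s‖ ^ 2 := by
    rw [← integral_const_mul]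
    refine integral_mono_of_nonneg (Eventually.of_forall fun s => ?_) (hv2.const_mul b)
      (Eventually.of_forall fun s => ?_)
    · exact mul_nonneg (sq_nonneg _) (integral_nonneg fun _ => curveKernel_nonneg _ _ _)
    · simp only
      by_cases hs : v s = 0
      · simp [hs]
      · rw [mul_comm b]
        gcongr
        exact hb s hs
  calc ∫ k, ‖curveFourier γ v k‖ ^ 2 * (laplaceSymbol κ k)⁻¹
      ≤ ‖((∫ k, ‖curveFourier γ v k‖ ^ 2 * (laplaceSymbol κ k)⁻¹ : ℝ) : ℂ)‖ := by
        rw [Complex.norm_real]; exact Real.le_norm_self _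
    _ ≤ ∫ p : ℝ × ℝ, ‖conj (v p.1) * v p.2 * (curveKernel γ κ p.1 p.2 : ℂ)‖ := by
        rw [e2]; exact norm_integral_le_integral_norm _
    -- The product of two values of `v` is at most half the sum of their squares. By symmetry of the
    -- kernel both halves give the same row integral, needed only where `v` is nonzero.
    _ ≤ ∫ p : ℝ × ℝ, ((1 / 2) * (‖v p.1‖ ^ 2 * curveKernel γ κ p.1 p.2) +
          (1 / 2) * (‖v p.2‖ ^ 2 * curveKernel γ κ p.1 p.2)) := by
        refine integral_mono (integrable_mul_mul_curveKernel hκ hc hcont h hv hv).norm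
          ((i1.const_mul _).add (i2.const_mul _)) fun p => ?_
        simp only [norm_mul, RCLike.norm_conj, Complex.norm_real,
          Real.norm_of_nonneg (curveKernel_nonneg _ _ _)]
        have h6 := curveKernel_nonneg (γ := γ) κ p.1 p.2
        nlinarith [mul_nonneg (sq_nonneg (‖v p.1‖ - ‖v p.2‖)) h6]
    _ = ∫ s, ‖v s‖ ^ 2 * ∫ s', curveKernel γ κ s' s := by
        rw [integral_add (i1.const_mul _) (i2.const_mul _), integral_const_mul, integral_const_mul,
          e3, e4]
        ring
    _ ≤ _ := e5

end CurveFourier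

/-! ### The Sobolev space on the Fourier side -/

section Sobolev

open Real
open scoped ComplexConjugate FourierTransform
open ContinuousLinearMap (adjoint)

theorem inner_toLp_toLp {β : Type*} [MeasurableSpace β] {μ : Measure β} {f g : β → ℂ}
    (hf : MemLp f 2 μ) (hg : MemLp g 2 μ) :
    inner ℂ (hf.toLp f) (hg.toLp g) = ∫ x, conj (f x) * g x ∂μ := by
  rw [L2.inner_def]
  refine integral_congr_ae ?_
  filter_upwards [hf.coeFn_toLp, hg.coeFn_toLp] with x h1 h2
  rw [h1, h2, RCLike.inner_apply, mul_comm]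

theorem norm_toLp_sq {β : Type*} [MeasurableSpace β] {μ : Measure β} {f : β → ℂ}
    (hf : MemLp f 2 μ) : ‖hf.toLp f‖ ^ 2 = ∫ x, ‖f x‖ ^ 2 ∂μ := by
  have h := inner_toLp_toLp hf hf
  rw [inner_self_eq_norm_sq_complex] at h
  have h2 : ∀ x, conj (f x) * f x = ((‖f x‖ ^ 2 : ℝ) : ℂ) := fun x => by
    rw [mul_comm, Complex.mul_conj, Complex.normSq_eq_norm_sq]
  simp_rw [h2] at h
  rw [integral_complex_ofReal] at h
  exact_mod_cast h

theorem integrable_conj_mul {β : Type*} [MeasurableSpace β] {μ : Measure β} {f g : β → ℂ}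
    (hf : MemLp f 2 μ) (hg : MemLp g 2 μ) : Integrable (fun x => conj (f x) * g x) μ := by
  refine (L2.integrable_inner (𝕜 := ℂ) (hf.toLp f) (hg.toLp g)).congr ?_
  filter_upwards [hf.coeFn_toLp, hg.coeFn_toLp] with x h1 h2
  rw [h1, h2, RCLike.inner_apply, mul_comm]

/-- The weight `(1 + 4 π² ‖k‖²)^r`. -/
def besselWeight (r : ℝ) (k : Plane) : ℂ := (((1 + ‖(2 * π) • k‖ ^ 2) ^ r : ℝ) : ℂ)

theorem hasTemperateGrowth_besselWeight (r : ℝ) : (besselWeight r).HasTemperateGrowth := by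
  have h1 : (fun k : Plane => (2 * π) • k).HasTemperateGrowth := by fun_prop
  have h2 := (Function.hasTemperateGrowth_one_add_norm_sq_rpow Plane r).comp h1
  exact (Complex.ofRealCLM.hasTemperateGrowth).comp h2

theorem one_add_norm_sq_eq_laplaceSymbol (k : Plane) :
    1 + ‖(2 * π) • k‖ ^ 2 = laplaceSymbol 1 k := by
  rw [norm_smul, mul_pow, laplaceSymbol, Real.norm_of_nonneg (by positivity)]; ring

theorem besselWeight_half (k : Plane) :
    besselWeight (1 / 2) k = ((√(laplaceSymbol 1 k) : ℝ) : ℂ) := by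
  rw [besselWeight, one_add_norm_sq_eq_laplaceSymbol, Real.sqrt_eq_rpow]

theorem besselWeight_neg_half (k : Plane) :
    besselWeight (-(1 / 2)) k = (((√(laplaceSymbol 1 k))⁻¹ : ℝ) : ℂ) := by
  rw [besselWeight, one_add_norm_sq_eq_laplaceSymbol, Real.sqrt_eq_rpow,
    Real.rpow_neg (laplaceSymbol_pos one_pos k).le]

theorem sqrt_laplaceSymbol_pos (k : Plane) : 0 < √(laplaceSymbol 1 k) :=
  Real.sqrt_pos.2 (laplaceSymbol_pos one_pos k)

/-- The Schwartz function `(1 + 4 π² ‖k‖²)^(r) (𝓕 φ)(k)`. -/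
def weightedFourier (r : ℝ) : 𝓢(Plane, ℂ) →ₗ[ℂ] 𝓢(Plane, ℂ) where
  toFun φ := SchwartzMap.smulLeftCLM ℂ (besselWeight r) (𝓕 φ)
  map_add' φ ψ := by rw [FourierTransform.fourier_add, map_add]
  map_smul' a φ := by rw [FourierTransform.fourier_smul, map_smul]; rfl

theorem weightedFourier_apply (r : ℝ) (φ : 𝓢(Plane, ℂ)) (k : Plane) :
    weightedFourier r φ k = besselWeight r k * 𝓕 φ k :=
  SchwartzMap.smulLeftCLM_apply_apply (hasTemperateGrowth_besselWeight r) _ _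

theorem weightedFourier_half_apply (φ : 𝓢(Plane, ℂ)) (k : Plane) :
    weightedFourier (1 / 2) φ k = ((√(laplaceSymbol 1 k) : ℝ) : ℂ) * 𝓕 φ k := by
  rw [weightedFourier_apply, besselWeight_half]

theorem weightedFourier_neg_half_apply (φ : 𝓢(Plane, ℂ)) (k : Plane) :
    weightedFourier (-(1 / 2)) φ k = (((√(laplaceSymbol 1 k))⁻¹ : ℝ) : ℂ) * 𝓕 φ k := by
  rw [weightedFourier_apply, besselWeight_neg_half]

/-- The Fourier transform and the smooth powers of the symbol are invertible on Schwartz space, so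
the density of Schwartz functions in `L²` passes to all weighted versions. -/
theorem weightedFourier_surjective (r : ℝ) : Function.Surjective (weightedFourier r) := by
  intro ψ
  refine ⟨𝓕⁻ (SchwartzMap.smulLeftCLM ℂ (besselWeight (-r)) ψ), ?_⟩
  ext k
  rw [weightedFourier_apply, FourierTransform.fourier_fourierInv_eq,
    SchwartzMap.smulLeftCLM_apply_apply (hasTemperateGrowth_besselWeight _), smul_eq_mul,
    ← mul_assoc, besselWeight, besselWeight, ← Complex.ofReal_mul,
    ← Real.rpow_add (by positivity)]
  simp

/-- Schwartz functions as elements of the Sobolev space `W_{1,2}(ℝ²)`, represented on the Fourier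
side. -/
def sobolevEmb : 𝓢(Plane, ℂ) →ₗ[ℂ] L2Plane :=
  (SchwartzMap.toLpCLM ℂ ℂ 2 (volume : Measure Plane)).toLinearMap ∘ₗ weightedFourier (1 / 2)

theorem sobolevEmb_apply (φ : 𝓢(Plane, ℂ)) :
    sobolevEmb φ = (weightedFourier (1 / 2) φ).toLp 2 volume := rfl

theorem denseRange_toLp_plane :
    DenseRange fun φ : 𝓢(Plane, ℂ) => φ.toLp 2 (volume : Measure Plane) :=
  SchwartzMap.denseRange_toLpCLM (by norm_num)

theorem denseRange_toLp_weightedFourier (r : ℝ) :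
    DenseRange fun φ : 𝓢(Plane, ℂ) => (weightedFourier r φ).toLp 2 (volume : Measure Plane) := by
  have h := denseRange_toLp_plane
  unfold DenseRange at h ⊢
  convert h using 1
  exact (weightedFourier_surjective r).range_comp (fun ψ => ψ.toLp 2 (volume : Measure Plane))

theorem denseRange_sobolevEmb : DenseRange sobolevEmb := denseRange_toLp_weightedFourier _

theorem inner_toLp_schwartz (φ ψ : 𝓢(Plane, ℂ)) :
    inner ℂ (φ.toLp 2 (volume : Measure Plane)) (ψ.toLp 2 volume) = ∫ x, conj (φ x) * ψ x :=
  inner_toLp_toLp (φ.memLp 2) (ψ.memLp 2)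

theorem inner_toLp_eq_fourier (φ ψ : 𝓢(Plane, ℂ)) :
    inner ℂ (φ.toLp 2 (volume : Measure Plane)) (ψ.toLp 2 volume) =
      ∫ k, conj (𝓕 φ k) * 𝓕 ψ k := by
  rw [← SchwartzMap.inner_fourier_toL2_eq, inner_toLp_schwartz]

theorem fourier_lineDeriv_apply (φ : 𝓢(Plane, ℂ)) (i : Fin 2) (k : Plane) :
    𝓕 (∂_{e i} φ) k = 2 * π * Complex.I * ((k i : ℝ) : ℂ) * 𝓕 φ k := by
  rw [SchwartzMap.fourier_lineDerivOp_eq]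
  have : (inner ℝ · (e i) : Plane → ℝ).HasTemperateGrowth :=
    ((innerSL ℝ).flip (e i)).hasTemperateGrowth
  rw [_root_.smul_apply, SchwartzMap.smulLeftCLM_apply_apply this, e,
    EuclideanSpace.inner_single_right]
  simp
  ring

/-- By Plancherel the weight `1 + 4π²|k|²` splits into the `L²` and the gradient parts, so the norm
of `L²` on the Fourier side is the `W_{1,2}` norm. -/
theorem inner_sobolevEmb (φ ψ : 𝓢(Plane, ℂ)) :
    inner ℂ (sobolevEmb φ) (sobolevEmb ψ) =
      inner ℂ (φ.toLp 2 (volume : Measure Plane)) (ψ.toLp 2 volume) +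
      ∑ i, inner ℂ ((∂_{e i} φ).toLp 2 (volume : Measure Plane)) ((∂_{e i} ψ).toLp 2 volume) := by
  rw [sobolevEmb_apply, sobolevEmb_apply, inner_toLp_schwartz, inner_toLp_eq_fourier]
  simp_rw [inner_toLp_eq_fourier]
  rw [Fin.sum_univ_two]
  have hi : ∀ f g : 𝓢(Plane, ℂ), Integrable fun k => conj (𝓕 f k) * 𝓕 g k := fun f g =>
    integrable_conj_mul ((𝓕 f).memLp 2) ((𝓕 g).memLp 2)
  rw [← integral_add (hi _ _) (hi _ _)]
  refine Eq.trans ?_ (integral_add (hi _ _) ((hi _ _).add (hi _ _)))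
  refine integral_congr_ae (Eventually.of_forall fun k => ?_)
  simp only [fourier_lineDeriv_apply, weightedFourier_half_apply, map_mul, Complex.conj_ofReal,
    Complex.conj_I, map_ofNat]
  have h1 : ((√(laplaceSymbol 1 k) : ℝ) : ℂ) * ((√(laplaceSymbol 1 k) : ℝ) : ℂ) =
      1 + 4 * π ^ 2 * ((k 0 : ℝ) : ℂ) ^ 2 + 4 * π ^ 2 * ((k 1 : ℝ) : ℂ) ^ 2 := by
    rw [← Complex.ofReal_mul, Real.mul_self_sqrt (laplaceSymbol_pos one_pos k).le, laplaceSymbol,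
      EuclideanSpace.norm_sq_eq, Fin.sum_univ_two]
    simp only [Real.norm_eq_abs, sq_abs]
    push_cast; ring
  linear_combination (conj (𝓕 φ k) * 𝓕 ψ k) * h1 +
    (4 * π ^ 2 * (((k 0 : ℝ) : ℂ) ^ 2 + ((k 1 : ℝ) : ℂ) ^ 2) * (conj (𝓕 φ k) * 𝓕 ψ k)) *
      Complex.I_sq

theorem norm_sobolevEmb_sq (φ : 𝓢(Plane, ℂ)) :
    ‖sobolevEmb φ‖ ^ 2 = ‖φ.toLp 2 (volume : Measure Plane)‖ ^ 2 +
      ∑ i, ‖(∂_{e i} φ).toLp 2 (volume : Measure Plane)‖ ^ 2 := by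
  have h := inner_sobolevEmb φ φ
  simp_rw [inner_self_eq_norm_sq_complex] at h
  exact_mod_cast h

theorem norm_toLp_le_norm_sobolevEmb (φ : 𝓢(Plane, ℂ)) :
    ‖φ.toLp 2 (volume : Measure Plane)‖ ≤ 1 * ‖sobolevEmb φ‖ := by
  rw [one_mul]
  refine le_of_sq_le_sq ?_ (norm_nonneg _)
  rw [norm_sobolevEmb_sq]
  linarith [Finset.sum_nonneg fun (i : Fin 2) (_ : i ∈ Finset.univ) =>
    sq_nonneg ‖(∂_{e i} φ).toLp 2 (volume : Measure Plane)‖]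

theorem norm_lineDeriv_toLp_le_norm_sobolevEmb (i : Fin 2) (φ : 𝓢(Plane, ℂ)) :
    ‖(∂_{e i} φ).toLp 2 (volume : Measure Plane)‖ ≤ 1 * ‖sobolevEmb φ‖ := by
  rw [one_mul]
  refine le_of_sq_le_sq ?_ (norm_nonneg _)
  rw [norm_sobolevEmb_sq]
  have := Finset.single_le_sum (fun (i : Fin 2) _ =>
    sq_nonneg ‖(∂_{e i} φ).toLp 2 (volume : Measure Plane)‖) (Finset.mem_univ i)
  have h2 := sq_nonneg ‖φ.toLp 2 (volume : Measure Plane)‖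
  linarith

/-- The embedding of the Sobolev space into `L²(ℝ²)`. -/
def sobolevIncl : L2Plane →L[ℂ] L2Plane :=
  (SchwartzMap.toLpCLM ℂ ℂ 2 (volume : Measure Plane)).toLinearMap.extendOfNorm sobolevEmb

theorem sobolevIncl_emb (φ : 𝓢(Plane, ℂ)) : sobolevIncl (sobolevEmb φ) = φ.toLp 2 volume :=
  LinearMap.extendOfNorm_eq denseRange_sobolevEmb ⟨1, norm_toLp_le_norm_sobolevEmb⟩ φ

/-- The map that sends a Schwartz function to its partial derivative in `L²(ℝ²)`. -/
def schwartzPartial (i : Fin 2) : 𝓢(Plane, ℂ) →ₗ[ℂ] L2Plane where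
  toFun φ := (∂_{e i} φ).toLp 2 volume
  map_add' φ ψ := by rw [LineDeriv.lineDerivOp_add]; rfl
  map_smul' a φ := by rw [LineDeriv.lineDerivOp_smul]; rfl

/-- The partial derivatives on the Sobolev space. -/
def sobolevPartial (i : Fin 2) : L2Plane →L[ℂ] L2Plane :=
  (schwartzPartial i).extendOfNorm sobolevEmb

theorem sobolevPartial_emb (i : Fin 2) (φ : 𝓢(Plane, ℂ)) :
    sobolevPartial i (sobolevEmb φ) = (∂_{e i} φ).toLp 2 volume :=
  LinearMap.extendOfNorm_eq (f := schwartzPartial i) denseRange_sobolevEmb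
    ⟨1, norm_lineDeriv_toLp_le_norm_sobolevEmb i⟩ φ

theorem inner_eq_sobolev (h h' : L2Plane) :
    inner ℂ h h' = inner ℂ (sobolevIncl h) (sobolevIncl h') +
      ∑ i, inner ℂ (sobolevPartial i h) (sobolevPartial i h') := by
  refine denseRange_sobolevEmb.induction_on₂ (p := fun h h' => inner ℂ h h' =
    inner ℂ (sobolevIncl h) (sobolevIncl h') +
      ∑ i, inner ℂ (sobolevPartial i h) (sobolevPartial i h')) ?_ (fun φ ψ => ?_) h h'
  · exact isClosed_eq (by fun_prop) (by fun_prop)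
  · simp only [sobolevIncl_emb, sobolevPartial_emb, inner_sobolevEmb]

/-- The adjoint of the embedding of the Sobolev space on Schwartz functions. -/
theorem adjoint_sobolevIncl_toLp (φ : 𝓢(Plane, ℂ)) :
    adjoint sobolevIncl (φ.toLp 2 volume) = (weightedFourier (-(1 / 2)) φ).toLp 2 volume := by
  refine Dense.eq_of_inner_left ℂ denseRange_sobolevEmb ?_
  rintro _ ⟨ψ, rfl⟩
  rw [ContinuousLinearMap.adjoint_inner_left, sobolevIncl_emb, inner_toLp_eq_fourier,
    sobolevEmb_apply, inner_toLp_schwartz]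
  refine integral_congr_ae (Eventually.of_forall fun k => ?_)
  simp only [weightedFourier_half_apply, weightedFourier_neg_half_apply, map_mul,
    Complex.conj_ofReal]
  have h1 : (((√(laplaceSymbol 1 k))⁻¹ : ℝ) : ℂ) * ((√(laplaceSymbol 1 k) : ℝ) : ℂ) = 1 := by
    rw [← Complex.ofReal_mul, inv_mul_cancel₀ (sqrt_laplaceSymbol_pos k).ne', Complex.ofReal_one]
  linear_combination -(conj (𝓕 φ k) * 𝓕 ψ k) * h1

/-- The adjoint has dense range, because it contains all the functions `(1 + 4π²|k|²)^{-1/2} φ̂`. -/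
theorem sobolevIncl_injective : Function.Injective sobolevIncl := by
  rw [injective_iff_map_eq_zero]
  intro h hh
  refine Dense.eq_zero_of_inner_left ℂ (denseRange_toLp_weightedFourier (-(1 / 2))) ?_
  rintro _ ⟨φ, rfl⟩
  simp only
  rw [← adjoint_sobolevIncl_toLp, ContinuousLinearMap.adjoint_inner_right, hh, inner_zero_left]

theorem denseRange_sobolevIncl : DenseRange sobolevIncl := by
  refine denseRange_toLp_plane.mono ?_
  rintro _ ⟨φ, rfl⟩
  exact ⟨sobolevEmb φ, sobolevIncl_emb φ⟩

/-! ### Traces -/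

variable (m : Measure Plane) [m.HasTemperateGrowth]

/-- The trace map on the Sobolev space. -/
def sobolevTrace : L2Plane →L[ℂ] Lp ℂ 2 m :=
  (SchwartzMap.toLpCLM ℂ ℂ 2 m).toLinearMap.extendOfNorm sobolevEmb

variable {m}

/-- The extension has its intended values only under a trace inequality; for the curve this is
`IsWire.norm_toLp_le`. -/
theorem sobolevTrace_emb {C : ℝ} (hC : ∀ φ : 𝓢(Plane, ℂ), ‖φ.toLp 2 m‖ ≤ C * ‖sobolevEmb φ‖)
    (φ : 𝓢(Plane, ℂ)) : sobolevTrace m (sobolevEmb φ) = φ.toLp 2 m :=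
  LinearMap.extendOfNorm_eq (f := (SchwartzMap.toLpCLM ℂ ℂ 2 m).toLinearMap)
    denseRange_sobolevEmb ⟨C, hC⟩ φ

theorem tendsto_toLp_iff {φ : ℕ → 𝓢(Plane, ℂ)} {v : Lp ℂ 2 m} :
    Tendsto (fun n => eLpNorm (fun x => φ n x - v x) 2 m) atTop (𝓝 0) ↔
      Tendsto (fun n => (φ n).toLp 2 m) atTop (𝓝 v) := by
  rw [Lp.tendsto_Lp_iff_tendsto_eLpNorm']
  refine tendsto_congr fun n => eLpNorm_congr_ae ?_
  filter_upwards [(φ n).coeFn_toLp 2 m] with x hx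
  rw [Pi.sub_apply, hx]

/-- Convergence of functions and gradients makes the sequence Cauchy in the Sobolev norm, so it has
a limit `h` there, and continuity identifies its value, gradient and trace. The converse is density
of Schwartz functions. Hence the concrete form domain is exactly the range of `h`. -/
theorem isTrace_iff {C : ℝ} (hC : ∀ φ : 𝓢(Plane, ℂ), ‖φ.toLp 2 m‖ ≤ C * ‖sobolevEmb φ‖)
    (u : L2Plane) (g : Fin 2 → L2Plane) (v : Lp ℂ 2 m) :
    IsTrace m u g v ↔
      ∃ h, sobolevIncl h = u ∧ (∀ i, sobolevPartial i h = g i) ∧ sobolevTrace m h = v := by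
  constructor
  · rintro ⟨φ, h1, h2, h3⟩
    rw [tendsto_toLp_iff] at h3
    have hcau : CauchySeq fun n => sobolevEmb (φ n) := by
      have c1 := h1.cauchySeq
      have c2 := fun i => (h2 i).cauchySeq
      rw [Metric.cauchySeq_iff] at c1 ⊢
      simp_rw [Metric.cauchySeq_iff] at c2
      intro ε hε
      obtain ⟨N, hN⟩ := c1 (ε / 3) (by positivity)
      choose M hM using fun i => c2 i (ε / 3) (by positivity)
      refine ⟨max N (max (M 0) (M 1)), fun a ha b hb => ?_⟩
      have d0 := hN a (le_of_max_le_left ha) b (le_of_max_le_left hb)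
      have d1 := hM 0 a (le_of_max_le_left (le_of_max_le_right ha)) b
        (le_of_max_le_left (le_of_max_le_right hb))
      have d2 := hM 1 a (le_of_max_le_right (le_of_max_le_right ha)) b
        (le_of_max_le_right (le_of_max_le_right hb))
      rw [← sobolevPartial_emb, ← sobolevPartial_emb, dist_eq_norm, ← map_sub, ← map_sub,
        sobolevPartial_emb] at d1 d2
      rw [← sobolevIncl_emb, ← sobolevIncl_emb, dist_eq_norm, ← map_sub, ← map_sub,
        sobolevIncl_emb] at d0
      rw [dist_eq_norm, ← map_sub]
      refine lt_of_pow_lt_pow_left₀ 2 hε.le ?_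
      rw [norm_sobolevEmb_sq, Fin.sum_univ_two]
      have n0 := norm_nonneg ((φ a - φ b).toLp 2 (volume : Measure Plane))
      have n1 := norm_nonneg ((∂_{e 0} (φ a - φ b)).toLp 2 (volume : Measure Plane))
      have n2 := norm_nonneg ((∂_{e 1} (φ a - φ b)).toLp 2 (volume : Measure Plane))
      nlinarith
    obtain ⟨h, hh⟩ := cauchySeq_tendsto_of_complete hcau
    refine ⟨h, ?_, fun i => ?_, ?_⟩
    · refine tendsto_nhds_unique (((sobolevIncl.continuous.tendsto h).comp hh).congr fun n => ?_) h1
      exact sobolevIncl_emb _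
    · refine tendsto_nhds_unique
        ((((sobolevPartial i).continuous.tendsto h).comp hh).congr fun n => ?_) (h2 i)
      exact sobolevPartial_emb i _
    · refine tendsto_nhds_unique
        ((((sobolevTrace m).continuous.tendsto h).comp hh).congr fun n => ?_) h3
      exact sobolevTrace_emb hC _
  · rintro ⟨h, rfl, hg, rfl⟩
    obtain ⟨x, hx, hlim⟩ := mem_closure_iff_seq_limit.1 (denseRange_sobolevEmb h)
    choose φ hφ using hx
    refine ⟨φ, ?_, fun i => ?_, ?_⟩
    · refine ((sobolevIncl.continuous.tendsto h).comp hlim).congr fun n => ?_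
      rw [Function.comp_apply, ← hφ, sobolevIncl_emb]
    · rw [← hg i]
      refine (((sobolevPartial i).continuous.tendsto h).comp hlim).congr fun n => ?_
      rw [Function.comp_apply, ← hφ, sobolevPartial_emb]
    · rw [tendsto_toLp_iff]
      refine (((sobolevTrace m).continuous.tendsto h).comp hlim).congr fun n => ?_
      rw [Function.comp_apply, ← hφ, sobolevTrace_emb hC]

theorem integral_mul_schwartz_eq_inner (ψ : 𝓢(Plane, ℂ)) :
    ∃ a : L2Plane, ∀ u : L2Plane, ∫ x, u x * ψ x = inner ℂ a u := by
  have hs : MemLp (fun x => conj (ψ x)) 2 (volume : Measure Plane) :=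
    (ψ.memLp 2 volume).star
  refine ⟨hs.toLp _, fun u => ?_⟩
  rw [L2.inner_def]
  refine integral_congr_ae ?_
  filter_upwards [hs.coeFn_toLp] with x h1
  rw [h1, RCLike.inner_apply, Complex.conj_conj]

theorem IsTrace.hasWeakGradient {m : Measure Plane} {u : L2Plane} {g : Fin 2 → L2Plane}
    {v : Lp ℂ 2 m} (h : IsTrace m u g v) : HasWeakGradient u g := by
  obtain ⟨φ, h1, h2, -⟩ := h
  intro i ψ
  obtain ⟨a, ha⟩ := integral_mul_schwartz_eq_inner (∂_{e i} ψ)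
  obtain ⟨b, hb⟩ := integral_mul_schwartz_eq_inner ψ
  rw [ha, hb]
  refine tendsto_nhds_unique (tendsto_const_nhds.inner h1)
    (((tendsto_const_nhds.inner (h2 i)).neg).congr fun n => ?_)
  rw [← ha, ← hb]
  have e1 : ∫ x, ((φ n).toLp 2 (volume : Measure Plane)) x * (∂_{e i} ψ) x =
      ∫ x, φ n x * (∂_{e i} ψ) x :=
    integral_congr_ae (by filter_upwards [(φ n).coeFn_toLp 2 volume] with x hx; rw [hx])
  have e2 : ∫ x, ((∂_{e i} (φ n)).toLp 2 (volume : Measure Plane)) x * ψ x =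
      ∫ x, (∂_{e i} (φ n)) x * ψ x :=
    integral_congr_ae (by filter_upwards [(∂_{e i} (φ n)).coeFn_toLp 2 volume] with x hx; rw [hx])
  rw [e1, e2, SchwartzMap.integral_mul_lineDerivOp_right_eq_neg_left]

/-- The operator on the Sobolev space of the form with parameters `α`, `m`. -/
def deltaForm (α : ℝ) (m : Measure Plane) [m.HasTemperateGrowth] : L2Plane →L[ℂ] L2Plane :=
  -- The identity is the full Sobolev form; subtracting the `L²` part leaves the gradient form.
  1 - adjoint sobolevIncl ∘L sobolevIncl -
    (α : ℂ) • (adjoint (sobolevTrace m) ∘L sobolevTrace m)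

theorem inner_deltaForm (α : ℝ) (h h' : L2Plane) :
    inner ℂ h (deltaForm α m h') = inner ℂ h h' - inner ℂ (sobolevIncl h) (sobolevIncl h') -
      α * inner ℂ (sobolevTrace m h) (sobolevTrace m h') := by
  have h1 : deltaForm α m h' = h' - adjoint sobolevIncl (sobolevIncl h') -
      (α : ℂ) • adjoint (sobolevTrace m) (sobolevTrace m h') := rfl
  rw [h1, inner_sub_right, inner_sub_right, inner_smul_right,
    ContinuousLinearMap.adjoint_inner_right, ContinuousLinearMap.adjoint_inner_right]

theorem deltaForm_symm (α : ℝ) (h h' : L2Plane) :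
    inner ℂ (deltaForm α m h) h' = inner ℂ h (deltaForm α m h') := by
  rw [← inner_conj_symm, inner_deltaForm, inner_deltaForm]
  simp only [map_sub, map_mul, inner_conj_symm, Complex.conj_ofReal]

/-- By `isTrace_iff`, triples of value, gradient and trace are parametrised by `K`, and the
weak-gradient condition follows from the trace condition. What remains is the weak equation tested
against all of `K`. -/
theorem isFormOperator_formOp {α C : ℝ}
    (hC : ∀ φ : 𝓢(Plane, ℂ), ‖φ.toLp 2 m‖ ≤ C * ‖sobolevEmb φ‖)
    (hF : IsSemiboundedForm sobolevIncl (deltaForm α m)) :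
    IsFormOperator α m (formOp sobolevIncl (deltaForm α m)) := by
  intro u f
  have hval : ∀ h h', formValue α m (fun i => sobolevPartial i h) (fun i => sobolevPartial i h')
      (sobolevTrace m h) (sobolevTrace m h') = inner ℂ h (deltaForm α m h') := by
    intro h h'
    rw [formValue, inner_deltaForm, inner_eq_sobolev h h']
    ring
  rw [hF.mem_graph]
  constructor
  · rintro ⟨h, rfl, hB⟩
    have htr : IsTrace m (sobolevIncl h) (fun i => sobolevPartial i h) (sobolevTrace m h) :=
      (isTrace_iff hC _ _ _).2 ⟨h, rfl, fun _ => rfl, rfl⟩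
    refine ⟨_, _, htr.hasWeakGradient, htr, fun w g z _ hw => ?_⟩
    obtain ⟨h', rfl, hg, rfl⟩ := (isTrace_iff hC _ _ _).1 hw
    obtain rfl : (fun i => sobolevPartial i h') = g := funext hg
    rw [hval, hB, ContinuousLinearMap.adjoint_inner_right]
  · rintro ⟨g, v, -, htr, hall⟩
    obtain ⟨h, rfl, hg, rfl⟩ := (isTrace_iff hC _ _ _).1 htr
    obtain rfl : (fun i => sobolevPartial i h) = g := funext hg
    refine ⟨h, rfl, ext_inner_left ℂ fun h' => ?_⟩
    have htr' : IsTrace m (sobolevIncl h') (fun i => sobolevPartial i h') (sobolevTrace m h') :=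
      (isTrace_iff hC _ _ _).2 ⟨h', rfl, fun _ => rfl, rfl⟩
    have := hall _ _ _ htr'.hasWeakGradient htr'
    rw [hval] at this
    rw [this, ContinuousLinearMap.adjoint_inner_right]

end Sobolev

/-! ### The trace of Sobolev functions on the curve -/

section CurveTrace

open Real
open scoped ComplexConjugate FourierTransform
open ContinuousLinearMap (adjoint)

/-- The properties of the curve used below: it is continuous and bi-Lipschitz, with the upper
constant `1` and the lower constant `c`, and its parameter is the one-dimensional Hausdorff
measure. -/
structure IsWire (γ : ℝ → Plane) (c : ℝ) : Prop where
  cont : Continuous γ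
  pos : 0 < c
  lower : ∀ s s' : ℝ, c * |s - s'| ≤ ‖γ s - γ s'‖
  upper : ∀ s s' : ℝ, ‖γ s - γ s'‖ ≤ |s - s'|
  injective : Function.Injective γ
  measurePreserving : MeasurePreserving γ volume (curveMeasure γ)

variable {γ : ℝ → Plane} {c κ : ℝ} [(curveMeasure γ).HasTemperateGrowth]

theorem IsWire.memLp_schwartz (hγ : IsWire γ c) (φ : 𝓢(Plane, ℂ)) :
    MemLp (fun s => φ (γ s)) 2 :=
  (φ.memLp 2 (curveMeasure γ)).comp_measurePreserving hγ.measurePreserving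

theorem IsWire.integrable_schwartz (hγ : IsWire γ c) (φ : 𝓢(Plane, ℂ)) :
    Integrable fun s => φ (γ s) :=
  memLp_one_iff_integrable.1
    ((φ.memLp 1 (curveMeasure γ)).comp_measurePreserving hγ.measurePreserving)

theorem schwartz_eq_integral_fourier (φ : 𝓢(Plane, ℂ)) (x : Plane) :
    φ x = ∫ k, 𝓕 φ k * Complex.exp (((2 * π * inner ℝ x k : ℝ) : ℂ) * Complex.I) := by
  have h1 : φ x = 𝓕⁻ (𝓕 φ) x := by rw [FourierTransform.fourierInv_fourier_eq]
  rw [h1, SchwartzMap.fourierInv_coe, Real.fourierInv_eq']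
  refine integral_congr_ae (Eventually.of_forall fun k => ?_)
  simp only [smul_eq_mul, real_inner_comm x k]
  ring

theorem integral_conj_mul_schwartz_curve (hcont : Continuous γ) {v : ℝ → ℂ} (hv : Integrable v)
    (φ : 𝓢(Plane, ℂ)) :
    ∫ s, conj (v s) * φ (γ s) = ∫ k, conj (curveFourier γ v k) * 𝓕 φ k := by
  have hv' : Integrable fun s => conj (v s) := by
    simpa [Function.comp_def] using (Complex.conjCLE.toContinuousLinearMap.integrable_comp hv)
  have h1 : ∀ s, conj (v s) * φ (γ s) = ∫ k, conj (v s) * (𝓕 φ k *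
      Complex.exp (((2 * π * inner ℝ (γ s) k : ℝ) : ℂ) * Complex.I)) := fun s => by
    rw [integral_const_mul, ← schwartz_eq_integral_fourier]
  have h2 : ∀ k, conj (curveFourier γ v k) * 𝓕 φ k = ∫ s, conj (v s) * (𝓕 φ k *
      Complex.exp (((2 * π * inner ℝ (γ s) k : ℝ) : ℂ) * Complex.I)) := fun k => by
    rw [curveFourier, ← integral_conj, ← integral_mul_const]
    refine integral_congr_ae (Eventually.of_forall fun s => ?_)
    simp only [map_mul, ← Complex.exp_conj, Complex.conj_ofReal, Complex.conj_I]
    rw [show ((2 * π * inner ℝ (γ s) k : ℝ) : ℂ) * Complex.I =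
      ((-2 * π * inner ℝ (γ s) k : ℝ) : ℂ) * -Complex.I by push_cast; ring]
    ring
  simp_rw [h1, h2]
  refine integral_integral_swap ?_
  have h3 := (hv'.mul_prod ((𝓕 φ).integrable (μ := volume))).mul_bdd (c := 1) (g := fun q : ℝ × Plane =>
      Complex.exp (((2 * π * inner ℝ (γ q.1) q.2 : ℝ) : ℂ) * Complex.I))
      (Continuous.aestronglyMeasurable (by fun_prop))
      (Eventually.of_forall fun q => by rw [Complex.norm_exp_ofReal_mul_I])
  refine h3.congr (Eventually.of_forall fun q => ?_)
  simp only [Function.uncurry, mul_assoc]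

theorem integrable_fourier_sq (φ : 𝓢(Plane, ℂ)) : Integrable fun k => ‖𝓕 φ k‖ ^ 2 :=
  (memLp_two_iff_integrable_sq_norm (𝓕 φ).continuous.aestronglyMeasurable).1 ((𝓕 φ).memLp 2)

theorem integrable_laplaceSymbol_one_mul_fourier_sq (φ : 𝓢(Plane, ℂ)) :
    Integrable fun k => laplaceSymbol 1 k * ‖𝓕 φ k‖ ^ 2 := by
  have h := (memLp_two_iff_integrable_sq_norm
    (weightedFourier (1 / 2) φ).continuous.aestronglyMeasurable).1
    ((weightedFourier (1 / 2) φ).memLp 2 volume)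
  refine h.congr (Eventually.of_forall fun k => ?_)
  simp only [weightedFourier_half_apply, norm_mul, Complex.norm_real,
    Real.norm_of_nonneg (sqrt_laplaceSymbol_pos k).le, mul_pow,
    Real.sq_sqrt (laplaceSymbol_pos one_pos k).le]

theorem laplaceSymbol_eq_add (κ : ℝ) (k : Plane) :
    laplaceSymbol κ k = laplaceSymbol 1 k + (κ ^ 2 - 1) := by
  unfold laplaceSymbol; ring

theorem integrable_laplaceSymbol_mul_fourier_sq (κ : ℝ) (φ : 𝓢(Plane, ℂ)) :
    Integrable fun k => laplaceSymbol κ k * ‖𝓕 φ k‖ ^ 2 := by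
  simp_rw [laplaceSymbol_eq_add κ, add_mul]
  exact (integrable_laplaceSymbol_one_mul_fourier_sq φ).add
    ((integrable_fourier_sq φ).const_mul _)

theorem integral_laplaceSymbol_mul_fourier_sq (κ : ℝ) (φ : 𝓢(Plane, ℂ)) :
    ∫ k, laplaceSymbol κ k * ‖𝓕 φ k‖ ^ 2 =
      ‖sobolevEmb φ‖ ^ 2 + (κ ^ 2 - 1) * ‖sobolevIncl (sobolevEmb φ)‖ ^ 2 := by
  rw [sobolevIncl_emb, ← SchwartzMap.norm_fourier_toL2_eq, sobolevEmb_apply]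
  have e1 := norm_toLp_sq ((weightedFourier (1 / 2) φ).memLp 2 (volume : Measure Plane))
  have e2 := norm_toLp_sq ((𝓕 φ).memLp 2 (volume : Measure Plane))
  rw [SchwartzMap.toLp, SchwartzMap.toLp, e1, e2, ← integral_const_mul,
    ← integral_add _ ((integrable_fourier_sq φ).const_mul _)]
  · refine integral_congr_ae (Eventually.of_forall fun k => ?_)
    simp only [weightedFourier_half_apply, norm_mul, Complex.norm_real,
      Real.norm_of_nonneg (sqrt_laplaceSymbol_pos k).le, mul_pow,
      Real.sq_sqrt (laplaceSymbol_pos one_pos k).le]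
    rw [laplaceSymbol_eq_add κ, add_mul]
  · refine (integrable_laplaceSymbol_one_mul_fourier_sq φ).congr (Eventually.of_forall fun k => ?_)
    simp only [weightedFourier_half_apply, norm_mul, Complex.norm_real,
      Real.norm_of_nonneg (sqrt_laplaceSymbol_pos k).le, mul_pow,
      Real.sq_sqrt (laplaceSymbol_pos one_pos k).le]

/-- The trace inequality for Schwartz functions on a part of the curve. -/
theorem IsWire.setIntegral_schwartz_sq_le (hγ : IsWire γ c) (hκ : 0 < κ) {A : Set ℝ}
    (hA : MeasurableSet A) {b : ℝ} (hb : 0 < b)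
    (hAb : ∀ s ∈ A, ∫ s', curveKernel γ κ s' s ≤ b) (φ : 𝓢(Plane, ℂ)) :
    ∫ s in A, ‖φ (γ s)‖ ^ 2 ≤ b * ∫ k, laplaceSymbol κ k * ‖𝓕 φ k‖ ^ 2 := by
  set v : ℝ → ℂ := A.indicator fun s => φ (γ s) with hv
  have hv1 : Integrable v := (hγ.integrable_schwartz φ).indicator hA
  have hv2 : MemLp v 2 := (hγ.memLp_schwartz φ).indicator hA
  have hI : ∫ s, ‖v s‖ ^ 2 = ∫ s in A, ‖φ (γ s)‖ ^ 2 := by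
    rw [← integral_indicator hA]
    refine integral_congr_ae (Eventually.of_forall fun s => ?_)
    by_cases hs : s ∈ A <;> simp [hv, hs]
  have hII : ((∫ s, ‖v s‖ ^ 2 : ℝ) : ℂ) = ∫ k, conj (curveFourier γ v k) * 𝓕 φ k := by
    rw [← integral_conj_mul_schwartz_curve hγ.cont hv1, ← integral_complex_ofReal]
    refine integral_congr_ae (Eventually.of_forall fun s => ?_)
    by_cases hs : s ∈ A
    · simp only [hv, Set.indicator_of_mem hs]
      rw [mul_comm, Complex.mul_conj, Complex.normSq_eq_norm_sq]
    · simp [hv, hs]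
  have i1 := integrable_curveFourier_sq_div hκ hγ.pos hγ.cont hγ.lower hv1 hv2
  have i2 := integrable_laplaceSymbol_mul_fourier_sq κ φ
  have h1 := integral_curveFourier_sq_div_le hκ hγ.pos hγ.cont hγ.lower hv1 hv2 (b := b)
    fun s hs => hAb s (by by_contra h; exact hs (Set.indicator_of_notMem h _))
  -- The pairing of `v̂` with `φ̂` is split by Young's inequality with weight `b S`. The Schur test
  -- bounds the first term by half of the left side, which is then absorbed.
  have h2 : ∫ s, ‖v s‖ ^ 2 ≤ (2 * b)⁻¹ * (∫ k, ‖curveFourier γ v k‖ ^ 2 * (laplaceSymbol κ k)⁻¹) +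
      b / 2 * ∫ k, laplaceSymbol κ k * ‖𝓕 φ k‖ ^ 2 := by
    calc ∫ s, ‖v s‖ ^ 2 ≤ ‖((∫ s, ‖v s‖ ^ 2 : ℝ) : ℂ)‖ := by
          rw [Complex.norm_real]; exact Real.le_norm_self _
      _ ≤ ∫ k, ‖conj (curveFourier γ v k) * 𝓕 φ k‖ := by
          rw [hII]; exact norm_integral_le_integral_norm _
      _ ≤ ∫ k, ((2 * b)⁻¹ * (‖curveFourier γ v k‖ ^ 2 * (laplaceSymbol κ k)⁻¹) +
            b / 2 * (laplaceSymbol κ k * ‖𝓕 φ k‖ ^ 2)) := by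
          refine integral_mono_of_nonneg (Eventually.of_forall fun k => norm_nonneg _)
            ((i1.const_mul _).add (i2.const_mul _)) (Eventually.of_forall fun k => ?_)
          simp only [norm_mul, RCLike.norm_conj]
          have hS := laplaceSymbol_pos hκ k
          set x := ‖curveFourier γ v k‖
          set y := ‖𝓕 φ k‖
          set S := laplaceSymbol κ k
          have h3 : (2 * b)⁻¹ * (x ^ 2 * S⁻¹) + b / 2 * (S * y ^ 2) - x * y =
              (x - b * S * y) ^ 2 / (2 * b * S) := by field_simp; ring
          have h4 : 0 ≤ (x - b * S * y) ^ 2 / (2 * b * S) := by positivity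
          linarith
      _ = _ := by
          rw [integral_add (i1.const_mul _) (i2.const_mul _), integral_const_mul,
            integral_const_mul]
  have h5 : (2 * b)⁻¹ * (∫ k, ‖curveFourier γ v k‖ ^ 2 * (laplaceSymbol κ k)⁻¹) ≤
      (2 * b)⁻¹ * (b * ∫ s, ‖v s‖ ^ 2) := by gcongr
  have h6 : (2 * b)⁻¹ * (b * ∫ s, ‖v s‖ ^ 2) = (1 / 2) * ∫ s, ‖v s‖ ^ 2 := by field_simp
  rw [← hI]
  linarith

theorem IsWire.norm_toLp_le (hγ : IsWire γ c) (φ : 𝓢(Plane, ℂ)) :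
    ‖φ.toLp 2 (curveMeasure γ)‖ ≤ √(1 / (2 * 1 * c)) * ‖sobolevEmb φ‖ := by
  have hc := hγ.pos
  have h := hγ.setIntegral_schwartz_sq_le one_pos MeasurableSet.univ (b := 1 / (2 * 1 * c))
    (by positivity) (fun s _ => integral_curveKernel_le one_pos hγ.pos hγ.cont hγ.lower s) φ
  rw [integral_laplaceSymbol_mul_fourier_sq, Measure.restrict_univ] at h
  refine le_of_sq_le_sq ?_ (by positivity)
  rw [mul_pow, Real.sq_sqrt (by positivity), SchwartzMap.toLp, norm_toLp_sq,
    ← hγ.measurePreserving.integral_comp (hγ.cont.measurableEmbedding hγ.injective)]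
  simpa using h

/-- The trace on the curve as a function of the arc length. -/
def IsWire.trace (hγ : IsWire γ c) : L2Plane →L[ℂ] Lp ℂ 2 (volume : Measure ℝ) :=
  (Lp.compMeasurePreservingₗᵢ ℂ γ hγ.measurePreserving).toContinuousLinearMap ∘L
    sobolevTrace (curveMeasure γ)

theorem IsWire.inner_trace (hγ : IsWire γ c) (h h' : L2Plane) :
    inner ℂ (hγ.trace h) (hγ.trace h') =
      inner ℂ (sobolevTrace (curveMeasure γ) h) (sobolevTrace (curveMeasure γ) h') := by
  let U : Lp ℂ 2 (curveMeasure γ) →ₗᵢ[ℂ] Lp ℂ 2 (volume : Measure ℝ) :=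
    Lp.compMeasurePreservingₗᵢ ℂ γ hγ.measurePreserving
  exact U.inner_map_map _ _

theorem IsWire.trace_emb (hγ : IsWire γ c) (φ : 𝓢(Plane, ℂ)) :
    hγ.trace (sobolevEmb φ) = (hγ.memLp_schwartz φ).toLp _ := by
  change Lp.compMeasurePreserving γ hγ.measurePreserving
    (sobolevTrace (curveMeasure γ) (sobolevEmb φ)) = _
  rw [sobolevTrace_emb hγ.norm_toLp_le, SchwartzMap.toLp, Lp.toLp_compMeasurePreserving]
  rfl

theorem IsWire.deltaForm_apply (hγ : IsWire γ c) (α : ℝ) (h : L2Plane) :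
    deltaForm α (curveMeasure γ) h =
      h - adjoint sobolevIncl (sobolevIncl h) - (α : ℂ) • adjoint hγ.trace (hγ.trace h) := by
  refine ext_inner_left ℂ fun h' => ?_
  rw [inner_deltaForm, inner_sub_right, inner_sub_right, inner_smul_right,
    ContinuousLinearMap.adjoint_inner_right, ContinuousLinearMap.adjoint_inner_right,
    hγ.inner_trace]

theorem norm_restrict_sq {β : Type*} [MeasurableSpace β] {μ : Measure β} (A : Set β)
    (f : Lp ℂ 2 μ) : ‖LpToLpRestrictCLM β ℂ ℂ μ 2 A f‖ ^ 2 = ∫ x in A, ‖f x‖ ^ 2 ∂μ := by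
  have h1 := norm_toLp_sq (Lp.memLp (LpToLpRestrictCLM β ℂ ℂ μ 2 A f))
  rw [Lp.toLp_coeFn] at h1
  rw [h1]
  refine integral_congr_ae ?_
  filter_upwards [LpToLpRestrictCLM_coeFn ℂ A f] with x hx
  rw [hx]

theorem norm_sq_eq_add_compl {β : Type*} [MeasurableSpace β] {μ : Measure β} {A : Set β}
    (hA : MeasurableSet A) (f : Lp ℂ 2 μ) :
    ‖f‖ ^ 2 = (∫ x in A, ‖f x‖ ^ 2 ∂μ) + ∫ x in Aᶜ, ‖f x‖ ^ 2 ∂μ := by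
  have h1 := norm_toLp_sq (Lp.memLp f)
  rw [Lp.toLp_coeFn] at h1
  rw [h1, integral_add_compl hA]
  exact (memLp_two_iff_integrable_sq_norm (Lp.aestronglyMeasurable f)).1 (Lp.memLp f)

/-- The trace inequality on a part of the curve. -/
theorem IsWire.setIntegral_trace_sq_le (hγ : IsWire γ c) (hκ : 0 < κ) {A : Set ℝ}
    (hA : MeasurableSet A) {b : ℝ} (hb : 0 < b)
    (hAb : ∀ s ∈ A, ∫ s', curveKernel γ κ s' s ≤ b) (h : L2Plane) :
    ∫ s in A, ‖hγ.trace h s‖ ^ 2 ≤ b * (‖h‖ ^ 2 + (κ ^ 2 - 1) * ‖sobolevIncl h‖ ^ 2) := by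
  rw [← norm_restrict_sq]
  refine denseRange_sobolevEmb.induction_on (p := fun h =>
    ‖LpToLpRestrictCLM ℝ ℂ ℂ volume 2 A (hγ.trace h)‖ ^ 2 ≤
      b * (‖h‖ ^ 2 + (κ ^ 2 - 1) * ‖sobolevIncl h‖ ^ 2)) h ?_ fun φ => ?_
  · exact isClosed_le (by fun_prop) (by fun_prop)
  · rw [norm_restrict_sq, ← integral_laplaceSymbol_mul_fourier_sq, hγ.trace_emb]
    refine le_of_eq_of_le ?_ (hγ.setIntegral_schwartz_sq_le hκ hA hb hAb φ)
    refine integral_congr_ae (ae_restrict_of_ae ?_)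
    filter_upwards [(hγ.memLp_schwartz φ).coeFn_toLp] with s hs
    rw [hs]

theorem IsWire.norm_trace_sq_le (hγ : IsWire γ c) (hκ : 0 < κ) (h : L2Plane) :
    ‖hγ.trace h‖ ^ 2 ≤ 1 / (2 * κ * c) * (‖h‖ ^ 2 + (κ ^ 2 - 1) * ‖sobolevIncl h‖ ^ 2) := by
  have hc := hγ.pos
  have h1 := hγ.setIntegral_trace_sq_le hκ MeasurableSet.univ (b := 1 / (2 * κ * c))
    (by positivity) (fun s _ => integral_curveKernel_le hκ hγ.pos hγ.cont hγ.lower s) h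
  have h2 := norm_sq_eq_add_compl MeasurableSet.univ (hγ.trace h)
  rw [h2]
  simpa using h1

/-! ### The adjoint of the trace and single layer potentials -/

theorem IsWire.memLp_curveFourier_div (hγ : IsWire γ c) {v : ℝ → ℂ} (hv1 : Integrable v)
    (hv : MemLp v 2) :
    MemLp (fun k => (((√(laplaceSymbol 1 k))⁻¹ : ℝ) : ℂ) * curveFourier γ v k) 2 := by
  have hF := continuous_curveFourier hγ.cont hv1
  have hS := continuous_laplaceSymbol 1
  have hm : AEStronglyMeasurable
      (fun k => (((√(laplaceSymbol 1 k))⁻¹ : ℝ) : ℂ) * curveFourier γ v k) volume := by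
    refine Measurable.aestronglyMeasurable ?_
    have := hF.measurable
    have := hS.measurable
    fun_prop
  rw [memLp_two_iff_integrable_sq_norm hm]
  refine (integrable_curveFourier_sq_div one_pos hγ.pos hγ.cont hγ.lower hv1 hv).congr
    (Eventually.of_forall fun k => ?_)
  simp only [norm_mul, Complex.norm_real, norm_inv, mul_pow,
    Real.norm_of_nonneg (sqrt_laplaceSymbol_pos k).le, inv_pow,
    Real.sq_sqrt (laplaceSymbol_pos one_pos k).le]
  ring

/-- The adjoint of the trace turns a density into a measure on the curve, seen in the dual Sobolev
space; this is why its Fourier transform is divided by the square root of the symbol. -/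
theorem IsWire.adjoint_trace_toLp (hγ : IsWire γ c) {v : ℝ → ℂ} (hv1 : Integrable v)
    (hv : MemLp v 2) :
    adjoint hγ.trace (hv.toLp v) = (hγ.memLp_curveFourier_div hv1 hv).toLp _ := by
  refine Dense.eq_of_inner_left ℂ denseRange_sobolevEmb ?_
  rintro _ ⟨φ, rfl⟩
  rw [ContinuousLinearMap.adjoint_inner_left, hγ.trace_emb, inner_toLp_toLp,
    integral_conj_mul_schwartz_curve hγ.cont hv1, sobolevEmb_apply, SchwartzMap.toLp,
    inner_toLp_toLp]
  refine integral_congr_ae (Eventually.of_forall fun k => ?_)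
  simp only [weightedFourier_half_apply, map_mul, Complex.conj_ofReal]
  have h1 : (((√(laplaceSymbol 1 k))⁻¹ : ℝ) : ℂ) * ((√(laplaceSymbol 1 k) : ℝ) : ℂ) = 1 := by
    rw [← Complex.ofReal_mul, inv_mul_cancel₀ (sqrt_laplaceSymbol_pos k).ne', Complex.ofReal_one]
  linear_combination -(conj (curveFourier γ v k) * 𝓕 φ k) * h1

theorem IsWire.norm_adjoint_trace_sq (hγ : IsWire γ c) {v : ℝ → ℂ} (hv1 : Integrable v)
    (hv : MemLp v 2) :
    ‖adjoint hγ.trace (hv.toLp v)‖ ^ 2 =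
      ∫ k, ‖curveFourier γ v k‖ ^ 2 * (laplaceSymbol 1 k)⁻¹ := by
  rw [hγ.adjoint_trace_toLp hv1, norm_toLp_sq]
  refine integral_congr_ae (Eventually.of_forall fun k => ?_)
  simp only [norm_mul, Complex.norm_real, norm_inv, mul_pow,
    Real.norm_of_nonneg (sqrt_laplaceSymbol_pos k).le, inv_pow,
    Real.sq_sqrt (laplaceSymbol_pos one_pos k).le]
  ring

theorem IsWire.memLp_singleLayer (hγ : IsWire γ c) (hκ : 0 < κ) {v : ℝ → ℂ} (hv1 : Integrable v)
    (hv : MemLp v 2) :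
    MemLp (fun k => ((√(laplaceSymbol 1 k) * (laplaceSymbol κ k)⁻¹ : ℝ) : ℂ) *
      curveFourier γ v k) 2 := by
  have hF := continuous_curveFourier hγ.cont hv1
  have hm : AEStronglyMeasurable (fun k => ((√(laplaceSymbol 1 k) * (laplaceSymbol κ k)⁻¹ : ℝ) : ℂ)
      * curveFourier γ v k) volume := by
    refine Measurable.aestronglyMeasurable ?_
    have := hF.measurable
    have := (continuous_laplaceSymbol 1).measurable
    have := (continuous_laplaceSymbol κ).measurable
    fun_prop
  rw [memLp_two_iff_integrable_sq_norm hm]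
  refine ((integrable_curveFourier_sq_div hκ hγ.pos hγ.cont hγ.lower hv1 hv).const_mul
    (1 + (κ ^ 2)⁻¹)).mono' (hm.norm.pow 2) (Eventually.of_forall fun k => ?_)
  have h1 := laplaceSymbol_pos hκ k
  have h0 := laplaceSymbol_pos one_pos k
  -- The two symbols are comparable, so integrability of `‖v̂‖²` over `S_κ` gives the Sobolev norm
  -- of the potential.
  have h2 : laplaceSymbol 1 k ≤ (1 + (κ ^ 2)⁻¹) * laplaceSymbol κ k := by
    have h3 : (κ ^ 2)⁻¹ * κ ^ 2 = 1 := inv_mul_cancel₀ (by positivity)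
    have h4 : 0 ≤ (κ ^ 2)⁻¹ * (4 * π ^ 2 * ‖k‖ ^ 2) := by positivity
    unfold laplaceSymbol
    nlinarith [sq_nonneg κ]
  rw [norm_pow, norm_norm, norm_mul, mul_pow, Complex.norm_real,
    Real.norm_of_nonneg (mul_nonneg (Real.sqrt_nonneg _) (inv_nonneg.2 h1.le)), mul_pow,
    Real.sq_sqrt h0.le]
  calc laplaceSymbol 1 k * (laplaceSymbol κ k)⁻¹ ^ 2 * ‖curveFourier γ v k‖ ^ 2
      ≤ ((1 + (κ ^ 2)⁻¹) * laplaceSymbol κ k) * (laplaceSymbol κ k)⁻¹ ^ 2 *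
        ‖curveFourier γ v k‖ ^ 2 := by gcongr
    _ = _ := by field_simp

/-- The single layer potential of the density `v` for the operator `-Δ + κ²`, as an element of the
Sobolev space. -/
def IsWire.singleLayer (hγ : IsWire γ c) (hκ : 0 < κ) {v : ℝ → ℂ} (hv1 : Integrable v)
    (hv : MemLp v 2) : L2Plane :=
  (hγ.memLp_singleLayer hκ hv1 hv).toLp _

/-- The Birman–Schwinger reduction. The operator `-Δ + κ²` turns the potential back into the
density, so the residual lives on the curve and is small as soon as `α` times the trace of the
potential is close to the density. -/
theorem IsWire.shiftedForm_singleLayer (hγ : IsWire γ c) (hκ : 0 < κ) (α : ℝ) {v : ℝ → ℂ}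
    (hv1 : Integrable v) (hv : MemLp v 2 volume) :
    shiftedForm sobolevIncl (deltaForm α (curveMeasure γ)) ((-κ ^ 2 : ℝ) : ℂ)
      (hγ.singleLayer hκ hv1 hv) =
    adjoint hγ.trace (hv.toLp v - (α : ℂ) • hγ.trace (hγ.singleLayer hκ hv1 hv)) := by
  set h := hγ.singleLayer hκ hv1 hv with hh
  have key : h - adjoint sobolevIncl (sobolevIncl h) -
      ((-κ ^ 2 : ℝ) : ℂ) • adjoint sobolevIncl (sobolevIncl h) =
      adjoint hγ.trace (hv.toLp v) := by
    refine Dense.eq_of_inner_right ℂ denseRange_sobolevEmb ?_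
    rintro _ ⟨φ, rfl⟩
    have e1 : inner ℂ (sobolevEmb φ) h = ∫ k, conj (weightedFourier (1 / 2) φ k) *
        (((√(laplaceSymbol 1 k) * (laplaceSymbol κ k)⁻¹ : ℝ) : ℂ) * curveFourier γ v k) :=
      inner_toLp_toLp ((weightedFourier (1 / 2) φ).memLp 2 volume)
        (hγ.memLp_singleLayer hκ hv1 hv)
    have e2 : inner ℂ (sobolevEmb φ) (adjoint sobolevIncl (sobolevIncl h)) =
        ∫ k, conj (weightedFourier (-(1 / 2)) φ k) *
        (((√(laplaceSymbol 1 k) * (laplaceSymbol κ k)⁻¹ : ℝ) : ℂ) * curveFourier γ v k) := by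
      rw [ContinuousLinearMap.adjoint_inner_right, sobolevIncl_emb,
        ← ContinuousLinearMap.adjoint_inner_left, adjoint_sobolevIncl_toLp]
      exact inner_toLp_toLp ((weightedFourier (-(1 / 2)) φ).memLp 2 volume)
        (hγ.memLp_singleLayer hκ hv1 hv)
    have e3 : inner ℂ (sobolevEmb φ) (adjoint hγ.trace (hv.toLp v)) =
        ∫ k, conj (weightedFourier (1 / 2) φ k) *
          ((((√(laplaceSymbol 1 k))⁻¹ : ℝ) : ℂ) * curveFourier γ v k) := by
      rw [hγ.adjoint_trace_toLp hv1]
      exact inner_toLp_toLp ((weightedFourier (1 / 2) φ).memLp 2 volume) _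
    have i1 := integrable_conj_mul ((weightedFourier (1 / 2) φ).memLp 2 volume)
      (hγ.memLp_singleLayer hκ hv1 hv)
    have i2 := integrable_conj_mul ((weightedFourier (-(1 / 2)) φ).memLp 2 volume)
      (hγ.memLp_singleLayer hκ hv1 hv)
    rw [inner_sub_right, inner_sub_right, inner_smul_right, e1, e2, e3, ← integral_const_mul,
      ← integral_sub i1 i2]
    refine (integral_sub (i1.sub i2) (i2.const_mul _)).symm.trans ?_
    refine integral_congr_ae (Eventually.of_forall fun k => ?_)
    simp only [Pi.sub_apply, weightedFourier_half_apply, weightedFourier_neg_half_apply, map_mul,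
      Complex.conj_ofReal]
    have h0 := sqrt_laplaceSymbol_pos k
    have h1 := laplaceSymbol_pos hκ k
    have h2 : √(laplaceSymbol 1 k) * (√(laplaceSymbol 1 k) * (laplaceSymbol κ k)⁻¹) -
        (√(laplaceSymbol 1 k))⁻¹ * (√(laplaceSymbol 1 k) * (laplaceSymbol κ k)⁻¹) -
        (-κ ^ 2) * ((√(laplaceSymbol 1 k))⁻¹ * (√(laplaceSymbol 1 k) * (laplaceSymbol κ k)⁻¹)) =
        √(laplaceSymbol 1 k) * (√(laplaceSymbol 1 k))⁻¹ := by
      have h3 : √(laplaceSymbol 1 k) ^ 2 = laplaceSymbol κ k - (κ ^ 2 - 1) := by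
        rw [Real.sq_sqrt (laplaceSymbol_pos one_pos k).le, laplaceSymbol_eq_add κ k]; ring
      field_simp
      rw [h3]
      ring
    have h4 := congrArg (fun x : ℝ => (x : ℂ)) h2
    push_cast at h4 ⊢
    linear_combination (conj (𝓕 φ k) * curveFourier γ v k) * h4
  rw [shiftedForm_apply, hγ.deltaForm_apply, map_sub, map_smul, ← key]
  abel

/-- The trace of the potential is the density acted on by the integral operator with the resolvent
kernel on the curve. -/
theorem IsWire.inner_trace_singleLayer (hγ : IsWire γ c) (hκ : 0 < κ) {v w : ℝ → ℂ}
    (hv1 : Integrable v) (hv : MemLp v 2) (hw1 : Integrable w) (hw : MemLp w 2) :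
    inner ℂ (hw.toLp w) (hγ.trace (hγ.singleLayer hκ hv1 hv)) =
      ∫ p : ℝ × ℝ, conj (w p.1) * v p.2 * (curveKernel γ κ p.1 p.2 : ℂ) := by
  rw [← integral_curveFourier_div hκ hγ.pos hγ.cont hγ.lower hv1 hv hw1 hw,
    ← ContinuousLinearMap.adjoint_inner_left, hγ.adjoint_trace_toLp hw1, IsWire.singleLayer,
    inner_toLp_toLp]
  refine integral_congr_ae (Eventually.of_forall fun k => ?_)
  simp only [map_mul, Complex.conj_ofReal]
  have h1 : (((√(laplaceSymbol 1 k))⁻¹ : ℝ) : ℂ) * ((√(laplaceSymbol 1 k) : ℝ) : ℂ) = 1 := by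
    rw [← Complex.ofReal_mul, inv_mul_cancel₀ (sqrt_laplaceSymbol_pos k).ne', Complex.ofReal_one]
  push_cast at h1 ⊢
  linear_combination (conj (curveFourier γ w k) * curveFourier γ v k *
    (laplaceSymbol κ k : ℂ)⁻¹) * h1

end CurveTrace

/-! ### Lower bounds of the form -/

section LowerBound

open Real Set
open scoped ComplexConjugate FourierTransform
open ContinuousLinearMap (adjoint)

variable {γ : ℝ → Plane} {c κ : ℝ} [(curveMeasure γ).HasTemperateGrowth]

theorem norm_sobolevIncl_le (h : L2Plane) : ‖sobolevIncl h‖ ≤ ‖h‖ := by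
  have := LinearMap.norm_extendOfNorm_apply_le
    (f := (SchwartzMap.toLpCLM ℂ ℂ 2 (volume : Measure Plane)).toLinearMap)
    denseRange_sobolevEmb 1 norm_toLp_le_norm_sobolevEmb h
  rwa [one_mul] at this

theorem IsWire.norm_trace_eq (hγ : IsWire γ c) (h : L2Plane) :
    ‖hγ.trace h‖ = ‖sobolevTrace (curveMeasure γ) h‖ :=
  (Lp.compMeasurePreservingₗᵢ ℂ γ hγ.measurePreserving).norm_map _

theorem IsWire.re_inner_shiftedForm (hγ : IsWire γ c) (α r : ℝ) (h : L2Plane) :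
    (inner ℂ h (shiftedForm sobolevIncl (deltaForm α (curveMeasure γ)) (r : ℂ) h)).re =
      ‖h‖ ^ 2 + (-r - 1) * ‖sobolevIncl h‖ ^ 2 - α * ‖hγ.trace h‖ ^ 2 := by
  rw [inner_shiftedForm, inner_deltaForm, hγ.norm_trace_eq]
  simp only [inner_self_eq_norm_sq_complex, ← Complex.ofReal_mul, ← Complex.ofReal_sub,
    Complex.ofReal_re]
  ring

theorem IsWire.isSemiboundedForm (hγ : IsWire γ c) {α : ℝ} (hα : 0 < α) :
    IsSemiboundedForm sobolevIncl (deltaForm α (curveMeasure γ)) where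
  injective := sobolevIncl_injective
  dense := denseRange_sobolevIncl
  symm := deltaForm_symm α
  bddBelow := by
    have hc := hγ.pos
    -- At `κ = α/c` the trace inequality has `α · 1/(2κc) = 1/2`, so the interaction uses only half
    -- of the Sobolev norm.
    refine ⟨1 + ((α / c) ^ 2 - 1) / 2, 1 / 2, by norm_num, fun h => ?_⟩
    have h1 := hγ.re_inner_shiftedForm α 0 h
    rw [inner_shiftedForm, Complex.ofReal_zero, zero_mul, sub_zero] at h1
    have h2 := mul_le_mul_of_nonneg_left (hγ.norm_trace_sq_le (κ := α / c) (by positivity) h) hα.le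
    have h3 : α * (1 / (2 * (α / c) * c) * (‖h‖ ^ 2 + ((α / c) ^ 2 - 1) * ‖sobolevIncl h‖ ^ 2)) =
        1 / 2 * (‖h‖ ^ 2 + ((α / c) ^ 2 - 1) * ‖sobolevIncl h‖ ^ 2) := by
      have : α * (1 / (2 * (α / c) * c)) = 1 / 2 := by field_simp
      rw [← mul_assoc, this]
    rw [h1]
    nlinarith

/-- The frequencies of a density that has mean zero on small intervals are high. -/
theorem IsWire.norm_curveFourier_le_of_mean_zero (hγ : IsWire γ c) {R : ℝ} (hR : 0 < R)
    {f : ℝ → ℂ} (hf : IntegrableOn f (Ioc (-R) R)) {N : ℕ} (hN : 0 < N)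
    (hzero : ∀ j < N, ∫ s in (-R + j * (2 * R / N))..(-R + (j + 1 : ℕ) * (2 * R / N)), f s = 0)
    (k : Plane) :
    ‖curveFourier γ ((Ioc (-R) R).indicator f) k‖ ≤
      2 * π * ‖k‖ * (2 * R / N) * ∫ s in Ioc (-R) R, ‖f s‖ := by
  have hN' : (0 : ℝ) < N := by exact_mod_cast hN
  set δ : ℝ := 2 * R / N with hδ
  have hδ0 : 0 < δ := by positivity
  set a : ℕ → ℝ := fun j => -R + j * δ with ha
  have ha0 : a 0 = -R := by simp [ha]
  have haN : a N = R := by simp only [ha, hδ]; field_simp; ring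
  have hmono : Monotone a := fun i j hij => by
    simp only [ha]; gcongr
  have hstep : ∀ j, a (j + 1) = a j + δ := fun j => by simp only [ha]; push_cast; ring
  set E : ℝ → ℂ := fun s => Complex.exp (((-2 * π * inner ℝ (γ s) k : ℝ) : ℂ) * Complex.I) with hE
  have hcont := hγ.cont
  have hEc : Continuous E := by fun_prop
  have hEle : ∀ s s', ‖E s - E s'‖ ≤ 2 * π * ‖k‖ * |s - s'| := fun s s' => by
    have h1 := Real.norm_exp_I_mul_ofReal_sub_one_le
      (x := -2 * π * inner ℝ (γ s) k - -2 * π * inner ℝ (γ s') k)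
    have h2 : E s - E s' = E s' * (Complex.exp (Complex.I *
        ((-2 * π * inner ℝ (γ s) k - -2 * π * inner ℝ (γ s') k : ℝ) : ℂ)) - 1) := by
      simp only [hE]
      rw [mul_sub, ← Complex.exp_add, mul_one]
      congr 2
      push_cast; ring
    rw [h2, norm_mul]
    simp only [hE, Complex.norm_exp_ofReal_mul_I, one_mul]
    refine h1.trans ?_
    rw [show -2 * π * inner ℝ (γ s) k - -2 * π * inner ℝ (γ s') k =
      -(2 * π) * inner ℝ (γ s - γ s') k by rw [inner_sub_left]; ring, norm_mul, norm_neg,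
      Real.norm_of_nonneg (by positivity)]
    have h3 := norm_inner_le_norm (𝕜 := ℝ) (γ s - γ s') k
    have h4 := hγ.upper s s'
    calc 2 * π * ‖(inner ℝ (γ s - γ s') k : ℝ)‖ ≤ 2 * π * (|s - s'| * ‖k‖) := by
          gcongr; exact h3.trans (by gcongr)
      _ = _ := by ring
  have hfi : IntervalIntegrable f volume (-R) R :=
    (intervalIntegrable_iff_integrableOn_Ioc_of_le (by linarith)).2 hf
  have hsub : ∀ j < N, uIcc (a j) (a (j + 1)) ⊆ uIcc (-R) R := fun j hj => by
    rw [uIcc_of_le (hmono j.le_succ), uIcc_of_le (by linarith)]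
    refine Icc_subset_Icc ?_ ?_
    · rw [← ha0]; exact hmono (Nat.zero_le _)
    · rw [← haN]; exact hmono hj
  have hfj : ∀ j < N, IntervalIntegrable f volume (a j) (a (j + 1)) := fun j hj =>
    hfi.mono_set (hsub j hj)
  have e1 : curveFourier γ ((Ioc (-R) R).indicator f) k = ∫ s in (-R)..R, f s * E s := by
    rw [curveFourier, intervalIntegral.integral_of_le (by linarith),
      ← integral_indicator measurableSet_Ioc]
    refine integral_congr_ae (Eventually.of_forall fun s => ?_)
    by_cases hs : s ∈ Ioc (-R) R <;> simp [hs, hE]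
  have e2 : ∫ s in (-R)..R, f s * E s =
      ∑ j ∈ Finset.range N, ∫ s in (a j)..(a (j + 1)), f s * E s := by
    rw [intervalIntegral.sum_integral_adjacent_intervals (fun j hj =>
      (hfj j hj).mul_continuousOn hEc.continuousOn), ha0, haN]
  have e3 : ∫ s in (-R)..R, ‖f s‖ = ∑ j ∈ Finset.range N, ∫ s in (a j)..(a (j + 1)), ‖f s‖ := by
    rw [intervalIntegral.sum_integral_adjacent_intervals (fun j hj => (hfj j hj).norm), ha0, haN]
  rw [e1, e2, ← intervalIntegral.integral_of_le (by linarith), e3, Finset.mul_sum]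
  refine (norm_sum_le _ _).trans (Finset.sum_le_sum fun j hj => ?_)
  have hj' := Finset.mem_range.1 hj
  -- Mean zero allows the exponential to be replaced by its increment from the left end of the
  -- interval, which is at most `2π|k|` times the interval's length.
  have e4 : ∫ s in (a j)..(a (j + 1)), f s * E s =
      ∫ s in (a j)..(a (j + 1)), f s * (E s - E (a j)) := by
    have h5 : ∫ s in (a j)..(a (j + 1)), f s * E (a j) = 0 := by
      rw [intervalIntegral.integral_mul_const, hzero j hj', zero_mul]
    simp_rw [mul_sub]
    rw [intervalIntegral.integral_sub ((hfj j hj').mul_continuousOn hEc.continuousOn)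
      ((hfj j hj').mul_const _), h5, sub_zero]
  rw [e4, ← intervalIntegral.integral_const_mul]
  refine intervalIntegral.norm_integral_le_of_norm_le (hmono j.le_succ)
    (Eventually.of_forall fun s hs => ?_) ((hfj j hj').norm.const_mul _)
  rw [norm_mul, mul_comm]
  refine mul_le_mul_of_nonneg_right ((hEle s (a j)).trans ?_) (norm_nonneg _)
  gcongr
  rw [hstep] at hs
  rw [abs_of_nonneg (by linarith [hs.1])]
  linarith [hs.2]

/-- The trace on a bounded part of the curve is small on a subspace of finite codimension. -/
theorem IsWire.exists_setIntegral_trace_le (hγ : IsWire γ c) {R ε : ℝ} (hR : 0 < R) (hε : 0 < ε) :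
    ∃ W : Submodule ℂ L2Plane, FiniteDimensional ℂ W ∧ ∀ h ∈ Wᗮ,
      ∫ s in Ioc (-R) R, ‖hγ.trace h s‖ ^ 2 ≤ ε * ‖h‖ ^ 2 := by
  have hc := hγ.pos
  -- Chosen so that the high frequencies contribute `2 · I/(2κc) = ε I/2`. `S` is the complementary
  -- low-frequency disc.
  set κ : ℝ := 2 / (c * ε) with hκ
  have hκ0 : 0 < κ := by positivity
  set S : Set Plane := {k | 4 * π ^ 2 * ‖k‖ ^ 2 < κ ^ 2} with hS
  have hSm : MeasurableSet S := measurableSet_lt (by fun_prop) measurable_const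
  have hSfin : volume S < ⊤ := by
    refine lt_of_le_of_lt (measure_mono ?_) (measure_ball_lt_top (x := (0 : Plane)) (r := κ))
    intro k hk
    rw [mem_ball_zero_iff]
    refine lt_of_pow_lt_pow_left₀ 2 hκ0.le (lt_of_le_of_lt ?_ hk)
    have h1 : 1 ≤ 4 * π ^ 2 := by nlinarith [Real.pi_gt_three]
    nlinarith [sq_nonneg ‖k‖]
  set V : ℝ := volume.real S with hV
  have hV0 : 0 ≤ V := measureReal_nonneg
  obtain ⟨N, hN⟩ := exists_nat_gt (max 1 ((2 * R) ^ 2 * (2 * R) * V * 2 / ε))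
  have hN1 : (1 : ℝ) < N := (le_max_left _ _).trans_lt hN
  have hN0 : 0 < N := by exact_mod_cast zero_lt_one.trans hN1
  have hN' : (0 : ℝ) < N := by exact_mod_cast hN0
  have hNb : (2 * R / N) ^ 2 * (2 * R) * V ≤ ε / 2 := by
    have h1 : (2 * R) ^ 2 * (2 * R) * V * 2 / ε < N := (le_max_right _ _).trans_lt hN
    rw [div_lt_iff₀ hε] at h1
    rw [div_pow, div_mul_eq_mul_div, div_mul_eq_mul_div, div_le_iff₀ (by positivity)]
    have : (N : ℝ) * ε ≤ N ^ 2 * ε := by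
      have : (N : ℝ) ≤ N ^ 2 := by nlinarith
      gcongr
    nlinarith
  set a : ℕ → ℝ := fun j => -R + j * (2 * R / N) with ha
  -- Orthogonality to these vectors says that the trace has mean zero on each of the `N`
  -- subintervals of `(-R, R]`.
  let g : Fin N → L2Plane := fun j => adjoint hγ.trace
    (indicatorConstLp 2 (measurableSet_Ioc (a := a j) (b := a (j + 1)))
      (by rw [Real.volume_Ioc]; exact ENNReal.ofReal_ne_top) (1 : ℂ))
  refine ⟨Submodule.span ℂ (range g), FiniteDimensional.span_of_finite ℂ (finite_range g),
    fun h hh => ?_⟩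
  set f : ℝ → ℂ := ⇑(hγ.trace h) with hf
  set v : ℝ → ℂ := (Ioc (-R) R).indicator f with hv
  have hfL : MemLp f 2 := Lp.memLp _
  have hvL : MemLp v 2 := hfL.indicator measurableSet_Ioc
  have hfi : IntegrableOn f (Ioc (-R) R) :=
    (hfL.restrict (Ioc (-R) R)).integrable (by norm_num)
  have hv1 : Integrable v := (integrable_indicator_iff measurableSet_Ioc).2 hfi
  have hmono : ∀ j, a j ≤ a (j + 1) := fun j => by
    simp only [ha]; push_cast; nlinarith [show 0 < 2 * R / N by positivity]
  have hzero : ∀ j < N, ∫ s in (a j)..(a (j + 1)), f s = 0 := fun j hj => by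
    have h1 := (Submodule.mem_orthogonal _ h).1 hh (g ⟨j, hj⟩)
      (Submodule.subset_span (mem_range_self _))
    rw [ContinuousLinearMap.adjoint_inner_left, L2.inner_indicatorConstLp_one] at h1
    rw [intervalIntegral.integral_of_le (hmono j)]
    exact h1
  have hI : ∫ s, ‖v s‖ ^ 2 = ∫ s in Ioc (-R) R, ‖f s‖ ^ 2 := by
    rw [← integral_indicator measurableSet_Ioc]
    refine integral_congr_ae (Eventually.of_forall fun s => ?_)
    by_cases hs : s ∈ Ioc (-R) R <;> simp [hv, hs]
  set I : ℝ := ∫ s in Ioc (-R) R, ‖f s‖ ^ 2 with hIdef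
  have hI0 : 0 ≤ I := integral_nonneg fun s => sq_nonneg _
  have hfsq : IntegrableOn (fun s => ‖f s‖ ^ 2) (Ioc (-R) R) :=
    ((memLp_two_iff_integrable_sq_norm hfL.1).1 hfL).integrableOn
  have hL1 : (∫ s in Ioc (-R) R, ‖f s‖) ^ 2 ≤ 2 * R * I := by
    -- Cauchy–Schwarz on the interval, from the nonnegativity of the integrated square `(2R‖f‖ -
    -- b)²`.
    set b : ℝ := ∫ s in Ioc (-R) R, ‖f s‖ with hb
    have h1 : 0 ≤ ∫ s in Ioc (-R) R, (2 * R * ‖f s‖ - b) ^ 2 := integral_nonneg fun s => sq_nonneg _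
    have h2 : ∫ s in Ioc (-R) R, (2 * R * ‖f s‖ - b) ^ 2 =
        (2 * R) ^ 2 * I - 2 * (2 * R) * b * b + b ^ 2 * (2 * R) := by
      have h3 : ∀ s, (2 * R * ‖f s‖ - b) ^ 2 =
        (2 * R) ^ 2 * ‖f s‖ ^ 2 - 2 * (2 * R) * b * ‖f s‖ + b ^ 2 := fun s => by ring
      simp_rw [h3]
      have i1 : IntegrableOn (fun s => (2 * R) ^ 2 * ‖f s‖ ^ 2 - 2 * (2 * R) * b * ‖f s‖)
          (Ioc (-R) R) := (hfsq.const_mul _).sub (hfi.norm.const_mul _)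
      rw [integral_add i1 (integrable_const _), integral_sub (hfsq.const_mul _) (hfi.norm.const_mul _), integral_const_mul,
        integral_const_mul, setIntegral_const, smul_eq_mul, measureReal_def, Real.volume_Ioc,
        ENNReal.toReal_ofReal (by linarith)]
      ring
    rw [h2] at h1
    nlinarith
  have hFb : ∀ k, ‖curveFourier γ v k‖ ^ 2 ≤
      4 * π ^ 2 * ‖k‖ ^ 2 * ((2 * R / N) ^ 2 * (2 * R) * I) := fun k => by
    have h1 := hγ.norm_curveFourier_le_of_mean_zero hR hfi hN0 hzero k
    calc ‖curveFourier γ v k‖ ^ 2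
        ≤ (2 * π * ‖k‖ * (2 * R / N) * ∫ s in Ioc (-R) R, ‖f s‖) ^ 2 := by gcongr
      _ = 4 * π ^ 2 * ‖k‖ ^ 2 * ((2 * R / N) ^ 2 * (∫ s in Ioc (-R) R, ‖f s‖) ^ 2) := by ring
      _ ≤ 4 * π ^ 2 * ‖k‖ ^ 2 * ((2 * R / N) ^ 2 * (2 * R * I)) := by gcongr
      _ = _ := by ring
  set D : ℝ := (2 * R / N) ^ 2 * (2 * R) * I with hD
  have hD0 : 0 ≤ D := by positivity
  -- Off the disc `S` the symbol for `1` dominates half of that for `κ`, and the Schur bound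
  -- applies. On `S` the mean-zero bound is multiplied by the area of `S`; `N` was taken large for
  -- this.
  have hnorm : ‖adjoint hγ.trace (hvL.toLp v)‖ ^ 2 ≤ ε * I := by
    rw [hγ.norm_adjoint_trace_sq hv1]
    have i1 := integrable_curveFourier_sq_div hκ0 hγ.pos hγ.cont hγ.lower hv1 hvL
    have i2 : Integrable (S.indicator fun _ : Plane => D) :=
      (integrable_indicator_iff hSm).2 (integrableOn_const hSfin.ne)
    have h1 := integral_curveFourier_sq_div_le hκ0 hγ.pos hγ.cont hγ.lower hv1 hvL
      (b := 1 / (2 * κ * c)) fun s _ => integral_curveKernel_le hκ0 hγ.pos hγ.cont hγ.lower s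
    rw [hI] at h1
    calc ∫ k, ‖curveFourier γ v k‖ ^ 2 * (laplaceSymbol 1 k)⁻¹
        ≤ ∫ k, (2 * (‖curveFourier γ v k‖ ^ 2 * (laplaceSymbol κ k)⁻¹) +
            S.indicator (fun _ => D) k) := by
          refine integral_mono (integrable_curveFourier_sq_div one_pos hγ.pos hγ.cont hγ.lower
            hv1 hvL) ((i1.const_mul 2).add i2) fun k => ?_
          have p1 := laplaceSymbol_pos one_pos k
          have pκ := laplaceSymbol_pos hκ0 k
          by_cases hk : k ∈ S
          · simp only [indicator_of_mem hk]
            have h2 : 0 ≤ 2 * (‖curveFourier γ v k‖ ^ 2 * (laplaceSymbol κ k)⁻¹) := by positivity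
            have h3 : ‖curveFourier γ v k‖ ^ 2 * (laplaceSymbol 1 k)⁻¹ ≤ D := by
              rw [← div_eq_mul_inv, div_le_iff₀ p1, mul_comm]
              refine (hFb k).trans ?_
              gcongr
              unfold laplaceSymbol
              linarith
            linarith
          · simp only [indicator_of_notMem hk, add_zero]
            have h2 : (laplaceSymbol 1 k)⁻¹ ≤ 2 * (laplaceSymbol κ k)⁻¹ := by
              rw [← div_eq_mul_inv, inv_eq_one_div, div_le_div_iff₀ p1 pκ]
              have : κ ^ 2 ≤ 4 * π ^ 2 * ‖k‖ ^ 2 := not_lt.1 hk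
              unfold laplaceSymbol
              linarith
            calc _ ≤ ‖curveFourier γ v k‖ ^ 2 * (2 * (laplaceSymbol κ k)⁻¹) := by gcongr
              _ = _ := by ring
      _ = 2 * (∫ k, ‖curveFourier γ v k‖ ^ 2 * (laplaceSymbol κ k)⁻¹) + V * D := by
          rw [integral_add (i1.const_mul 2) i2, integral_const_mul, integral_indicator hSm,
            setIntegral_const, smul_eq_mul]
      _ ≤ 2 * (1 / (2 * κ * c) * I) + V * D := by gcongr
      _ = ε / 2 * I + ((2 * R / N) ^ 2 * (2 * R) * V) * I := by
          have : 2 * (1 / (2 * κ * c)) = ε / 2 := by rw [hκ]; field_simp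
          rw [← mul_assoc, this, hD]; ring
      _ ≤ ε / 2 * I + ε / 2 * I := by gcongr
      _ = ε * I := by ring
  -- `I` is the pairing of `h` with the adjoint trace of its own cut-off trace, so `I² ≤ ε I ‖h‖²`.
  have hpair : I ≤ ‖adjoint hγ.trace (hvL.toLp v)‖ * ‖h‖ := by
    have h1 : (inner ℂ (adjoint hγ.trace (hvL.toLp v)) h : ℂ) = (I : ℂ) := by
      rw [ContinuousLinearMap.adjoint_inner_left, ← Lp.toLp_coeFn (hγ.trace h) hfL,
        inner_toLp_toLp, ← hI, ← integral_complex_ofReal]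
      refine integral_congr_ae (Eventually.of_forall fun s => ?_)
      by_cases hs : s ∈ Ioc (-R) R
      · simp only [hv, indicator_of_mem hs]
        rw [mul_comm, Complex.mul_conj, Complex.normSq_eq_norm_sq]
      · simp [hv, hs]
    have h2 := norm_inner_le_norm (𝕜 := ℂ) (adjoint hγ.trace (hvL.toLp v)) h
    rwa [h1, Complex.norm_real, Real.norm_of_nonneg hI0] at h2
  rcases hI0.eq_or_lt with h0 | h0
  · rw [← h0]; positivity
  · refine le_of_mul_le_mul_right ?_ h0
    calc I * I = I ^ 2 := by ring
      _ ≤ (‖adjoint hγ.trace (hvL.toLp v)‖ * ‖h‖) ^ 2 := by gcongr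
      _ = ‖adjoint hγ.trace (hvL.toLp v)‖ ^ 2 * ‖h‖ ^ 2 := by ring
      _ ≤ ε * I * ‖h‖ ^ 2 := by gcongr
      _ = ε * ‖h‖ ^ 2 * I := by ring

/-- Below `-α²/4` the form is coercive on a subspace of finite codimension. -/
theorem IsWire.exists_coercive_orthogonal (hγ : IsWire γ c) (ha1 : ConditionA1 γ)
    (ha2 : ConditionA2 γ) {α : ℝ} (hα : 0 < α) {r : ℝ} (hr : r < -(α ^ 2 / 4)) :
    ∃ W : Submodule ℂ L2Plane, FiniteDimensional ℂ W ∧ ∃ δ > 0, ∀ h ∈ Wᗮ, δ * ‖h‖ ^ 2 ≤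
      (inner ℂ h (shiftedForm sobolevIncl (deltaForm α (curveMeasure γ)) (r : ℂ) h)).re := by
  have hr0 : 0 < -r := by nlinarith [sq_nonneg α]
  set κ : ℝ := √(-r) with hκ
  have hκ0 : 0 < κ := Real.sqrt_pos.2 hr0
  have hκ2 : κ ^ 2 = -r := Real.sq_sqrt hr0.le
  have hακ : α / 2 < κ := by
    refine lt_of_pow_lt_pow_left₀ 2 hκ0.le ?_
    rw [hκ2]; nlinarith
  have hq : α / (2 * κ) < 1 := by rw [div_lt_one (by positivity)]; linarith
  -- Half of the gap: the distant part then uses the fraction `α(1/(2κ) + θ/α) = 1 - θ` of the form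
  -- of `-Δ + κ²`. Of the remaining `θ`, at least `θ m ‖h‖²`, half pays for the bounded arc.
  set θ : ℝ := (1 - α / (2 * κ)) / 2 with hθ
  have hθ0 : 0 < θ := by rw [hθ]; linarith
  obtain ⟨R, hRb⟩ := exists_integral_curveKernel_le hκ0 hγ.cont ha1 ha2
    (show 0 < θ / α by positivity)
  set m := min 1 (κ ^ 2) with hm
  have hm0 : 0 < m := lt_min one_pos (by positivity)
  set ε : ℝ := θ * m / (2 * α) with hε
  obtain ⟨W, hW, hWb⟩ := hγ.exists_setIntegral_trace_le (R := max 1 R) (ε := ε) (by positivity)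
    (by positivity)
  refine ⟨W, hW, θ * m / 2, by positivity, fun h hh => ?_⟩
  set R' := max 1 R with hR'
  have h1 := hγ.setIntegral_trace_sq_le hκ0 (measurableSet_Ioc (a := -R') (b := R')).compl
    (b := 1 / (2 * κ) + θ / α) (by positivity) (fun s hs => hRb s ?_) h
  · have h2 := hWb h hh
    have h3 := norm_sq_eq_add_compl (measurableSet_Ioc (a := -R') (b := R')) (hγ.trace h)
    have h4 : α * (1 / (2 * κ) + θ / α) = 1 - θ := by
      rw [hθ]; field_simp; ring
    have h5 : m * ‖h‖ ^ 2 ≤ ‖h‖ ^ 2 + (κ ^ 2 - 1) * ‖sobolevIncl h‖ ^ 2 := by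
      have n1 := norm_sobolevIncl_le h
      have n2 : ‖sobolevIncl h‖ ^ 2 ≤ ‖h‖ ^ 2 := by gcongr
      have n3 := sq_nonneg ‖sobolevIncl h‖
      rcases le_total 1 (κ ^ 2) with hk | hk
      · rw [hm, min_eq_left hk]
        nlinarith
      · rw [hm, min_eq_right hk]
        nlinarith
    rw [hγ.re_inner_shiftedForm, ← hκ2]
    set Q := ‖h‖ ^ 2 + (κ ^ 2 - 1) * ‖sobolevIncl h‖ ^ 2 with hQ
    have h6 : α * ‖hγ.trace h‖ ^ 2 ≤ θ * m / 2 * ‖h‖ ^ 2 + (1 - θ) * Q := by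
      rw [h3, mul_add, ← h4, mul_assoc]
      have h7 : α * (ε * ‖h‖ ^ 2) = θ * m / 2 * ‖h‖ ^ 2 := by rw [hε]; field_simp
      rw [← h7]
      gcongr
    have h8 := mul_le_mul_of_nonneg_left h5 hθ0.le
    linarith
  · have hs' : ¬(-R' < s ∧ s ≤ R') := hs
    have hRR : R ≤ R' := le_max_right _ _
    refine hRR.trans ?_
    by_contra hlt
    rw [not_le, abs_lt] at hlt
    exact hs' ⟨hlt.1, hlt.2.le⟩

end LowerBound

/-! ### Approximate eigenfunctions guided by the curve -/

section GuidedModes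

open Real Set
open scoped ComplexConjugate FourierTransform
open ContinuousLinearMap (adjoint)

variable {γ : ℝ → Plane} {c κ : ℝ} [(curveMeasure γ).HasTemperateGrowth]

/-! ### The straight line as a model. -/

theorem norm_smul_e_sub (s s' : ℝ) : ‖s • e 0 - s' • e 0‖ = |s - s'| := by
  rw [← sub_smul, norm_smul, Real.norm_eq_abs, e, PiLp.norm_single, norm_one, mul_one]

theorem curveKernel_line (κ s s' : ℝ) :
    curveKernel (fun s => s • e 0) κ s s' = resolventKernel κ (s - s') := by
  rw [curveKernel, norm_smul_e_sub, resolventKernel_abs]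

theorem integrable_mul_resolventKernel_sub (hκ : 0 < κ) {f : ℝ → ℝ} (hf : Integrable f) :
    Integrable fun p : ℝ × ℝ => f p.1 * resolventKernel κ (p.1 - p.2) := by
  simpa only [curveKernel_line] using integrable_mul_curveKernel (γ := fun s => s • e 0) hκ one_pos
    (by fun_prop) (fun s s' => by rw [norm_smul_e_sub, one_mul]) hf

theorem integrable_mul_resolventKernel_sub_right (hκ : 0 < κ) {f : ℝ → ℝ} (hf : Integrable f) :
    Integrable fun p : ℝ × ℝ => f p.2 * resolventKernel κ (p.1 - p.2) := by
  simpa only [curveKernel_line] using integrable_mul_curveKernel_right (γ := fun s => s • e 0) hκ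
    one_pos (by fun_prop) (fun s s' => by rw [norm_smul_e_sub, one_mul]) hf

/-- On a line plane waves are exact generalised eigenfunctions of the kernel. With `κ² + q² = α²/4`
the eigenvalue is `1/α`. -/
theorem integral_mul_resolventKernel_mul_exp (hκ : 0 < κ) (q s : ℝ) :
    ∫ s' : ℝ, Complex.exp (Complex.I * q * s') * (resolventKernel κ (s - s') : ℂ) =
      ((1 / (2 * √(κ ^ 2 + q ^ 2)) : ℝ) : ℂ) * Complex.exp (Complex.I * q * s) := by
  have h1 := integral_resolventKernel_mul_exp hκ (-q)
  rw [neg_sq] at h1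
  rw [← h1, ← integral_mul_const]
  rw [← integral_sub_left_eq_self (fun r : ℝ => (resolventKernel κ r : ℂ) *
    Complex.exp (Complex.I * ((-q : ℝ) : ℂ) * r) * Complex.exp (Complex.I * q * s)) volume s]
  refine integral_congr_ae (Eventually.of_forall fun s' => ?_)
  simp only
  rw [mul_assoc (resolventKernel κ (s - s') : ℂ), ← Complex.exp_add, mul_comm]
  congr 2
  push_cast
  ring

/-- A bound of the error made in replacing the curve by a straight line and the density `χ` by a
constant. -/
def kernelDefect (γ : ℝ → Plane) (κ : ℝ) (χ : ℝ → ℝ) (p : ℝ × ℝ) : ℝ :=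
  χ p.2 * (curveKernel γ κ p.1 p.2 - resolventKernel κ (p.1 - p.2)) +
    |χ p.2 - χ p.1| * resolventKernel κ (p.1 - p.2)

theorem integrable_abs_sub_mul_resolventKernel (hκ : 0 < κ) {χ : ℝ → ℝ} (hχ : Integrable χ) :
    Integrable fun p : ℝ × ℝ => |χ p.2 - χ p.1| * resolventKernel κ (p.1 - p.2) := by
  refine (((integrable_mul_resolventKernel_sub_right hκ hχ).sub
    (integrable_mul_resolventKernel_sub hκ hχ)).abs).congr (Eventually.of_forall fun p => ?_)
  simp only [Pi.sub_apply]
  rw [← sub_mul, abs_mul, abs_of_nonneg (resolventKernel_nonneg _ _)]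

theorem IsWire.integrable_kernelDefect (hγ : IsWire γ c) (hκ : 0 < κ) {χ : ℝ → ℝ}
    (hχ : Integrable χ) : Integrable (kernelDefect γ κ χ) := by
  refine Integrable.add ?_ (integrable_abs_sub_mul_resolventKernel hκ hχ)
  refine ((integrable_mul_curveKernel_right hκ hγ.pos hγ.cont hγ.lower hχ).sub
    (integrable_mul_resolventKernel_sub_right hκ hχ)).congr (Eventually.of_forall fun p => ?_)
  simp only [Pi.sub_apply]
  ring

/-- The single layer potential of a slowly modulated plane wave is almost an eigenfunction. -/
theorem IsWire.norm_trace_singleLayer_sub_sq_le (hγ : IsWire γ c) (hκ : 0 < κ) {χ : ℝ → ℝ}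
    (hχ0 : ∀ s, 0 ≤ χ s) (hχ1 : ∀ s, χ s ≤ 1) (hχ : Integrable χ) (q : ℝ)
    (hv1 : Integrable fun s : ℝ => (χ s : ℂ) * Complex.exp (Complex.I * q * s))
    (hv : MemLp (fun s : ℝ => (χ s : ℂ) * Complex.exp (Complex.I * q * s)) 2 volume) :
    ‖hγ.trace (hγ.singleLayer hκ hv1 hv) - ((1 / (2 * √(κ ^ 2 + q ^ 2)) : ℝ) : ℂ) • hv.toLp _‖ ^ 2 ≤
      1 / (2 * κ * c) * ∫ p, kernelDefect γ κ χ p := by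
  have hc := hγ.pos
  set A : ℝ := 1 / (2 * κ * c) with hA
  have hA0 : 0 < A := by positivity
  set β : ℂ := ((1 / (2 * √(κ ^ 2 + q ^ 2)) : ℝ) : ℂ) with hβ
  set z := hγ.trace (hγ.singleLayer hκ hv1 hv) - β • hv.toLp _ with hz
  set B := ∫ p, kernelDefect γ κ χ p with hB
  -- Taking `f = z` gives `‖z‖² ≤ A B`. The bound is closed in `f`, so Schwartz test functions
  -- suffice.
  suffices H : ∀ f : Lp ℂ 2 (volume : Measure ℝ),
      (inner ℂ f z).re ≤ 1 / 2 * ‖f‖ ^ 2 + 1 / 2 * (A * B) by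
    have h1 := H z
    rw [inner_self_eq_norm_sq_complex, Complex.ofReal_re] at h1
    linarith
  intro f
  refine (SchwartzMap.denseRange_toLpCLM (F := ℂ) (E := ℝ) (μ := volume) (p := 2)
    ENNReal.ofNat_ne_top).induction_on (p := fun f =>
      (inner ℂ f z).re ≤ 1 / 2 * ‖f‖ ^ 2 + 1 / 2 * (A * B)) f ?_ fun ψ => ?_
  · exact isClosed_le (by fun_prop) (by fun_prop)
  have hw1 : Integrable (ψ : ℝ → ℂ) := ψ.integrable
  have hw : MemLp (ψ : ℝ → ℂ) 2 := ψ.memLp 2 volume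
  change (inner ℂ (hw.toLp ψ) z).re ≤ 1 / 2 * ‖hw.toLp ψ‖ ^ 2 + 1 / 2 * (A * B)
  set E : ℝ → ℂ := fun s => Complex.exp (Complex.I * q * s) with hE
  have hEn : ∀ s, ‖E s‖ = 1 := fun s => by
    rw [hE]
    simp only
    rw [mul_assoc, mul_comm, ← Complex.ofReal_mul, Complex.norm_exp_ofReal_mul_I]
  have hEc : Continuous E := by rw [hE]; fun_prop
  have hχm := hχ.aestronglyMeasurable
  have hwχ : Integrable fun s => ‖conj (ψ s) * (χ s : ℂ)‖ := by
    refine Integrable.norm (hw1.norm.mono' ?_ (Eventually.of_forall fun s => ?_))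
    · exact (Complex.continuous_conj.comp ψ.continuous).aestronglyMeasurable.mul
        (Complex.continuous_ofReal.comp_aestronglyMeasurable hχm)
    · rw [norm_mul, RCLike.norm_conj, Complex.norm_real, Real.norm_of_nonneg (hχ0 s)]
      exact mul_le_of_le_one_right (norm_nonneg _) (hχ1 s)
  have i1 := integrable_mul_mul_curveKernel hκ hγ.pos hγ.cont hγ.lower hv hw
  have i2 : Integrable fun p : ℝ × ℝ =>
      conj (ψ p.1) * (χ p.1 : ℂ) * (E p.2 * (resolventKernel κ (p.1 - p.2) : ℂ)) := by
    refine (integrable_mul_resolventKernel_sub hκ hwχ).mono' ?_ (Eventually.of_forall fun p => ?_)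
    · have m1 : AEStronglyMeasurable (fun p : ℝ × ℝ => conj (ψ p.1) * (χ p.1 : ℂ))
          (volume.prod volume) :=
        ((Complex.continuous_conj.comp ψ.continuous).aestronglyMeasurable.mul
          (Complex.continuous_ofReal.comp_aestronglyMeasurable hχm)).comp_fst
      have m2 : Measurable fun p : ℝ × ℝ => (resolventKernel κ (p.1 - p.2) : ℂ) :=
        Complex.measurable_ofReal.comp
          ((measurable_resolventKernel κ).comp (measurable_fst.sub measurable_snd))
      exact m1.mul ((hEc.comp continuous_snd).aestronglyMeasurable.mul m2.aestronglyMeasurable)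
    · rw [norm_mul, norm_mul (E p.2), hEn, one_mul, Complex.norm_real,
        Real.norm_of_nonneg (resolventKernel_nonneg _ _)]
  have e2 : β * ∫ s, conj (ψ s) * ((χ s : ℂ) * E s) =
      ∫ p : ℝ × ℝ, conj (ψ p.1) * (χ p.1 : ℂ) * (E p.2 * (resolventKernel κ (p.1 - p.2) : ℂ)) := by
    rw [Measure.volume_eq_prod, integral_prod _ i2, ← integral_const_mul]
    refine integral_congr_ae (Eventually.of_forall fun s => ?_)
    simp only
    rw [integral_const_mul, integral_mul_resolventKernel_mul_exp hκ]
    ring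
  have e3 : inner ℂ (hw.toLp ψ) z = ∫ p : ℝ × ℝ,
      (conj (ψ p.1) * ((χ p.2 : ℂ) * E p.2) * (curveKernel γ κ p.1 p.2 : ℂ) -
      conj (ψ p.1) * (χ p.1 : ℂ) * (E p.2 * (resolventKernel κ (p.1 - p.2) : ℂ))) := by
    rw [hz, inner_sub_right, inner_smul_right, hγ.inner_trace_singleLayer hκ hv1 hv hw1 hw,
      inner_toLp_toLp, e2, integral_sub i1 i2]
  have hD := hγ.integrable_kernelDefect hκ hχ
  have hsq : Integrable fun s => ‖ψ s‖ ^ 2 := (memLp_two_iff_integrable_sq_norm hw.1).1 hw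
  have iG := integrable_mul_curveKernel hκ hγ.pos hγ.cont hγ.lower hsq
  have hG : ∫ p : ℝ × ℝ, ‖ψ p.1‖ ^ 2 * curveKernel γ κ p.1 p.2 ≤ A * ∫ s, ‖ψ s‖ ^ 2 := by
    rw [Measure.volume_eq_prod, integral_prod _ iG, ← integral_const_mul]
    refine integral_mono iG.integral_prod_left (hsq.const_mul _) fun s => ?_
    simp only
    rw [integral_const_mul, mul_comm]
    gcongr
    simp_rw [curveKernel_comm κ s]
    exact integral_curveKernel_le hκ hγ.pos hγ.cont hγ.lower s
  calc (inner ℂ (hw.toLp ψ) z).re ≤ ‖inner ℂ (hw.toLp ψ) z‖ := Complex.re_le_norm _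
    _ ≤ ∫ p : ℝ × ℝ, ((2 * A)⁻¹ * (‖ψ p.1‖ ^ 2 * curveKernel γ κ p.1 p.2) +
          A / 2 * kernelDefect γ κ χ p) := by
        rw [e3]
        refine norm_integral_le_of_norm_le ((iG.const_mul _).add (hD.const_mul _)) ?_
        filter_upwards [ae_ne_prod] with p hp
        have hle := resolventKernel_le_curveKernel hκ hγ.injective (hγ.upper p.1 p.2) hp
        have hR0 := resolventKernel_nonneg κ (p.1 - p.2)
        have habs : |χ p.2 - χ p.1| ≤ 1 := by
          rw [abs_le]; constructor <;> linarith [hχ0 p.1, hχ0 p.2, hχ1 p.1, hχ1 p.2]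
        -- The defect is dominated by the kernel itself because `0 ≤ χ ≤ 1`. Hence, after Young's
        -- inequality, the `‖ψ‖²` term is controlled by row integrals, and only the total integral
        -- of the defect remains.
        have hD1 : kernelDefect γ κ χ p ≤ curveKernel γ κ p.1 p.2 := by
          unfold kernelDefect
          have := mul_le_mul_of_nonneg_right (hχ1 p.2) (sub_nonneg.2 hle)
          have := mul_le_mul_of_nonneg_right habs hR0
          linarith
        have hD0 : 0 ≤ kernelDefect γ κ χ p :=
          add_nonneg (mul_nonneg (hχ0 _) (sub_nonneg.2 hle)) (mul_nonneg (abs_nonneg _) hR0)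
        have hn : ‖conj (ψ p.1) * ((χ p.2 : ℂ) * E p.2) * (curveKernel γ κ p.1 p.2 : ℂ) -
            conj (ψ p.1) * (χ p.1 : ℂ) * (E p.2 * (resolventKernel κ (p.1 - p.2) : ℂ))‖ ≤
            ‖ψ p.1‖ * kernelDefect γ κ χ p := by
          have h1 : conj (ψ p.1) * ((χ p.2 : ℂ) * E p.2) * (curveKernel γ κ p.1 p.2 : ℂ) -
              conj (ψ p.1) * (χ p.1 : ℂ) * (E p.2 * (resolventKernel κ (p.1 - p.2) : ℂ)) =
              conj (ψ p.1) * E p.2 * ((χ p.2 * (curveKernel γ κ p.1 p.2 -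
                resolventKernel κ (p.1 - p.2)) + (χ p.2 - χ p.1) *
                resolventKernel κ (p.1 - p.2) : ℝ) : ℂ) := by
            push_cast; ring
          rw [h1, norm_mul, norm_mul, RCLike.norm_conj, hEn, mul_one, Complex.norm_real]
          gcongr
          refine (norm_add_le _ _).trans (le_of_eq ?_)
          rw [norm_mul, norm_mul, Real.norm_of_nonneg (hχ0 _),
            Real.norm_of_nonneg (sub_nonneg.2 hle), Real.norm_of_nonneg hR0, Real.norm_eq_abs]
          rfl
        refine hn.trans ?_
        have h2 : ‖ψ p.1‖ ≤ (2 * A)⁻¹ * ‖ψ p.1‖ ^ 2 + A / 2 := by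
          have h3 : (2 * A)⁻¹ * ‖ψ p.1‖ ^ 2 + A / 2 - ‖ψ p.1‖ =
              (2 * A)⁻¹ * (‖ψ p.1‖ - A) ^ 2 := by field_simp; ring
          have : 0 ≤ (2 * A)⁻¹ * (‖ψ p.1‖ - A) ^ 2 := by positivity
          linarith
        calc ‖ψ p.1‖ * kernelDefect γ κ χ p
            ≤ ((2 * A)⁻¹ * ‖ψ p.1‖ ^ 2 + A / 2) * kernelDefect γ κ χ p := by gcongr
          _ = (2 * A)⁻¹ * (‖ψ p.1‖ ^ 2 * kernelDefect γ κ χ p) +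
              A / 2 * kernelDefect γ κ χ p := by ring
          _ ≤ _ := by gcongr
    _ = (2 * A)⁻¹ * (∫ p : ℝ × ℝ, ‖ψ p.1‖ ^ 2 * curveKernel γ κ p.1 p.2) + A / 2 * B := by
        rw [integral_add (iG.const_mul _) (hD.const_mul _), integral_const_mul,
          integral_const_mul]
    _ ≤ (2 * A)⁻¹ * (A * ∫ s, ‖ψ s‖ ^ 2) + A / 2 * B := by gcongr
    _ = 1 / 2 * ‖hw.toLp ψ‖ ^ 2 + 1 / 2 * (A * B) := by
        rw [norm_toLp_sq]; field_simp

/-! ### The defect of long intervals far out on the curve. -/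

theorem resolventKernel_neg (κ r : ℝ) : resolventKernel κ (-r) = resolventKernel κ r := by
  rw [← resolventKernel_abs κ (-r), abs_neg, resolventKernel_abs]

theorem integrable_indicator_Ioc (a b : ℝ) :
    Integrable ((Ioc a b).indicator fun _ => (1 : ℝ)) :=
  (integrable_indicator_iff measurableSet_Ioc).2
    (integrableOn_const (by rw [Real.volume_Ioc]; exact ENNReal.ofReal_ne_top))

theorem integral_indicator_Ioc {a b : ℝ} (h : a ≤ b) :
    ∫ s, (Ioc a b).indicator (fun _ => (1 : ℝ)) s = b - a := by
  rw [integral_indicator measurableSet_Ioc, setIntegral_const, measureReal_def, Real.volume_Ioc,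
    ENNReal.toReal_ofReal (by linarith), smul_eq_mul, mul_one]

/-- A long interval interacts little with its complement. -/
theorem exists_integral_boundary_le (hκ : 0 < κ) {ε : ℝ} (hε : 0 < ε) :
    ∃ L > 0, ∀ a : ℝ, ∫ p : ℝ × ℝ,
      |(Ioc a (a + L)).indicator (fun _ => (1 : ℝ)) p.2 -
        (Ioc a (a + L)).indicator (fun _ => (1 : ℝ)) p.1| * resolventKernel κ (p.1 - p.2) ≤
      ε * L := by
  obtain ⟨l, hl, htail⟩ := exists_setIntegral_tail_le (integrable_resolventKernel hκ)
    (show 0 < ε / 4 by positivity)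
  -- The two boundary layers of width `l` cost `2l/κ` in both orders together, at most `ε L/2` for
  -- this length. The tails from interior points cost another `ε L/2`.
  refine ⟨max (2 * l) (4 * l / (κ * ε)), lt_max_of_lt_left (by positivity), fun a => ?_⟩
  set L := max (2 * l) (4 * l / (κ * ε)) with hL
  have hL1 : 2 * l ≤ L := le_max_left _ _
  have hL2 : 2 * l / κ ≤ ε / 2 * L := by
    calc 2 * l / κ = ε / 2 * (4 * l / (κ * ε)) := by field_simp; ring
      _ ≤ ε / 2 * L := by gcongr; exact le_max_right _ _
  set χ : ℝ → ℝ := (Ioc a (a + L)).indicator fun _ => (1 : ℝ) with hχ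
  have hχi : Integrable χ := integrable_indicator_Ioc _ _
  have hχ01 : ∀ s, χ s = 0 ∨ χ s = 1 := fun s => by
    by_cases hs : s ∈ Ioc a (a + L) <;> simp [hχ, hs]
  have hχ0 : ∀ s, 0 ≤ χ s := fun s => by rcases hχ01 s with h | h <;> simp [h]
  have hχ1 : ∀ s, χ s ≤ 1 := fun s => by rcases hχ01 s with h | h <;> simp [h]
  have hχm : Measurable χ := measurable_const.indicator measurableSet_Ioc
  set f : ℝ × ℝ → ℝ := fun p => χ p.2 * (1 - χ p.1) * resolventKernel κ (p.1 - p.2) with hf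
  have hfi : Integrable f (volume.prod volume) := by
    refine (integrable_mul_resolventKernel_sub_right hκ hχi).mono' ?_
      (Eventually.of_forall fun p => ?_)
    · refine Measurable.aestronglyMeasurable ?_
      have := measurable_resolventKernel κ
      rw [hf]
      fun_prop
    · have h1 := hχ0 p.2
      have h2 : 0 ≤ 1 - χ p.1 := sub_nonneg.2 (hχ1 _)
      have h3 := resolventKernel_nonneg κ (p.1 - p.2)
      rw [Real.norm_of_nonneg (by positivity)]
      exact mul_le_mul_of_nonneg_right
        (mul_le_of_le_one_right h1 (by linarith [hχ0 p.1])) h3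
  have hinner : ∀ s', ∫ s, f (s, s') ≤ ε / 4 * χ s' +
      1 / (2 * κ) * ((Ioc a (a + l)).indicator (fun _ => (1 : ℝ)) s' +
        (Ioc (a + L - l) (a + L)).indicator (fun _ => (1 : ℝ)) s') := fun s' => by
    have hn1 : 0 ≤ (Ioc a (a + l)).indicator (fun _ => (1 : ℝ)) s' :=
      indicator_nonneg (fun _ _ => zero_le_one) _
    have hn2 : 0 ≤ (Ioc (a + L - l) (a + L)).indicator (fun _ => (1 : ℝ)) s' :=
      indicator_nonneg (fun _ _ => zero_le_one) _
    have hr : Integrable fun s => resolventKernel κ (s - s') :=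
      (integrable_resolventKernel hκ).comp_sub_right s'
    by_cases hs : s' ∈ Ioc a (a + L)
    swap
    · have : χ s' = 0 := by simp [hχ, hs]
      simp only [hf, this, zero_mul, integral_zero, mul_zero, zero_add]
      positivity
    have hs1 : χ s' = 1 := by simp [hχ, hs]
    by_cases hb : s' ≤ a + l ∨ a + L - l < s'
    · have h1 : ∫ s, f (s, s') ≤ 1 / (2 * κ) := by
        rw [← integral_resolventKernel hκ, ← integral_sub_right_eq_self (resolventKernel κ) s']
        refine integral_mono_of_nonneg (Eventually.of_forall fun s => ?_) hr
          (Eventually.of_forall fun s => ?_)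
        · exact mul_nonneg (mul_nonneg (hχ0 _) (sub_nonneg.2 (hχ1 _))) (resolventKernel_nonneg _ _)
        · simp only [hf, hs1, one_mul]
          exact mul_le_of_le_one_left (resolventKernel_nonneg _ _) (sub_le_self _ (hχ0 s))
      have h2 : 1 ≤ (Ioc a (a + l)).indicator (fun _ => (1 : ℝ)) s' +
          (Ioc (a + L - l) (a + L)).indicator (fun _ => (1 : ℝ)) s' := by
        rcases hb with hb | hb
        · rw [indicator_of_mem (show s' ∈ Ioc a (a + l) from ⟨hs.1, hb⟩)]; linarith
        · rw [indicator_of_mem (show s' ∈ Ioc (a + L - l) (a + L) from ⟨hb, hs.2⟩)]; linarith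
      have h3 : 1 / (2 * κ) * 1 ≤ 1 / (2 * κ) * ((Ioc a (a + l)).indicator (fun _ => (1 : ℝ)) s' +
          (Ioc (a + L - l) (a + L)).indicator (fun _ => (1 : ℝ)) s') := by gcongr
      rw [hs1]
      linarith
    · push Not at hb
      have hm : MeasurableSet {r : ℝ | l < |r|} := measurableSet_lt measurable_const measurable_id.abs
      have h1 : ∫ s, f (s, s') ≤ ε / 4 := by
        refine le_trans ?_ htail
        rw [← integral_indicator hm, ← integral_sub_right_eq_self (indicator _ _) s']
        refine integral_mono_of_nonneg (Eventually.of_forall fun s => ?_)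
          (((integrable_resolventKernel hκ).indicator hm).comp_sub_right s')
          (Eventually.of_forall fun s => ?_)
        · exact mul_nonneg (mul_nonneg (hχ0 _) (sub_nonneg.2 (hχ1 _))) (resolventKernel_nonneg _ _)
        · simp only [hf, hs1, one_mul]
          by_cases hsI : s ∈ Ioc a (a + L)
          · have : χ s = 1 := by simp [hχ, hsI]
            rw [this, sub_self, zero_mul]
            exact indicator_nonneg (fun _ _ => resolventKernel_nonneg _ _) _
          · have h0 : χ s = 0 := by simp [hχ, hsI]
            have h4 : s - s' ∈ {r : ℝ | l < |r|} := by
              change l < |s - s'|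
              rw [mem_Ioc, not_and_or, not_lt, not_le] at hsI
              rcases hsI with h | h
              · exact lt_abs.2 (Or.inr (by linarith))
              · exact lt_abs.2 (Or.inl (by linarith))
            rw [indicator_of_mem h4, h0, sub_zero, one_mul]
      rw [hs1]
      have : 0 ≤ 1 / (2 * κ) * ((Ioc a (a + l)).indicator (fun _ => (1 : ℝ)) s' +
          (Ioc (a + L - l) (a + L)).indicator (fun _ => (1 : ℝ)) s') := by positivity
      linarith
  have hbound : ∫ p, f p ∂(volume.prod volume) ≤ ε / 4 * L + l / κ := by
    rw [integral_prod_symm _ hfi]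
    have i1 := (integrable_indicator_Ioc a (a + l)).add
      (integrable_indicator_Ioc (a + L - l) (a + L))
    have i2 : Integrable fun s' => 1 / (2 * κ) * ((Ioc a (a + l)).indicator (fun _ => (1 : ℝ)) s' +
        (Ioc (a + L - l) (a + L)).indicator (fun _ => (1 : ℝ)) s') := i1.const_mul _
    refine (integral_mono hfi.integral_prod_right ((hχi.const_mul (ε / 4)).add i2) hinner).trans
      (le_of_eq ?_)
    refine (integral_add (hχi.const_mul _) i2).trans ?_
    rw [integral_const_mul, integral_const_mul,
      integral_add (integrable_indicator_Ioc _ _) (integrable_indicator_Ioc _ _),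
      integral_indicator_Ioc (by linarith), integral_indicator_Ioc (by linarith),
      integral_indicator_Ioc (by linarith)]
    field_simp
    ring
  -- For an indicator, `|χ(s') - χ(s)|` is `1` exactly when one point is inside and the other
  -- outside; the two cases are swaps of each other.
  have hsplit : ∀ p : ℝ × ℝ, |χ p.2 - χ p.1| * resolventKernel κ (p.1 - p.2) =
      f p + f p.swap := fun p => by
    simp only [hf, Prod.fst_swap, Prod.snd_swap]
    rw [← resolventKernel_neg κ (p.2 - p.1), neg_sub]
    rcases hχ01 p.1 with h1 | h1 <;> rcases hχ01 p.2 with h2 | h2 <;> simp [h1, h2]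
  simp_rw [hsplit]
  have hsw : Integrable (fun p => f p.swap) (volume.prod volume) := hfi.swap
  rw [Measure.volume_eq_prod, integral_add hfi hsw, integral_prod_swap]
  have : l / κ + l / κ ≤ ε / 2 * L := by
    rw [← add_div, ← two_mul]; exact hL2
  linarith

theorem IsWire.exists_integral_kernelDefect_le (hγ : IsWire γ c) (ha1 : ConditionA1 γ)
    (ha2 : ConditionA2 γ) (hκ : 0 < κ) {ε : ℝ} (hε : 0 < ε) :
    ∃ a L : ℝ, 0 < L ∧
      ∫ p, kernelDefect γ κ ((Ioc a (a + L)).indicator fun _ => (1 : ℝ)) p ≤ ε * L := by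
  obtain ⟨R, hR⟩ := exists_integral_curveKernel_le hκ hγ.cont ha1 ha2
    (show 0 < ε / 2 by positivity)
  obtain ⟨L, hL, hLb⟩ := exists_integral_boundary_le hκ (show 0 < ε / 2 by positivity)
  -- The length `L` works for every position, so the interval can be moved to where the row
  -- integrals exceed those of the line by at most `ε/2`.
  set a := max R 0 with ha
  refine ⟨a, L, hL, ?_⟩
  have hb := hLb a
  set χ : ℝ → ℝ := (Ioc a (a + L)).indicator fun _ => (1 : ℝ) with hχ
  have hχi : Integrable χ := integrable_indicator_Ioc _ _
  have iG : Integrable (fun p : ℝ × ℝ => χ p.2 * curveKernel γ κ p.1 p.2 -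
      χ p.2 * resolventKernel κ (p.1 - p.2)) (volume.prod volume) :=
    (integrable_mul_curveKernel_right hκ hγ.pos hγ.cont hγ.lower hχi).sub
      (integrable_mul_resolventKernel_sub_right hκ hχi)
  have h1 : ∫ p : ℝ × ℝ, (χ p.2 * curveKernel γ κ p.1 p.2 -
      χ p.2 * resolventKernel κ (p.1 - p.2)) ≤ ε / 2 * L := by
    rw [Measure.volume_eq_prod, integral_prod_symm _ iG]
    calc _ ≤ ∫ s', ε / 2 * χ s' := by
          refine integral_mono iG.integral_prod_right (hχi.const_mul _) fun s' => ?_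
          simp only
          rw [integral_sub ((integrable_curveKernel hκ hγ.pos hγ.cont hγ.lower s').const_mul _)
            (((integrable_resolventKernel hκ).comp_sub_right s').const_mul _), integral_const_mul,
            integral_const_mul, integral_sub_right_eq_self, integral_resolventKernel hκ]
          by_cases hs : s' ∈ Ioc a (a + L)
          · have h2 : χ s' = 1 := by simp [hχ, hs]
            have h3 : R ≤ |s'| := (le_max_left R 0).trans (hs.1.le.trans (le_abs_self _))
            rw [h2]
            linarith [hR s' h3]
          · have h2 : χ s' = 0 := by simp [hχ, hs]
            simp [h2]
      _ = ε / 2 * L := by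
          rw [integral_const_mul, integral_indicator_Ioc (by linarith), add_sub_cancel_left]
  have h4 : ∫ p, kernelDefect γ κ χ p = (∫ p : ℝ × ℝ, (χ p.2 * curveKernel γ κ p.1 p.2 -
      χ p.2 * resolventKernel κ (p.1 - p.2))) +
      ∫ p : ℝ × ℝ, |χ p.2 - χ p.1| * resolventKernel κ (p.1 - p.2) := by
    rw [← integral_add (μ := volume) iG (integrable_abs_sub_mul_resolventKernel hκ hχi)]
    refine integral_congr_ae (Eventually.of_forall fun p => ?_)
    simp only [kernelDefect]
    ring
  rw [h4]
  linarith

/-- Approximate eigenfunctions for the negative part of the essential spectrum. -/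
theorem IsWire.exists_approx_eigenvector_of_neg (hγ : IsWire γ c) (ha1 : ConditionA1 γ)
    (ha2 : ConditionA2 γ) {α : ℝ} (hα : 0 < α) {r : ℝ} (hr : -(α ^ 2 / 4) ≤ r) (hr0 : r < 0)
    {ε : ℝ} (hε : 0 < ε) :
    ∃ h ≠ 0, ‖shiftedForm sobolevIncl (deltaForm α (curveMeasure γ)) (r : ℂ) h‖ ≤ ε * ‖h‖ := by
  have hc := hγ.pos
  set κ : ℝ := √(-r) with hκ
  have hκ0 : 0 < κ := Real.sqrt_pos.2 (by linarith)
  have hκ2 : κ ^ 2 = -r := Real.sq_sqrt (by linarith)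
  -- The guided-mode momentum, for which the line's symbol equals `1/α`. It is `0` at the threshold.
  set q : ℝ := √(α ^ 2 / 4 - κ ^ 2) with hq
  have hq2 : κ ^ 2 + q ^ 2 = (α / 2) ^ 2 := by
    have h1 : q ^ 2 = α ^ 2 / 4 - κ ^ 2 := Real.sq_sqrt (by linarith)
    rw [h1]; ring
  have hβ : 1 / (2 * √(κ ^ 2 + q ^ 2)) = 1 / α := by
    rw [hq2, Real.sqrt_sq (by positivity)]; congr 1; ring
  set M : ℝ := 1 + ‖hγ.trace‖ with hM
  have hM0 : 0 < M := by positivity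
  have hTM : ∀ h, ‖hγ.trace h‖ ≤ M * ‖h‖ := fun h =>
    (hγ.trace.le_opNorm h).trans (by gcongr; rw [hM]; linarith)
  have hTM' : ∀ f, ‖adjoint hγ.trace f‖ ≤ M * ‖f‖ := fun f =>
    ((adjoint hγ.trace).le_opNorm f).trans (by
      gcongr; rw [LinearIsometryEquiv.norm_map, hM]; linarith)
  -- The first bound keeps the trace of norm at least `√L/(2α)`, which bounds `‖h‖` from below; the
  -- second makes the residual small relative to that.
  set δ : ℝ := min (1 / (2 * α)) (ε / (2 * α ^ 2 * M ^ 2)) with hδ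
  have hδ0 : 0 < δ := lt_min (by positivity) (by positivity)
  obtain ⟨a, L, hL, hdef⟩ := hγ.exists_integral_kernelDefect_le ha1 ha2 hκ0
    (show 0 < 2 * κ * c * δ ^ 2 by positivity)
  set χ : ℝ → ℝ := (Ioc a (a + L)).indicator fun _ => (1 : ℝ) with hχ
  have hχi : Integrable χ := integrable_indicator_Ioc _ _
  have hχ01 : ∀ s, χ s = 0 ∨ χ s = 1 := fun s => by
    by_cases hs : s ∈ Ioc a (a + L) <;> simp [hχ, hs]
  have hχm : Measurable χ := measurable_const.indicator measurableSet_Ioc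
  have hvn : ∀ s : ℝ, ‖(χ s : ℂ) * Complex.exp (Complex.I * q * s)‖ = χ s := fun s => by
    rw [norm_mul, mul_assoc, mul_comm Complex.I, ← Complex.ofReal_mul,
      Complex.norm_exp_ofReal_mul_I, mul_one, Complex.norm_real]
    rcases hχ01 s with h | h <;> simp [h]
  have hvm : Measurable fun s : ℝ => (χ s : ℂ) * Complex.exp (Complex.I * q * s) := by fun_prop
  have hv1 : Integrable fun s : ℝ => (χ s : ℂ) * Complex.exp (Complex.I * q * s) :=
    hχi.mono' hvm.aestronglyMeasurable (Eventually.of_forall fun s => (hvn s).le)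
  have hsq : ∀ s : ℝ, ‖(χ s : ℂ) * Complex.exp (Complex.I * q * s)‖ ^ 2 = χ s := fun s => by
    rw [hvn]; rcases hχ01 s with h | h <;> simp [h]
  have hv : MemLp (fun s : ℝ => (χ s : ℂ) * Complex.exp (Complex.I * q * s)) 2 volume := by
    rw [memLp_two_iff_integrable_sq_norm hvm.aestronglyMeasurable]
    simpa only [hsq] using hχi
  have hvL : ‖hv.toLp _‖ = √L := by
    rw [← Real.sqrt_sq (norm_nonneg (hv.toLp _)), norm_toLp_sq]
    simp only [hsq]
    rw [integral_indicator_Ioc (by linarith), add_sub_cancel_left]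
  have hsL : 0 < √L := Real.sqrt_pos.2 hL
  set h := hγ.singleLayer hκ0 hv1 hv with hh
  have hz := hγ.norm_trace_singleLayer_sub_sq_le hκ0
    (fun s => by rcases hχ01 s with h | h <;> simp [h])
    (fun s => by rcases hχ01 s with h | h <;> simp [h]) hχi q hv1 hv
  rw [hβ, ← hh] at hz
  set z := hγ.trace h - ((1 / α : ℝ) : ℂ) • hv.toLp _ with hzdef
  have hzL : ‖z‖ ≤ δ * √L := by
    refine le_of_sq_le_sq (hz.trans ?_) (by positivity)
    rw [mul_pow, Real.sq_sqrt hL.le]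
    calc 1 / (2 * κ * c) * ∫ p, kernelDefect γ κ χ p
        ≤ 1 / (2 * κ * c) * (2 * κ * c * δ ^ 2 * L) := by gcongr
      _ = δ ^ 2 * L := by field_simp
  have hTh : 1 / (2 * α) * √L ≤ ‖hγ.trace h‖ := by
    have h1 : ‖((1 / α : ℝ) : ℂ) • hv.toLp _‖ = 1 / α * √L := by
      rw [norm_smul, hvL, Complex.norm_real, Real.norm_of_nonneg (by positivity)]
    have h2 : ‖((1 / α : ℝ) : ℂ) • hv.toLp _‖ - ‖z‖ ≤ ‖hγ.trace h‖ := by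
      have : hγ.trace h = ((1 / α : ℝ) : ℂ) • hv.toLp _ + z := by rw [hzdef]; abel
      rw [this]
      have := norm_sub_norm_le (((1 / α : ℝ) : ℂ) • hv.toLp _) (-z)
      rwa [norm_neg, sub_neg_eq_add] at this
    have h3 : δ * √L ≤ 1 / (2 * α) * √L := by gcongr; exact min_le_left _ _
    have h4 : 1 / α * √L = 1 / (2 * α) * √L + 1 / (2 * α) * √L := by field_simp; ring
    linarith
  have hTh0 : 0 < ‖hγ.trace h‖ := lt_of_lt_of_le (by positivity) hTh
  refine ⟨h, fun h0 => ?_, ?_⟩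
  · rw [h0, map_zero, norm_zero] at hTh0
    exact lt_irrefl _ hTh0
  · have hrκ : (r : ℂ) = ((-κ ^ 2 : ℝ) : ℂ) := by rw [hκ2, neg_neg]
    rw [hrκ, hh, hγ.shiftedForm_singleLayer hκ0 α hv1 hv, ← hh]
    have h1 : hv.toLp _ - (α : ℂ) • hγ.trace h = -((α : ℂ) • z) := by
      rw [hzdef, smul_sub, smul_smul, ← Complex.ofReal_mul, mul_one_div_cancel hα.ne',
        Complex.ofReal_one, one_smul, neg_sub]
    rw [h1]
    refine (hTM' _).trans ?_
    rw [norm_neg, norm_smul, Complex.norm_real, Real.norm_of_nonneg hα.le]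
    have h2 : δ ≤ ε / (2 * α ^ 2 * M ^ 2) := min_le_right _ _
    calc M * (α * ‖z‖) ≤ M * (α * (ε / (2 * α ^ 2 * M ^ 2) * √L)) := by
          gcongr
          exact hzL.trans (by gcongr)
      _ = ε / M * (1 / (2 * α) * √L) := by field_simp
      _ ≤ ε / M * (M * ‖h‖) :=
          mul_le_mul_of_nonneg_left (hTh.trans (hTM h)) (by positivity)
      _ = ε * ‖h‖ := by field_simp

end GuidedModes

/-! ### Wave packets -/

section WavePackets

open Real Set
open scoped ComplexConjugate FourierTransform
open ContinuousLinearMap (adjoint)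

variable {γ : ℝ → Plane} {c κ : ℝ} [(curveMeasure γ).HasTemperateGrowth]

theorem exists_schwartz_supported :
    ∃ G : 𝓢(Plane, ℂ), (∀ k, G k ≠ 0 → ‖k‖ ≤ 2) ∧ 0 < ∫ k, ‖G k‖ ^ 2 := by
  let b : ContDiffBump (0 : Plane) := ⟨1, 2, one_pos, one_lt_two⟩
  have hs : HasCompactSupport fun k => ((b k : ℝ) : ℂ) :=
    b.hasCompactSupport.comp_left Complex.ofReal_zero
  have hd : ContDiff ℝ (⊤ : ℕ∞) fun k => ((b k : ℝ) : ℂ) := Complex.ofRealCLM.contDiff.comp b.contDiff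
  refine ⟨hs.toSchwartzMap hd, fun k hk => ?_, ?_⟩
  · have h1 : k ∈ Function.support b := fun h0 => hk (by
      change ((b k : ℝ) : ℂ) = 0
      rw [h0, Complex.ofReal_zero])
    rw [b.support_eq, mem_ball_zero_iff] at h1
    exact h1.le
  · set G := hs.toSchwartzMap hd
    have hc : Continuous fun k => ‖G k‖ ^ 2 := by fun_prop
    refine (integral_pos_iff_support_of_nonneg (fun k => sq_nonneg _) ?_).2 ?_
    · exact (memLp_two_iff_integrable_sq_norm (G.memLp 2 volume).1).1 (G.memLp 2 volume)
    · refine hc.isOpen_support.measure_pos _ ⟨0, ?_⟩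
      have h1 : G 0 = 1 := by
        change ((b 0 : ℝ) : ℂ) = 1
        rw [b.one_of_mem_closedBall (Metric.mem_closedBall_self b.rIn_pos.le), Complex.ofReal_one]
      simp [h1]

theorem exists_fourier_eq_comp (G : 𝓢(Plane, ℂ)) (k₀ : Plane) {L : ℝ} (hL : 0 < L) :
    ∃ φ : 𝓢(Plane, ℂ), ∀ k, 𝓕 φ k = G (L • (k - k₀)) := by
  let u : Plane ≃L[ℝ] Plane := ContinuousLinearEquiv.smulLeft (Units.mk0 L hL.ne')
  refine ⟨𝓕⁻ (SchwartzMap.compSubConstCLM ℂ k₀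
    (SchwartzMap.compCLMOfContinuousLinearEquiv ℂ u G)), fun k => ?_⟩
  rw [FourierTransform.fourier_fourierInv_eq]
  rfl

/-- Concentrating momenta at scale `1/L` spreads the packet over scale `L`, with height of order
`L⁻²`. The shift by `k₀` is only a phase. -/
theorem norm_eq_of_fourier_eq_comp {G φ : 𝓢(Plane, ℂ)} {k₀ : Plane} {L : ℝ} (hL : 0 < L)
    (hφ : ∀ k, 𝓕 φ k = G (L • (k - k₀))) (x : Plane) :
    ‖φ x‖ = (L ^ 2)⁻¹ * ‖𝓕⁻ G (L⁻¹ • x)‖ := by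
  have h1 : φ x = Complex.exp (((2 * π * inner ℝ x k₀ : ℝ) : ℂ) * Complex.I) *
      ((((L ^ 2)⁻¹ : ℝ) : ℂ) * 𝓕⁻ G (L⁻¹ • x)) := by
    rw [schwartz_eq_integral_fourier, schwartz_eq_integral_fourier (𝓕⁻ G),
      FourierTransform.fourier_fourierInv_eq, ← integral_add_right_eq_self _ k₀]
    have h2 := Measure.integral_comp_smul_of_nonneg (volume : Measure Plane)
      (fun k => G k * Complex.exp (((2 * π * inner ℝ (L⁻¹ • x) k : ℝ) : ℂ) * Complex.I)) L
      (hR := hL.le)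
    rw [finrank_euclideanSpace_fin, Complex.real_smul] at h2
    rw [← h2, ← integral_const_mul]
    refine integral_congr_ae (Eventually.of_forall fun k => ?_)
    simp only
    have h3 : inner ℝ (L⁻¹ • x) (L • k) = inner ℝ x k := by
      rw [inner_smul_left, inner_smul_right]
      simp [hL.ne']
    rw [hφ, add_sub_cancel_right, h3, inner_add_right, mul_add, Complex.ofReal_add, add_mul,
      Complex.exp_add]
    ring
  rw [h1, norm_mul, Complex.norm_exp_ofReal_mul_I, one_mul, norm_mul, Complex.norm_real,
    Real.norm_of_nonneg (by positivity)]

theorem norm_toLp_sq_eq_fourier (φ : 𝓢(Plane, ℂ)) :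
    ‖φ.toLp 2 (volume : Measure Plane)‖ ^ 2 = ∫ k, ‖𝓕 φ k‖ ^ 2 := by
  have h := inner_toLp_eq_fourier φ φ
  rw [inner_self_eq_norm_sq_complex] at h
  have h2 : ∫ k, conj (𝓕 φ k) * 𝓕 φ k = ((∫ k, ‖𝓕 φ k‖ ^ 2 : ℝ) : ℂ) := by
    rw [← integral_complex_ofReal]
    refine integral_congr_ae (Eventually.of_forall fun k => ?_)
    simp only
    rw [mul_comm, Complex.mul_conj, Complex.normSq_eq_norm_sq]
  rw [h2] at h
  exact_mod_cast h

theorem integral_fourier_sq_of_eq_comp {G φ : 𝓢(Plane, ℂ)} {k₀ : Plane} {L : ℝ} (hL : 0 < L)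
    (hφ : ∀ k, 𝓕 φ k = G (L • (k - k₀))) :
    ∫ k, ‖𝓕 φ k‖ ^ 2 = (L ^ 2)⁻¹ * ∫ k, ‖G k‖ ^ 2 := by
  simp_rw [hφ]
  rw [integral_sub_right_eq_self (fun k => ‖G (L • k)‖ ^ 2),
    Measure.integral_comp_smul_of_nonneg (volume : Measure Plane) (fun k => ‖G k‖ ^ 2) L
      (hR := hL.le), finrank_euclideanSpace_fin, smul_eq_mul]

theorem exists_norm_le_inv_one_add (G : 𝓢(Plane, ℂ)) :
    ∃ C > 0, ∀ x, (1 + ‖x‖) * ‖G x‖ ≤ C := by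
  obtain ⟨C₀, hC₀, h0⟩ := G.decay 0 0
  obtain ⟨C₁, hC₁, h1⟩ := G.decay 1 0
  refine ⟨C₀ + C₁, by positivity, fun x => ?_⟩
  have a0 := h0 x
  have a1 := h1 x
  rw [norm_iteratedFDeriv_zero] at a0 a1
  rw [pow_zero] at a0
  rw [pow_one] at a1
  linarith

/-- A wave packet of width `L` is mostly away from the curve. -/
theorem IsWire.norm_trace_sq_le_of_fourier_eq_comp (hγ : IsWire γ c) (G : 𝓢(Plane, ℂ)) :
    ∃ K > 0, ∀ (k₀ : Plane) (L : ℝ) (φ : 𝓢(Plane, ℂ)), 0 < L → ‖γ 0‖ ≤ L →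
      (∀ k, 𝓕 φ k = G (L • (k - k₀))) → ‖hγ.trace (sobolevEmb φ)‖ ^ 2 ≤ K * (L ^ 3)⁻¹ := by
  obtain ⟨C, hC, hCb⟩ := exists_norm_le_inv_one_add (𝓕⁻ G)
  have hc := hγ.pos
  refine ⟨2 * C ^ 2 * (π / c), by positivity, fun k₀ L φ hL hγL hφ => ?_⟩
  have hi : Integrable fun s : ℝ => (1 + (c / L * s) ^ 2)⁻¹ :=
    integrable_inv_one_add_sq.comp_mul_left' (by positivity)
  rw [hγ.trace_emb, norm_toLp_sq]
  calc ∫ s, ‖φ (γ s)‖ ^ 2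
      ≤ ∫ s, (L ^ 2)⁻¹ ^ 2 * (2 * C ^ 2) * (1 + (c / L * s) ^ 2)⁻¹ := by
        refine integral_mono_of_nonneg (Eventually.of_forall fun s => sq_nonneg _)
          (hi.const_mul _) (Eventually.of_forall fun s => ?_)
        simp only
        rw [norm_eq_of_fourier_eq_comp hL hφ, mul_pow, mul_assoc]
        gcongr
        rw [← div_eq_mul_inv, le_div_iff₀ (by positivity)]
        set y := ‖L⁻¹ • γ s‖ with hy
        have h1 := hCb (L⁻¹ • γ s)
        -- By (a1) the rescaled curve leaves every ball linearly, at rate `c/L`. The assumption `‖γ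
        -- 0‖ ≤ L` keeps the offset below `1`, so the constant `K` is uniform in `L`.
        have h2 : c / L * |s| ≤ 1 + y := by
          have h3 := hγ.lower s 0
          rw [sub_zero] at h3
          have h4 := h3.trans (norm_sub_le _ _)
          rw [hy, norm_smul, norm_inv, Real.norm_of_nonneg hL.le, div_mul_eq_mul_div,
            div_le_iff₀ hL, add_mul, mul_comm L⁻¹, mul_assoc, inv_mul_cancel₀ hL.ne']
          linarith
        have h5 : (c / L * s) ^ 2 ≤ (1 + y) ^ 2 := by
          rw [← sq_abs (c / L * s), abs_mul, abs_of_pos (by positivity : 0 < c / L)]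
          gcongr
        have hy0 : 0 ≤ y := norm_nonneg _
        have h6 : 1 ≤ (1 + y) ^ 2 := by nlinarith
        calc ‖𝓕⁻ G (L⁻¹ • γ s)‖ ^ 2 * (1 + (c / L * s) ^ 2)
            ≤ ‖𝓕⁻ G (L⁻¹ • γ s)‖ ^ 2 * (2 * (1 + y) ^ 2) := by gcongr; linarith
          _ = 2 * ((1 + y) * ‖𝓕⁻ G (L⁻¹ • γ s)‖) ^ 2 := by ring
          _ ≤ 2 * C ^ 2 := by gcongr
    _ = 2 * C ^ 2 * (π / c) * (L ^ 3)⁻¹ := by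
        rw [integral_const_mul, Measure.integral_comp_mul_left (fun s : ℝ => (1 + s ^ 2)⁻¹),
          integral_univ_inv_one_add_sq, smul_eq_mul, abs_of_pos (by positivity)]
        field_simp

/-- A function with frequencies near the circle `4π²|k|² = r` is almost a generalised
eigenfunction of the Laplacian. -/
theorem IsWire.norm_shiftedForm_sobolevEmb_le (hγ : IsWire γ c) {α r η : ℝ} (hα : 0 < α)
    (hη : 0 ≤ η) {φ : 𝓢(Plane, ℂ)}
    (hφ : ∀ k, 𝓕 φ k ≠ 0 → |4 * π ^ 2 * ‖k‖ ^ 2 - r| ≤ η) :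
    ‖shiftedForm sobolevIncl (deltaForm α (curveMeasure γ)) (r : ℂ) (sobolevEmb φ)‖ ≤
      η * ‖φ.toLp 2 (volume : Measure Plane)‖ +
        α * (‖hγ.trace‖ * ‖hγ.trace (sobolevEmb φ)‖) := by
  -- The residual of the free Laplacian: on the Fourier side it is `(4π²|k|² - r) φ̂` divided by the
  -- square root of a symbol that is at least `1`.
  set ψ : 𝓢(Plane, ℂ) := weightedFourier (1 / 2) φ - (1 + r : ℂ) • weightedFourier (-(1 / 2)) φ
    with hψ
  have h1 : shiftedForm sobolevIncl (deltaForm α (curveMeasure γ)) (r : ℂ) (sobolevEmb φ) =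
      ψ.toLp 2 volume - (α : ℂ) • adjoint hγ.trace (hγ.trace (sobolevEmb φ)) := by
    have h2 : ψ.toLp 2 (volume : Measure Plane) = sobolevEmb φ -
        (1 + r : ℂ) • adjoint sobolevIncl (sobolevIncl (sobolevEmb φ)) := by
      rw [sobolevIncl_emb, adjoint_sobolevIncl_toLp, sobolevEmb_apply]
      exact (map_sub (SchwartzMap.toLpCLM ℂ ℂ 2 (volume : Measure Plane)) _ _).trans
        (congrArg _ (map_smul (SchwartzMap.toLpCLM ℂ ℂ 2 (volume : Measure Plane)) _ _))
    rw [h2, shiftedForm_apply, hγ.deltaForm_apply, add_smul, one_smul]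
    abel
  have hψn : ‖ψ.toLp 2 (volume : Measure Plane)‖ ≤ η * ‖φ.toLp 2 (volume : Measure Plane)‖ := by
    refine le_of_sq_le_sq ?_ (by positivity)
    rw [mul_pow, norm_toLp_sq_eq_fourier φ, SchwartzMap.toLp, norm_toLp_sq, ← integral_const_mul]
    refine integral_mono_of_nonneg (Eventually.of_forall fun k => sq_nonneg _)
      ((integrable_fourier_sq φ).const_mul _) (Eventually.of_forall fun k => ?_)
    simp only
    rw [← mul_pow]
    gcongr
    have h3 : ψ k = (((√(laplaceSymbol 1 k))⁻¹ * (4 * π ^ 2 * ‖k‖ ^ 2 - r) : ℝ) : ℂ) * 𝓕 φ k := by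
      have h4 : ψ k = weightedFourier (1 / 2) φ k -
        (1 + r : ℂ) * weightedFourier (-(1 / 2)) φ k := rfl
      rw [h4, weightedFourier_half_apply, weightedFourier_neg_half_apply]
      have h0 := sqrt_laplaceSymbol_pos k
      have h5 : √(laplaceSymbol 1 k) - (1 + r) * (√(laplaceSymbol 1 k))⁻¹ =
          (√(laplaceSymbol 1 k))⁻¹ * (4 * π ^ 2 * ‖k‖ ^ 2 - r) := by
        have h6 : √(laplaceSymbol 1 k) ^ 2 = 4 * π ^ 2 * ‖k‖ ^ 2 + 1 ^ 2 :=
          Real.sq_sqrt (laplaceSymbol_pos one_pos k).le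
        field_simp
        rw [h6]
        ring
      rw [← h5]
      push_cast
      ring
    rw [h3, norm_mul, Complex.norm_real]
    by_cases hk : 𝓕 φ k = 0
    · simp [hk]
    gcongr
    rw [norm_mul, Real.norm_eq_abs (4 * π ^ 2 * ‖k‖ ^ 2 - r)]
    refine (mul_le_of_le_one_left (abs_nonneg _) ?_).trans (hφ k hk)
    rw [norm_inv, Real.norm_of_nonneg (Real.sqrt_nonneg _)]
    refine inv_le_one_of_one_le₀ (Real.one_le_sqrt.2 ?_)
    unfold laplaceSymbol
    have : 0 ≤ 4 * π ^ 2 * ‖k‖ ^ 2 := by positivity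
    linarith
  rw [h1]
  refine (norm_sub_le _ _).trans (add_le_add hψn ?_)
  rw [norm_smul, Complex.norm_real, Real.norm_of_nonneg hα.le]
  gcongr
  refine ((adjoint hγ.trace).le_opNorm _).trans (le_of_eq ?_)
  rw [LinearIsometryEquiv.norm_map]

/-- Approximate eigenfunctions for the nonnegative part of the essential spectrum. -/
theorem IsWire.exists_approx_eigenvector_of_nonneg (hγ : IsWire γ c) {α : ℝ} (hα : 0 < α) {r : ℝ}
    (hr : 0 ≤ r) {ε : ℝ} (hε : 0 < ε) :
    ∃ h ≠ 0, ‖shiftedForm sobolevIncl (deltaForm α (curveMeasure γ)) (r : ℂ) h‖ ≤ ε * ‖h‖ := by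
  obtain ⟨G, hGs, hG0⟩ := exists_schwartz_supported
  set N := ∫ k, ‖G k‖ ^ 2 with hN
  obtain ⟨K, hK, hKb⟩ := hγ.norm_trace_sq_le_of_fourier_eq_comp G
  set k₀ : Plane := (√r / (2 * π)) • e 0 with hk₀
  have hk₀n : 4 * π ^ 2 * ‖k₀‖ ^ 2 = r := by
    have h1 := norm_smul_e_sub (√r / (2 * π)) 0
    rw [zero_smul, sub_zero, sub_zero] at h1
    rw [hk₀, h1, sq_abs, div_pow, Real.sq_sqrt hr]
    field_simp
    ring
  -- On the support `‖k - k₀‖ ≤ 2/L ≤ 2`. Factoring the difference of squares then gives the spread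
  -- `Q/L` in energy.
  set Q : ℝ := 4 * π ^ 2 * (2 * (2 * ‖k₀‖ + 2)) with hQ
  have hQ0 : 0 < Q := by positivity
  -- `P/L` bounds the ratio of the squared interaction residual to the squared `L²` norm of the
  -- packet: `L⁻³` against `L⁻²`.
  set P : ℝ := (α * ‖hγ.trace‖) ^ 2 * (K / N) with hP
  have hP0 : 0 ≤ P := by positivity
  set L : ℝ := max (max 1 ‖γ 0‖) (max (2 * Q / ε) (4 * P / ε ^ 2)) with hL
  have hL1 : 1 ≤ L := (le_max_left _ _).trans (le_max_left _ _)
  have hLγ : ‖γ 0‖ ≤ L := (le_max_right _ _).trans (le_max_left _ _)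
  have hLQ : 2 * Q / ε ≤ L := (le_max_left _ _).trans (le_max_right _ _)
  have hLP : 4 * P / ε ^ 2 ≤ L := (le_max_right _ _).trans (le_max_right _ _)
  have hL0 : 0 < L := by linarith
  obtain ⟨φ, hφ⟩ := exists_fourier_eq_comp G k₀ hL0
  have hφn : ‖φ.toLp 2 (volume : Measure Plane)‖ ^ 2 = (L ^ 2)⁻¹ * N := by
    rw [norm_toLp_sq_eq_fourier, integral_fourier_sq_of_eq_comp hL0 hφ]
  have hφ0 : 0 < ‖φ.toLp 2 (volume : Measure Plane)‖ := by
    refine lt_of_le_of_ne (norm_nonneg _) fun h0 => ?_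
    rw [← h0] at hφn
    have : 0 < (L ^ 2)⁻¹ * N := by positivity
    norm_num at hφn
    rcases hφn with h | h <;> linarith
  have hle := norm_toLp_le_norm_sobolevEmb φ
  rw [one_mul] at hle
  have hfreq : ∀ k, 𝓕 φ k ≠ 0 → |4 * π ^ 2 * ‖k‖ ^ 2 - r| ≤ Q / L := fun k hk => by
    rw [hφ] at hk
    have h1 := hGs _ hk
    rw [norm_smul, Real.norm_of_nonneg hL0.le] at h1
    have h2 : ‖k - k₀‖ ≤ 2 / L := by rw [le_div_iff₀ hL0]; linarith
    have h3 : ‖k - k₀‖ ≤ 2 := h2.trans (div_le_self (by norm_num) hL1)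
    have h4 : |‖k‖ - ‖k₀‖| ≤ 2 / L := (abs_norm_sub_norm_le _ _).trans h2
    have h5 : ‖k‖ ≤ ‖k₀‖ + 2 := by
      have := norm_sub_norm_le k k₀
      linarith
    rw [← hk₀n, ← mul_sub, abs_mul, abs_of_pos (by positivity : 0 < 4 * π ^ 2), sq_sub_sq,
      abs_mul, abs_of_nonneg (by positivity : 0 ≤ ‖k‖ + ‖k₀‖)]
    calc 4 * π ^ 2 * ((‖k‖ + ‖k₀‖) * |‖k‖ - ‖k₀‖|)
        ≤ 4 * π ^ 2 * ((‖k₀‖ + 2 + ‖k₀‖) * (2 / L)) := by gcongr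
      _ = Q / L := by rw [hQ]; ring
  have hT : α * (‖hγ.trace‖ * ‖hγ.trace (sobolevEmb φ)‖) ≤
      ε / 2 * ‖φ.toLp 2 (volume : Measure Plane)‖ := by
    refine le_of_sq_le_sq ?_ (by positivity)
    rw [mul_pow (ε / 2), hφn, ← mul_assoc, mul_pow]
    calc (α * ‖hγ.trace‖) ^ 2 * ‖hγ.trace (sobolevEmb φ)‖ ^ 2
        ≤ (α * ‖hγ.trace‖) ^ 2 * (K * (L ^ 3)⁻¹) := by
          gcongr
          exact hKb k₀ L φ hL0 hLγ hφ
      _ = P / L * ((L ^ 2)⁻¹ * N) := by rw [hP]; field_simp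
      _ ≤ (ε / 2) ^ 2 * ((L ^ 2)⁻¹ * N) := by
          gcongr
          rw [div_le_iff₀ hL0]
          rw [div_le_iff₀ (by positivity)] at hLP
          linarith
  have hQL : Q / L ≤ ε / 2 := by
    rw [div_le_iff₀ hL0]
    rw [div_le_iff₀ hε] at hLQ
    linarith
  refine ⟨sobolevEmb φ, norm_ne_zero_iff.1 (hφ0.trans_le hle).ne', ?_⟩
  refine (hγ.norm_shiftedForm_sobolevEmb_le hα (by positivity) hfreq).trans ?_
  calc Q / L * ‖φ.toLp 2 (volume : Measure Plane)‖ +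
        α * (‖hγ.trace‖ * ‖hγ.trace (sobolevEmb φ)‖)
      ≤ ε / 2 * ‖φ.toLp 2 (volume : Measure Plane)‖ +
        ε / 2 * ‖φ.toLp 2 (volume : Measure Plane)‖ := add_le_add (by gcongr) hT
    _ = ε * ‖φ.toLp 2 (volume : Measure Plane)‖ := by ring
    _ ≤ ε * ‖sobolevEmb φ‖ := by gcongr

end WavePackets

end LeakyWire

end

theorem proposition5p1 (α : ℝ) (hα : 0 < α) (γ : ℝ → LeakyWire.Plane)
    (hcont : Continuous γ) (hC1 : LeakyWire.IsPiecewiseC1 γ)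
    (harc : LeakyWire.IsArcLengthParametrized γ)
    (ha1 : LeakyWire.ConditionA1 γ) (ha2 : LeakyWire.ConditionA2 γ) :
    ∃ H : LeakyWire.L2Plane →ₗ.[ℂ] LeakyWire.L2Plane,
      LeakyWire.IsLeakyHamiltonian α γ H ∧ IsSelfAdjoint H ∧
      LeakyWire.essentialSpectrum H = Complex.ofReal '' Set.Ici (-(α ^ 2 / 4)) := by
  have := LeakyWire.hasTemperateGrowth_curveMeasure hcont hC1 harc ha1
  obtain ⟨c, hc, -, hlower⟩ := id ha1
  have hγ : LeakyWire.IsWire γ c :=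
    { cont := hcont
      pos := hc
      lower := hlower
      upper := LeakyWire.norm_sub_le_abs_of_arcLength hcont hC1 harc
      injective := ha1.injective
      measurePreserving := LeakyWire.measurePreserving_curve hcont hC1 harc ha1 }
  have hF := hγ.isSemiboundedForm hα
  refine ⟨_, LeakyWire.isFormOperator_formOp hγ.norm_toLp_le hF, hF.isSelfAdjoint,
    hF.essentialSpectrum_eq (fun r hr => hγ.exists_coercive_orthogonal ha1 ha2 hα hr)
      fun r hr ε hε => ?_⟩
  rcases lt_or_ge r 0 with h0 | h0
  · exact hγ.exists_approx_eigenvector_of_neg ha1 ha2 hα hr h0 hε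
  · exact hγ.exists_approx_eigenvector_of_nonneg hα h0 hε
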